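/- Let $S$ be an inverse semigroup with unit $1$, with $s\le t$ meaning $s=te$ for some idempotent $e$. A *Fell bundle* $\mathcal A=(A_s)_{s\in S}$ over $S$ consists of complex Banach spaces $A_s$, bilinear products $A_s\times A_t\to A_{st}$, conjugate-linear involutions $A_s\to A_{s^*}$ and linear isometric inclusions $A_s\hookrightarrow A_t$ for $s\le t$ such that the product is associative, $a^{**}=a$, $(ab)^*=b^*a^*$, the inclusions are functorial and compatible with products and involutions, $\|ab\|\le\|a\|\|b\|$, $\|a^*\|=\|a\|$, $\|a^*a\|=\|a\|^2$, and $a^*a$ is a positive element of the $C^*$-algebra $A_1$ for all $a\in A_s$, $s\in S$. (No saturation is assumed.) Let $A_s''$ denote the weak closure of $A_s$ in the universal representation of $\mathcal A$, so that $A_1''$ is the enveloping von Neumann algebra of $A_1$. For $s\in S$ let $I_{s,1}$ be the closed two-sided ideal of $A_1$ generated by the subspaces $A_{v^*v}$ with $v\le s$ and $v\le 1$, and let $1_s\in I_{s,1}''\subseteq A_1''$ be the unit of $I_{s,1}''$. The bundle $\mathcal A$ has the *approximation property* if there is a net $(\xi_i)_{i\in I}$ of finitely supported functions $\xi_i\colon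 S\to A_1$ with $\xi_i(s)\in A_{ss^*}$ for all $s\in S$ such that (i) $\displaystyle\sup_{i\in I}\Bigl\|\sum_{p,t\in S}\xi_i(p)^*\,\xi_i(t)\,1_{pt^*}\Bigr\|<\infty$, and (ii) for all $s\in S$ and $a\in A_s$, $\displaystyle\sum_{p,t\in S}1_{p(st)^*}\,\xi_i(p)^*\,a\,\xi_i(t)\longrightarrow a$ in norm (in $A_s''$). For a $C^*$-algebra $B$, let $\mathcal A\otimes_{\min}B$ (respectively $\mathcal A\otimes_{\max}B$) be the Fell bundle over $S$ whose fibre at $s$ is the completion of the algebraic tensor product $A_s\odot B$ in the norm $\|x\|=\|x^*x\|^{1/2}$, where the norm of $x^*x\in A_1\odot B$ is taken in $A_1\otimes_{\min}B$ (respectively $A_1\otimes_{\max}B$), with products, involutions and inclusions extending $(a\otimes b)(a'\otimes b')=aa'\otimes bb'$, $(a\otimes b)^*=a^*\otimes b^*$ and $a\otimes b\mapsto a\otimes b$. **Proposition.** If $\mathcal A$ is a Fell bundle over an inverse semigroup $S$ with unit and $\mathcal A$ has the approximation property, then, for every $C^*$-algebra $B$, both $\mathcal A\otimes_{\min}B$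 and $\mathcal A\otimes_{\max}B$ have the approximation property. -/

import Mathlib

universe u v

noncomputable section

open scoped TensorProduct InnerProductSpace ComplexConjugate

/-- An inverse semigroup with unit: a monoid in which every element `s` has exactly one
generalised inverse `s⁻¹`. -/
class InverseMonoid (S : Type u) extends Monoid S, Inv S where
  mul_inv_mul : ∀ s : S, s * s⁻¹ * s = s
  inv_mul_inv : ∀ s : S, s⁻¹ * s * s⁻¹ = s⁻¹
  inv_unique : ∀ s t : S, s * t * s = s → t * s * t = t → t = s⁻¹

namespace InverseMonoid

variable {S : Type u} [InverseMonoid S]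

/-- The natural partial order: `s ≤ t` iff `s = t e` for some idempotent `e`. -/
instance : LE S := ⟨fun s t => ∃ e : S, e * e = e ∧ t * e = s⟩

theorem le_of_eq {s t : S} (h : s = t) : s ≤ t := ⟨1, by simp, by simp [h]⟩

theorem idem_inv {e : S} (h : e * e = e) : e⁻¹ = e :=
  (inv_unique e e (by simp [h]) (by simp [h])).symm

protected theorem inv_inv (s : S) : s⁻¹⁻¹ = s :=
  (inv_unique s⁻¹ s (inv_mul_inv s) (mul_inv_mul s)).symm

protected theorem one_inv : (1 : S)⁻¹ = 1 := idem_inv (by simp)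

theorem idem_mul {e f : S} (he : e * e = e) (hf : f * f = f) : (e * f) * (e * f) = e * f := by
  have h1 := mul_inv_mul (e * f)
  have h2 := inv_mul_inv (e * f)
  set x := (e * f)⁻¹ with hx
  have hfx : f * x * e = x := by
    apply inv_unique
    · calc e * f * (f * x * e) * (e * f) = e * (f * f) * x * (e * e) * f := by
            simp only [mul_assoc]
        _ = e * f := by rw [hf, he]; simpa only [mul_assoc] using h1
    · calc f * x * e * (e * f) * (f * x * e) = f * (x * ((e * e) * (f * f)) * x) * e := by
            simp only [mul_assoc]
        _ = f * x * e := by rw [hf, he, h2]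
  have hxx : x * x = x := by
    conv_lhs => rw [← hfx]
    calc f * x * e * (f * x * e) = f * (x * (e * f) * x) * e := by simp only [mul_assoc]
      _ = x := by rw [h2, hfx]
  have h3 : e * f = x := by
    rw [← InverseMonoid.inv_inv (e * f), ← hx, idem_inv hxx]
  rw [h3, hxx]

theorem idem_comm {e f : S} (he : e * e = e) (hf : f * f = f) : e * f = f * e := by
  have h1 := idem_mul he hf
  have h2 := idem_mul hf he
  have : f * e = (e * f)⁻¹ := by
    apply inv_unique
    · calc e * f * (f * e) * (e * f) = e * (f * f) * (e * e) * f := by simp only [mul_assoc]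
        _ = e * f := by rw [hf, he]; simpa only [mul_assoc] using h1
    · calc f * e * (e * f) * (f * e) = f * (e * e) * (f * f) * e := by simp only [mul_assoc]
        _ = f * e := by rw [hf, he]; simpa only [mul_assoc] using h2
  rw [this, idem_inv h1]

theorem inv_mul_idem (s : S) : s⁻¹ * s * (s⁻¹ * s) = s⁻¹ * s := by
  rw [← mul_assoc, inv_mul_inv]

theorem mul_inv_idem (s : S) : s * s⁻¹ * (s * s⁻¹) = s * s⁻¹ := by
  rw [← mul_assoc, mul_inv_mul]

protected theorem mul_inv_rev (s t : S) : (s * t)⁻¹ = t⁻¹ * s⁻¹ := by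
  have hc := idem_comm (inv_mul_idem s) (mul_inv_idem t)
  symm
  apply inv_unique
  · calc s * t * (t⁻¹ * s⁻¹) * (s * t) = s * ((t * t⁻¹) * (s⁻¹ * s)) * t := by
          simp only [mul_assoc]
      _ = (s * s⁻¹ * s) * (t * t⁻¹ * t) := by rw [← hc]; simp only [mul_assoc]
      _ = s * t := by rw [mul_inv_mul, mul_inv_mul]
  · calc t⁻¹ * s⁻¹ * (s * t) * (t⁻¹ * s⁻¹) = t⁻¹ * ((s⁻¹ * s) * (t * t⁻¹)) * s⁻¹ := by
          simp only [mul_assoc]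
      _ = (t⁻¹ * t * t⁻¹) * (s⁻¹ * s * s⁻¹) := by rw [hc]; simp only [mul_assoc]
      _ = t⁻¹ * s⁻¹ := by rw [inv_mul_inv, inv_mul_inv]

theorem le_trans' {r s t : S} (h₁ : r ≤ s) (h₂ : s ≤ t) : r ≤ t := by
  obtain ⟨e, he, rfl⟩ := h₁
  obtain ⟨f, hf, rfl⟩ := h₂
  exact ⟨f * e, idem_mul hf he, by rw [mul_assoc]⟩

theorem mul_le_mul {s₁ s₂ t₁ t₂ : S} (h₁ : s₁ ≤ t₁) (h₂ : s₂ ≤ t₂) : s₁ * s₂ ≤ t₁ * t₂ := by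
  obtain ⟨e, he, rfl⟩ := h₁
  obtain ⟨f, hf, rfl⟩ := h₂
  have hc := idem_comm he (mul_inv_idem t₂)
  refine ⟨t₂⁻¹ * e * t₂ * f, idem_mul ?_ hf, ?_⟩
  · calc t₂⁻¹ * e * t₂ * (t₂⁻¹ * e * t₂) = t₂⁻¹ * (e * (t₂ * t₂⁻¹)) * e * t₂ := by
          simp only [mul_assoc]
      _ = (t₂⁻¹ * t₂ * t₂⁻¹) * (e * e) * t₂ := by rw [hc]; simp only [mul_assoc]
      _ = _ := by rw [inv_mul_inv, he]
  · calc t₁ * t₂ * (t₂⁻¹ * e * t₂ * f) = t₁ * ((t₂ * t₂⁻¹) * e) * t₂ * f := by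
          simp only [mul_assoc]
      _ = t₁ * e * (t₂ * t₂⁻¹ * t₂) * f := by rw [← hc]; simp only [mul_assoc]
      _ = _ := by rw [mul_inv_mul]; simp only [mul_assoc]

theorem inv_le_inv {s t : S} (h : s ≤ t) : s⁻¹ ≤ t⁻¹ := by
  obtain ⟨e, he, rfl⟩ := h
  have hc := idem_comm he (mul_inv_idem t⁻¹)
  rw [InverseMonoid.inv_inv] at hc
  refine ⟨t * e * t⁻¹, ?_, ?_⟩
  · calc t * e * t⁻¹ * (t * e * t⁻¹) = t * (e * (t⁻¹ * t)) * e * t⁻¹ := by simp only [mul_assoc]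
      _ = (t * t⁻¹ * t) * (e * e) * t⁻¹ := by rw [hc]; simp only [mul_assoc]
      _ = _ := by rw [mul_inv_mul, he]
  · calc t⁻¹ * (t * e * t⁻¹) = ((t⁻¹ * t) * e) * t⁻¹ := by simp only [mul_assoc]
      _ = e * (t⁻¹ * t * t⁻¹) := by rw [← hc]; simp only [mul_assoc]
      _ = _ := by rw [inv_mul_inv, InverseMonoid.mul_inv_rev, idem_inv he]

theorem inv_mul_le_one (s : S) : s⁻¹ * s ≤ 1 := ⟨s⁻¹ * s, inv_mul_idem s, one_mul _⟩

theorem mul_inv_le_one (s : S) : s * s⁻¹ ≤ 1 := ⟨s * s⁻¹, mul_inv_idem s, one_mul _⟩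

end InverseMonoid

open InverseMonoid

/-- An (algebraic) `*`-bundle over the inverse monoid `S`: complex vector spaces `A s` with bilinear
multiplications `A s × A t → A (s t)`, conjugate-linear involutions `A s → A s⁻¹` and inclusions
`A s → A t` for `s ≤ t`, subject to associativity, `a** = a`, `(ab)* = b* a*`, and the
compatibility of the inclusions with each other, with products and with involutions.
The inclusion attached to an equality `s = t` is the transport `A s = A t`, and it is used to
compare elements of fibres with equal indices. -/
structure AlgBundle {S : Type u} [InverseMonoid S] (A : S → Type v)
    [∀ s, AddCommGroup (A s)] [∀ s, Module ℂ (A s)] where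
  mul : ∀ s t : S, A s →ₗ[ℂ] A t →ₗ[ℂ] A (s * t)
  star : ∀ s : S, A s →ₗ⋆[ℂ] A s⁻¹
  incl : ∀ {s t : S}, s ≤ t → (A s →ₗ[ℂ] A t)
  incl_refl : ∀ {s : S} (h : s ≤ s) (a : A s), incl h a = a
  incl_incl : ∀ {r s t : S} (h₁ : r ≤ s) (h₂ : s ≤ t) (h : r ≤ t) (a : A r),
    incl h₂ (incl h₁ a) = incl h a
  incl_mul : ∀ {s₁ s₂ t₁ t₂ : S} (h₁ : s₁ ≤ t₁) (h₂ : s₂ ≤ t₂) (h : s₁ * s₂ ≤ t₁ * t₂)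
    (a : A s₁) (b : A s₂), incl h (mul s₁ s₂ a b) = mul t₁ t₂ (incl h₁ a) (incl h₂ b)
  incl_star : ∀ {s t : S} (h : s ≤ t) (h' : s⁻¹ ≤ t⁻¹) (a : A s),
    incl h' (star s a) = star t (incl h a)
  mul_assoc : ∀ (r s t : S) (h : r * s * t ≤ r * (s * t)) (a : A r) (b : A s) (c : A t),
    incl h (mul (r * s) t (mul r s a b) c) = mul r (s * t) a (mul s t b c)
  star_star : ∀ (s : S) (h : s⁻¹⁻¹ ≤ s) (a : A s), incl h (star s⁻¹ (star s a)) = a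
  star_mul : ∀ (s t : S) (h : (s * t)⁻¹ ≤ t⁻¹ * s⁻¹) (a : A s) (b : A t),
    incl h (star (s * t) (mul s t a b)) = mul t⁻¹ s⁻¹ (star t b) (star s a)

/-- A normed `*`-bundle: a `*`-bundle with seminormed fibres, isometric inclusions and involutions,
submultiplicative products, and the `C*`-identity `‖a* a‖ = ‖a‖²`. -/
structure StarBundle {S : Type u} [InverseMonoid S] (A : S → Type v)
    [∀ s, SeminormedAddCommGroup (A s)] [∀ s, NormedSpace ℂ (A s)] extends AlgBundle A where
  norm_incl : ∀ {s t : S} (h : s ≤ t) (a : A s), ‖incl h a‖ = ‖a‖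
  norm_mul_le : ∀ (s t : S) (a : A s) (b : A t), ‖mul s t a b‖ ≤ ‖a‖ * ‖b‖
  norm_star : ∀ (s : S) (a : A s), ‖star s a‖ = ‖a‖
  norm_star_mul_self : ∀ (s : S) (a : A s), ‖mul s⁻¹ s (star s a) a‖ = ‖a‖ ^ 2

namespace AlgBundle

variable {S : Type u} [InverseMonoid S] {A : S → Type v}
  [∀ s, AddCommGroup (A s)] [∀ s, Module ℂ (A s)] (𝓐 : AlgBundle A)

/-- The product `a b`, regarded as an element of a fibre `A r` with `s t ≤ r`. -/
def mulTo {s t r : S} (h : s * t ≤ r) (a : A s) (b : A t) : A r := 𝓐.incl h (𝓐.mul s t a b)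

/-- The adjoint `a*`, regarded as an element of a fibre `A r` with `s⁻¹ ≤ r`. -/
def starTo {s r : S} (h : s⁻¹ ≤ r) (a : A s) : A r := 𝓐.incl h (𝓐.star s a)

/-- The element `a* b` of the unit fibre, for `a`, `b` in the same fibre. -/
def ip {s : S} (a b : A s) : A 1 := 𝓐.mulTo (inv_mul_le_one s) (𝓐.star s a) b

/-- The left action of the unit fibre on the fibre at `s`. -/
def lact {s : S} (c : A 1) (a : A s) : A s := 𝓐.mulTo (le_of_eq (one_mul s)) c a

/-- The product of the unit fibre. -/
def mulOne (c d : A 1) : A 1 := 𝓐.mulTo (le_of_eq (one_mul 1)) c d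

/-- The involution of the unit fibre. -/
def starOne (c : A 1) : A 1 := 𝓐.starTo (le_of_eq InverseMonoid.one_inv) c

theorem mulTo_incl {s t s' t' r : S} (hs : s ≤ s') (ht : t ≤ t') (h : s' * t' ≤ r)
    (a : A s) (b : A t) : 𝓐.mulTo h (𝓐.incl hs a) (𝓐.incl ht b) =
      𝓐.mulTo (le_trans' (mul_le_mul hs ht) h) a b := by
  rw [mulTo, ← 𝓐.incl_mul hs ht (mul_le_mul hs ht), 𝓐.incl_incl _ _ (le_trans' (mul_le_mul hs ht) h)]
  rfl

theorem mulTo_incl_left {s t s' r : S} (hs : s ≤ s') (h : s' * t ≤ r)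
    (a : A s) (b : A t) : 𝓐.mulTo h (𝓐.incl hs a) b =
      𝓐.mulTo (le_trans' (mul_le_mul hs (le_of_eq rfl)) h) a b := by
  conv_lhs => rw [← 𝓐.incl_refl (le_of_eq rfl) b]
  exact 𝓐.mulTo_incl hs (le_of_eq rfl) h a b

theorem mulTo_incl_right {s t t' r : S} (ht : t ≤ t') (h : s * t' ≤ r)
    (a : A s) (b : A t) : 𝓐.mulTo h a (𝓐.incl ht b) =
      𝓐.mulTo (le_trans' (mul_le_mul (le_of_eq rfl) ht) h) a b := by
  conv_lhs => rw [← 𝓐.incl_refl (le_of_eq rfl) a]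
  exact 𝓐.mulTo_incl (le_of_eq rfl) ht h a b

theorem incl_mulTo {s t r r' : S} (h : s * t ≤ r) (hr : r ≤ r') (a : A s) (b : A t) :
    𝓐.incl hr (𝓐.mulTo h a b) = 𝓐.mulTo (le_trans' h hr) a b :=
  𝓐.incl_incl _ _ _ _

theorem starTo_incl {s s' r : S} (hs : s ≤ s') (h : s'⁻¹ ≤ r) (a : A s) :
    𝓐.starTo h (𝓐.incl hs a) = 𝓐.starTo (le_trans' (inv_le_inv hs) h) a := by
  rw [starTo, ← 𝓐.incl_star hs (inv_le_inv hs), 𝓐.incl_incl _ _ (le_trans' (inv_le_inv hs) h)]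
  rfl

theorem incl_starTo {s r r' : S} (h : s⁻¹ ≤ r) (hr : r ≤ r') (a : A s) :
    𝓐.incl hr (𝓐.starTo h a) = 𝓐.starTo (le_trans' h hr) a :=
  𝓐.incl_incl _ _ _ _

theorem mulTo_assoc {r s t p q z : S} (h₁ : r * s ≤ p) (h₂ : p * t ≤ z) (h₃ : s * t ≤ q)
    (h₄ : r * q ≤ z) (a : A r) (b : A s) (c : A t) :
    𝓐.mulTo h₂ (𝓐.mulTo h₁ a b) c = 𝓐.mulTo h₄ a (𝓐.mulTo h₃ b c) := by
  have hl : 𝓐.mulTo h₂ (𝓐.mulTo h₁ a b) c = _ := 𝓐.mulTo_incl_left h₁ h₂ (𝓐.mul r s a b) c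
  have hr : 𝓐.mulTo h₄ a (𝓐.mulTo h₃ b c) = _ := 𝓐.mulTo_incl_right h₃ h₄ a (𝓐.mul s t b c)
  rw [hl, hr, mulTo, mulTo, ← 𝓐.mul_assoc r s t (le_of_eq (_root_.mul_assoc _ _ _)),
    𝓐.incl_incl]

theorem starTo_mulTo {s t p q q' r : S} (h₁ : s * t ≤ p) (h₂ : p⁻¹ ≤ r) (h₃ : t⁻¹ ≤ q)
    (h₄ : s⁻¹ ≤ q') (h₅ : q * q' ≤ r) (a : A s) (b : A t) :
    𝓐.starTo h₂ (𝓐.mulTo h₁ a b) = 𝓐.mulTo h₅ (𝓐.starTo h₃ b) (𝓐.starTo h₄ a) := by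
  rw [mulTo, starTo_incl]
  conv_rhs => rw [starTo, starTo, mulTo_incl]
  rw [mulTo, ← 𝓐.star_mul s t (le_of_eq (InverseMonoid.mul_inv_rev s t)), 𝓐.incl_incl]
  rfl

theorem starTo_starTo {s p r : S} (h₁ : s⁻¹ ≤ p) (h₂ : p⁻¹ ≤ r) (h : s ≤ r) (a : A s) :
    𝓐.starTo h₂ (𝓐.starTo h₁ a) = 𝓐.incl h a := by
  conv_lhs => enter [3]; rw [starTo]
  rw [starTo_incl, starTo, ← 𝓐.incl_incl (le_of_eq (InverseMonoid.inv_inv s)) h, 𝓐.star_star]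

theorem star_eq_starTo {s : S} (a : A s) : 𝓐.star s a = 𝓐.starTo (le_of_eq rfl) a :=
  (𝓐.incl_refl _ _).symm

theorem ip_eq_mulOne (c d : A 1) : 𝓐.ip c d = 𝓐.mulOne (𝓐.starOne c) d := by
  rw [mulOne, starOne, starTo, mulTo_incl_left]; rfl

theorem ip_incl {s t : S} (h : s ≤ t) (a b : A s) :
    𝓐.ip (𝓐.incl h a) (𝓐.incl h b) = 𝓐.ip a b := by
  rw [ip, ← 𝓐.incl_star h (inv_le_inv h), mulTo_incl]; rfl

theorem ip_mul {s t : S} (a a' : A s) (b b' : A t) :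
    𝓐.ip (𝓐.mul s t a b) (𝓐.mul s t a' b') = 𝓐.ip b (𝓐.lact (𝓐.ip a a') b') := by
  have h1 : 𝓐.star (s * t) (𝓐.mul s t a b) =
      𝓐.mulTo (le_of_eq (InverseMonoid.mul_inv_rev s t).symm) (𝓐.star t b) (𝓐.star s a) := by
    rw [mulTo, ← 𝓐.star_mul s t (le_of_eq (InverseMonoid.mul_inv_rev s t)),
      𝓐.incl_incl _ _ (le_of_eq rfl), 𝓐.incl_refl]
  have h2 : 𝓐.mul s t a' b' = 𝓐.mulTo (le_of_eq rfl) a' b' := (𝓐.incl_refl _ _).symm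
  have hle : s⁻¹ * (s * t) ≤ t := by
    rw [← _root_.mul_assoc]
    simpa using mul_le_mul (inv_mul_le_one s) (le_of_eq (rfl : t = t))
  rw [ip, ip, ip, lact, h1, 𝓐.mulTo_assoc _ _ hle (inv_mul_le_one t), h2]
  congr 1
  exact (𝓐.mulTo_assoc _ _ _ _ _ _ _).symm

theorem ip_star {s : S} (a : A s) :
    𝓐.ip (𝓐.star s a) (𝓐.star s a) = 𝓐.mulTo (mul_inv_le_one s) a (𝓐.star s a) := by
  conv_rhs => rw [← 𝓐.star_star s (le_of_eq (InverseMonoid.inv_inv s)) a]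
  rw [mulTo_incl_left, 𝓐.star_star s (le_of_eq (InverseMonoid.inv_inv s)) a]; rfl

theorem ip_lact {s : S} (c : A 1) (a b : A s) :
    𝓐.ip (𝓐.lact c a) b = 𝓐.ip a (𝓐.lact (𝓐.starOne c) b) := by
  rw [ip, star_eq_starTo, lact, 𝓐.starTo_mulTo _ _ (le_of_eq rfl)
    (le_of_eq InverseMonoid.one_inv) (le_of_eq (by simp)), ← star_eq_starTo,
    𝓐.mulTo_assoc _ _ (le_of_eq (one_mul s)) (inv_mul_le_one s)]
  rfl

theorem starOne_ip {s : S} (a b : A s) : 𝓐.starOne (𝓐.ip a b) = 𝓐.ip b a := by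
  rw [starOne, ip, 𝓐.starTo_mulTo _ _ (le_of_eq rfl) (le_of_eq (InverseMonoid.inv_inv s))
    (inv_mul_le_one s), ← star_eq_starTo, star_eq_starTo _ a,
    𝓐.starTo_starTo _ _ (le_of_eq rfl), 𝓐.incl_refl]
  rfl

theorem lact_lact {s : S} (c d : A 1) (a : A s) :
    𝓐.lact c (𝓐.lact d a) = 𝓐.lact (𝓐.mulOne c d) a :=
  (𝓐.mulTo_assoc _ _ _ _ _ _ _).symm

theorem ip_add_left {s : S} (a a' b : A s) : 𝓐.ip (a + a') b = 𝓐.ip a b + 𝓐.ip a' b := by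
  simp [ip, mulTo]

theorem ip_add_right {s : S} (a b b' : A s) : 𝓐.ip a (b + b') = 𝓐.ip a b + 𝓐.ip a b' := by
  simp [ip, mulTo]

theorem ip_smul_left {s : S} (z : ℂ) (a b : A s) : 𝓐.ip (z • a) b = conj z • 𝓐.ip a b := by
  simp [ip, mulTo]

theorem ip_smul_right {s : S} (z : ℂ) (a b : A s) : 𝓐.ip a (z • b) = z • 𝓐.ip a b := by
  simp [ip, mulTo]

end AlgBundle

namespace StarBundle

open AlgBundle

variable {S : Type u} [InverseMonoid S] {A : S → Type v}
  [∀ s, SeminormedAddCommGroup (A s)] [∀ s, NormedSpace ℂ (A s)] (𝓐 : StarBundle A)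

theorem norm_mulTo_le {s t r : S} (h : s * t ≤ r) (a : A s) (b : A t) :
    ‖𝓐.mulTo h a b‖ ≤ ‖a‖ * ‖b‖ := by
  rw [mulTo, 𝓐.norm_incl]
  exact 𝓐.norm_mul_le s t a b

theorem norm_ip_self {s : S} (a : A s) : ‖𝓐.ip a a‖ = ‖a‖ ^ 2 := by
  rw [ip, mulTo, 𝓐.norm_incl, 𝓐.norm_star_mul_self]

/-- The unit fibre of a bundle with complete fibres, as a `C*`-algebra. -/
@[reducible]
def cstarAlgebraOne {A : S → Type v} [∀ s, NormedAddCommGroup (A s)] [∀ s, NormedSpace ℂ (A s)]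
    [∀ s, CompleteSpace (A s)] (𝓐 : StarBundle A) : NonUnitalCStarAlgebra (A 1) where
  __ := (inferInstance : NormedAddCommGroup (A 1))
  __ := (inferInstance : NormedSpace ℂ (A 1))
  __ := (inferInstance : CompleteSpace (A 1))
  mul := 𝓐.mulOne
  star := 𝓐.starOne
  left_distrib c d e := by
    change 𝓐.mulTo _ _ _ = 𝓐.mulTo _ _ _ + 𝓐.mulTo _ _ _
    simp [mulTo]
  right_distrib c d e := by
    change 𝓐.mulTo _ _ _ = 𝓐.mulTo _ _ _ + 𝓐.mulTo _ _ _
    simp [mulTo]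
  zero_mul c := by
    change 𝓐.mulTo _ _ _ = _
    simp [mulTo]
  mul_zero c := by
    change 𝓐.mulTo _ _ _ = _
    simp [mulTo]
  mul_assoc c d e := 𝓐.mulTo_assoc _ _ _ _ c d e
  norm_mul_le c d := 𝓐.norm_mulTo_le _ c d
  star_involutive c := by
    change 𝓐.starTo _ (𝓐.starTo _ c) = c
    rw [𝓐.starTo_starTo _ _ (le_of_eq rfl), 𝓐.incl_refl]
  star_mul c d := 𝓐.starTo_mulTo _ _ _ _ _ c d
  star_add c d := by
    change 𝓐.starTo _ _ = 𝓐.starTo _ _ + 𝓐.starTo _ _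
    simp [starTo]
  norm_mul_self_le c := by
    change _ ≤ ‖𝓐.mulOne (𝓐.starOne c) c‖
    rw [← ip_eq_mulOne, norm_ip_self, sq]
  smul_assoc z c d := by
    change 𝓐.mulTo _ _ _ = z • 𝓐.mulTo _ _ _
    simp [mulTo]
  smul_comm z c d := by
    change z • 𝓐.mulTo _ _ _ = 𝓐.mulTo _ _ _
    simp [mulTo]
  star_smul z c := by
    change 𝓐.starTo _ _ = _ • 𝓐.starTo _ _
    simp [starTo]

end StarBundle

/-- A Fell bundle over the inverse monoid `S`: Banach spaces `A s` with products, involutions and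
inclusions as above, such that `a* a` is a positive element of the `C*`-algebra `A 1` for every
`a ∈ A s`, that is, `a* a = c* c` for some `c ∈ A 1`. -/
structure FellBundle (S : Type u) [InverseMonoid S] where
  fibre : S → Type u
  [normed : ∀ s, NormedAddCommGroup (fibre s)]
  [space : ∀ s, NormedSpace ℂ (fibre s)]
  [complete : ∀ s, CompleteSpace (fibre s)]
  bundle : StarBundle fibre
  pos : ∀ (s : S) (a : fibre s), ∃ c : fibre 1, bundle.ip a a = bundle.ip c c

namespace FellBundle

variable {S : Type u} [InverseMonoid S] (𝒜 : FellBundle S)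

instance (s : S) : NormedAddCommGroup (𝒜.fibre s) := 𝒜.normed s
instance (s : S) : NormedSpace ℂ (𝒜.fibre s) := 𝒜.space s
instance (s : S) : CompleteSpace (𝒜.fibre s) := 𝒜.complete s
instance : NonUnitalCStarAlgebra (𝒜.fibre 1) := 𝒜.bundle.cstarAlgebraOne

theorem mul_def (c d : 𝒜.fibre 1) : c * d = 𝒜.bundle.mulOne c d := rfl

theorem star_def (c : 𝒜.fibre 1) : star c = 𝒜.bundle.starOne c := rfl

/-- The closed two-sided ideal `I_{s,1}` of the unit fibre generated by the fibres at `v⁻¹ v`, where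
`v` runs over the elements with `v ≤ s` and `v ≤ 1`. -/
def ideal (s : S) : Submodule ℂ (𝒜.fibre 1) :=
  sInf {J | IsClosed (J : Set (𝒜.fibre 1)) ∧ (∀ x ∈ J, ∀ c : 𝒜.fibre 1, c * x ∈ J ∧ x * c ∈ J) ∧
    ∀ v : S, v ≤ s → v ≤ 1 → ∀ a : 𝒜.fibre (v⁻¹ * v), 𝒜.bundle.incl (inv_mul_le_one v) a ∈ J}

/-- A nondegenerate representation of a Fell bundle on a Hilbert space. -/
structure Rep where
  H : Type u
  [normed : NormedAddCommGroup H]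
  [inner : InnerProductSpace ℂ H]
  [complete : CompleteSpace H]
  π : ∀ s : S, 𝒜.fibre s →ₗ[ℂ] (H →L[ℂ] H)
  map_mul : ∀ (s t : S) (a : 𝒜.fibre s) (b : 𝒜.fibre t),
    π (s * t) (𝒜.bundle.mul s t a b) = π s a * π t b
  map_star : ∀ (s : S) (a : 𝒜.fibre s), π s⁻¹ (𝒜.bundle.star s a) = star (π s a)
  map_incl : ∀ (s t : S) (h : s ≤ t) (a : 𝒜.fibre s), π t (𝒜.bundle.incl h a) = π s a
  nondegenerate :
    (Submodule.span ℂ {w : H | ∃ (c : 𝒜.fibre 1) (v : H), w = π 1 c v}).topologicalClosure = ⊤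

namespace Rep

variable {𝒜}

instance (ρ : 𝒜.Rep) : NormedAddCommGroup ρ.H := ρ.normed
instance (ρ : 𝒜.Rep) : InnerProductSpace ℂ ρ.H := ρ.inner
instance (ρ : 𝒜.Rep) : CompleteSpace ρ.H := ρ.complete

/-- The restriction of a representation to the unit fibre. -/
def one (ρ : 𝒜.Rep) : 𝒜.fibre 1 →⋆ₙₐ[ℂ] (ρ.H →L[ℂ] ρ.H) where
  __ := ρ.π 1
  map_zero' := map_zero (ρ.π 1)
  map_mul' c d := (ρ.map_incl _ _ _ _).trans (ρ.map_mul 1 1 c d)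
  map_star' c := (ρ.map_incl _ _ _ _).trans (ρ.map_star 1 c)

theorem norm_le (ρ : 𝒜.Rep) (s : S) (a : 𝒜.fibre s) : ‖ρ.π s a‖ ≤ ‖a‖ := by
  have h : star (ρ.π s a) * ρ.π s a = ρ.one (𝒜.bundle.ip a a) := by
    rw [← ρ.map_star, ← ρ.map_mul]
    exact (ρ.map_incl _ _ _ _).symm
  have h1 : ‖ρ.π s a‖ * ‖ρ.π s a‖ ≤ ‖a‖ * ‖a‖ := by
    rw [← CStarRing.norm_star_mul_self, h, ← sq, ← 𝒜.bundle.norm_ip_self]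
    exact NonUnitalStarAlgHom.norm_apply_le _ _
  exact le_of_sq_le_sq (by simpa only [sq] using h1) (norm_nonneg _)

end Rep

/-- The Hilbert space of the universal representation, which is the direct sum of all nondegenerate
representations on Hilbert spaces of the universe of the fibres. -/
abbrev univSpace : Type (u + 1) := lp (fun ρ : 𝒜.Rep => ρ.H) 2

/-- The universal representation of a Fell bundle on the fibre at `s`. The enveloping von Neumann
bundle consists of the weak closures `A s''` of the ranges of these maps. -/
def univ (s : S) (a : 𝒜.fibre s) : 𝒜.univSpace →L[ℂ] 𝒜.univSpace :=
  lp.mapCLM 2 (fun ρ => ρ.π s a) (norm_nonneg a) (fun ρ => ρ.norm_le s a)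

/-- The unit of the von Neumann algebra `I_{s,1}'' ⊆ A 1''`, that is, the orthogonal projection
onto the closed linear span of `I_{s,1}` applied to the universal Hilbert space. -/
def unit (s : S) : 𝒜.univSpace →L[ℂ] 𝒜.univSpace :=
  (Submodule.span ℂ {w : 𝒜.univSpace |
    ∃ c ∈ 𝒜.ideal s, ∃ v : 𝒜.univSpace, w = 𝒜.univ 1 c v}).topologicalClosure.starProjection

/-- Finitely supported functions `ξ : S → A 1` with `ξ s` in the fibre at `s s⁻¹` for every `s`. -/
def IsSection (ξ : S →₀ 𝒜.fibre 1) : Prop :=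
  ∀ s : S, ∃ a : 𝒜.fibre (s * s⁻¹), ξ s = 𝒜.bundle.incl (mul_inv_le_one s) a

/-- The approximation property of a Fell bundle over an inverse monoid. -/
def ApproximationProperty : Prop :=
  ∃ (ι : Type u) (_ : Preorder ι) (_ : IsDirectedOrder ι) (_ : Nonempty ι)
    (ξ : ι → S →₀ 𝒜.fibre 1),
    (∀ i, 𝒜.IsSection (ξ i)) ∧
    (∃ C : ℝ, ∀ i, ‖∑ p ∈ (ξ i).support, ∑ t ∈ (ξ i).support,
      star (𝒜.univ 1 (ξ i p)) * 𝒜.univ 1 (ξ i t) * 𝒜.unit (p * t⁻¹)‖ ≤ C) ∧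
    ∀ (s : S) (a : 𝒜.fibre s), Filter.Tendsto
      (fun i => ∑ p ∈ (ξ i).support, ∑ t ∈ (ξ i).support,
        𝒜.unit (p * (s * t)⁻¹) * star (𝒜.univ 1 (ξ i p)) * 𝒜.univ s a * 𝒜.univ 1 (ξ i t))
      Filter.atTop (nhds (𝒜.univ s a))

end FellBundle

namespace StarBundle

open UniformSpace Completion

variable {S : Type u} [InverseMonoid S] {A : S → Type v}
  [∀ s, SeminormedAddCommGroup (A s)] [∀ s, NormedSpace ℂ (A s)] (𝓐 : StarBundle A)

/-- The multiplication as a bounded bilinear map. -/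
def mulL (s t : S) : A s →L[ℂ] A t →L[ℂ] A (s * t) :=
  LinearMap.mkContinuous₂ (𝓐.mul s t) 1 fun a b => by simpa using 𝓐.norm_mul_le s t a b

/-- The multiplication of the completions. -/
def mulC (s t : S) :
    Completion (A s) →L[ℂ] Completion (A t) →L[ℂ] Completion (A (s * t)) :=
  ((ContinuousLinearMap.compL ℂ (A t) (A (s * t)) (Completion (A (s * t))) toComplL).comp
    (𝓐.mulL s t)).fromCompletion.flip.fromCompletion.flip

theorem mulC_coe (s t : S) (a : A s) (b : A t) :
    𝓐.mulC s t a b = (𝓐.mul s t a b : Completion (A (s * t))) := by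
  rw [mulC, ContinuousLinearMap.flip_apply, ContinuousLinearMap.fromCompletion_apply_coe,
    ContinuousLinearMap.flip_apply, ContinuousLinearMap.fromCompletion_apply_coe]
  rfl

/-- The involution of the completions. -/
def starC (s : S) : Completion (A s) →L⋆[ℂ] Completion (A s⁻¹) :=
  ((𝓐.star s).mkContinuous 1 fun a => by simp [𝓐.norm_star]).completion

theorem starC_coe (s : S) (a : A s) : 𝓐.starC s a = (𝓐.star s a : Completion (A s⁻¹)) := by
  simp [starC]

/-- The inclusions of the completions. -/
def inclC {s t : S} (h : s ≤ t) : Completion (A s) →L[ℂ] Completion (A t) :=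
  ((𝓐.incl h).mkContinuous 1 fun a => by simp [𝓐.norm_incl]).completion

theorem inclC_coe {s t : S} (h : s ≤ t) (a : A s) :
    𝓐.inclC h a = (𝓐.incl h a : Completion (A t)) := by
  simp [inclC]

/-- The fibrewise (Hausdorff) completion of a normed `*`-bundle, with the continuous extensions of
the products, involutions and inclusions. -/
def completion : StarBundle (fun s => Completion (A s)) where
  mul s t := (ContinuousLinearMap.coeLM ℂ).comp (𝓐.mulC s t).toLinearMap
  star s := (𝓐.starC s).toLinearMap
  incl h := (𝓐.inclC h).toLinearMap
  incl_refl h a := by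
    change 𝓐.inclC h a = a
    induction a using induction_on with
    | hp => exact isClosed_eq (by fun_prop) (by fun_prop)
    | ih a => rw [inclC_coe, 𝓐.incl_refl]
  incl_incl h₁ h₂ h a := by
    change 𝓐.inclC h₂ (𝓐.inclC h₁ a) = 𝓐.inclC h a
    induction a using induction_on with
    | hp => exact isClosed_eq (by fun_prop) (by fun_prop)
    | ih a => rw [inclC_coe, inclC_coe, inclC_coe, 𝓐.incl_incl]
  incl_mul {s₁ s₂ t₁ t₂} h₁ h₂ h a b := by
    change 𝓐.inclC h (𝓐.mulC s₁ s₂ a b) = 𝓐.mulC t₁ t₂ (𝓐.inclC h₁ a) (𝓐.inclC h₂ b)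
    induction a, b using induction_on₂ with
    | hp => exact isClosed_eq (by fun_prop) (by fun_prop)
    | ih a b => simp only [inclC_coe, mulC_coe, 𝓐.incl_mul h₁ h₂ h]
  incl_star {s t} h h' a := by
    change 𝓐.inclC h' (𝓐.starC s a) = 𝓐.starC t (𝓐.inclC h a)
    induction a using induction_on with
    | hp => exact isClosed_eq (by fun_prop) (by fun_prop)
    | ih a => simp only [inclC_coe, starC_coe, 𝓐.incl_star h h']
  mul_assoc r s t h a b c := by
    change 𝓐.inclC h (𝓐.mulC (r * s) t (𝓐.mulC r s a b) c) =
      𝓐.mulC r (s * t) a (𝓐.mulC s t b c)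
    induction a, b, c using induction_on₃ with
    | hp => exact isClosed_eq (by fun_prop) (by fun_prop)
    | ih a b c => simp only [inclC_coe, mulC_coe, 𝓐.mul_assoc r s t h]
  star_star s h a := by
    change 𝓐.inclC h (𝓐.starC s⁻¹ (𝓐.starC s a)) = a
    induction a using induction_on with
    | hp => exact isClosed_eq (by fun_prop) (by fun_prop)
    | ih a => simp only [inclC_coe, starC_coe, 𝓐.star_star s h]
  star_mul s t h a b := by
    change 𝓐.inclC h (𝓐.starC (s * t) (𝓐.mulC s t a b)) =
      𝓐.mulC t⁻¹ s⁻¹ (𝓐.starC t b) (𝓐.starC s a)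
    induction a, b using induction_on₂ with
    | hp => exact isClosed_eq (by fun_prop) (by fun_prop)
    | ih a b => simp only [inclC_coe, mulC_coe, starC_coe, 𝓐.star_mul s t h]
  norm_incl h a := by
    change ‖𝓐.inclC h a‖ = _
    induction a using induction_on with
    | hp => exact isClosed_eq (by fun_prop) (by fun_prop)
    | ih a => rw [inclC_coe, norm_coe, norm_coe, 𝓐.norm_incl]
  norm_mul_le s t a b := by
    change ‖𝓐.mulC s t a b‖ ≤ _
    induction a, b using induction_on₂ with
    | hp => exact isClosed_le (by fun_prop) (by fun_prop)
    | ih a b => rw [mulC_coe]; simpa only [norm_coe] using 𝓐.norm_mul_le s t a b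
  norm_star s a := by
    change ‖𝓐.starC s a‖ = _
    induction a using induction_on with
    | hp => exact isClosed_eq (by fun_prop) (by fun_prop)
    | ih a => rw [starC_coe, norm_coe, norm_coe, 𝓐.norm_star]
  norm_star_mul_self s a := by
    change ‖𝓐.mulC s⁻¹ s (𝓐.starC s a) a‖ = _
    induction a using induction_on with
    | hp => exact isClosed_eq (by fun_prop) (by fun_prop)
    | ih a => rw [starC_coe, mulC_coe, norm_coe, norm_coe, 𝓐.norm_star_mul_self]

theorem completion_ip_coe {s : S} (a b : A s) :
    𝓐.completion.ip (a : Completion (A s)) (b : Completion (A s)) =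
      (𝓐.ip a b : Completion (A 1)) := by
  change 𝓐.inclC _ (𝓐.mulC s⁻¹ s (𝓐.starC s a) b) = _
  rw [starC_coe, mulC_coe, inclC_coe]
  rfl

theorem continuous_completion_ip {s : S} :
    Continuous fun a : Completion (A s) => 𝓐.completion.ip a a := by
  change Continuous fun a => 𝓐.inclC _ (𝓐.mulC s⁻¹ s (𝓐.starC s a) a)
  fun_prop

end StarBundle

namespace AlgBundle

variable {S : Type u} [InverseMonoid S] {A : S → Type v}
  [∀ s, AddCommGroup (A s)] [∀ s, Module ℂ (A s)] (𝓐 : AlgBundle A)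

/-- The algebraic tensor product of a `*`-bundle with a `C*`-algebra `B`: the fibres are
`A s ⊗ B`, with `(a ⊗ b) (a' ⊗ b') = a a' ⊗ b b'` and `(a ⊗ b)* = a* ⊗ b*`. -/
def tensor (B : Type v) [NonUnitalCStarAlgebra B] : AlgBundle (fun s => A s ⊗[ℂ] B) where
  mul s t := TensorProduct.map₂ (𝓐.mul s t) (LinearMap.mul ℂ B)
  star s := TensorProduct.map (𝓐.star s) (starLinearEquiv ℂ (A := B)).toLinearMap
  incl h := TensorProduct.map (𝓐.incl h) LinearMap.id
  incl_refl h x := by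
    induction x with
    | zero => simp
    | tmul a b => simp [𝓐.incl_refl]
    | add x y hx hy => rw [map_add, hx, hy]
  incl_incl h₁ h₂ h x := by
    induction x with
    | zero => simp
    | tmul a b => simp [𝓐.incl_incl h₁ h₂ h]
    | add x y hx hy => simp only [map_add, hx, hy]
  incl_mul h₁ h₂ h x y := by
    induction x with
    | zero => simp
    | add x x' hx hx' => simp only [map_add, LinearMap.add_apply, hx, hx']
    | tmul a b =>
      induction y with
      | zero => simp
      | add y y' hy hy' => simp only [map_add, hy, hy']
      | tmul a' b' => simp [𝓐.incl_mul h₁ h₂ h]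
  incl_star h h' x := by
    induction x with
    | zero => simp
    | tmul a b => simp [𝓐.incl_star h h']
    | add x y hx hy => simp only [map_add, hx, hy]
  mul_assoc r s t h x y z := by
    induction x with
    | zero => simp
    | add x x' hx hx' => simp only [map_add, LinearMap.add_apply, hx, hx']
    | tmul a b =>
      induction y with
      | zero => simp
      | add y y' hy hy' => simp only [map_add, LinearMap.add_apply, hy, hy']
      | tmul a' b' =>
        induction z with
        | zero => simp
        | add z z' hz hz' => simp only [map_add, hz, hz']
        | tmul a'' b'' => simp [𝓐.mul_assoc r s t h, _root_.mul_assoc]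
  star_star s h x := by
    induction x with
    | zero => simp
    | tmul a b => simp [𝓐.star_star s h]
    | add x y hx hy => simp only [map_add, hx, hy]
  star_mul s t h x y := by
    induction x with
    | zero => simp
    | add x x' hx hx' => simp only [map_add, LinearMap.add_apply, hx, hx']
    | tmul a b =>
      induction y with
      | zero => simp
      | add y y' hy hy' => simp only [map_add, LinearMap.add_apply, hy, hy']
      | tmul a' b' => simp [𝓐.star_mul s t h]

variable {B : Type v} [NonUnitalCStarAlgebra B]

theorem tensor_ip_tmul {s : S} (a a' : A s) (b b' : B) :
    (𝓐.tensor B).ip (a ⊗ₜ b) (a' ⊗ₜ b') = 𝓐.ip a a' ⊗ₜ (Star.star b * b') := by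
  simp [ip, mulTo, tensor]

theorem tensor_lact_tmul {s : S} (c : A 1) (a : A s) (b b' : B) :
    (𝓐.tensor B).lact (c ⊗ₜ b) (a ⊗ₜ b') = 𝓐.lact c a ⊗ₜ (b * b') := by
  simp [lact, mulTo, tensor]

end AlgBundle

namespace FellBundle

variable {S : Type u} [InverseMonoid S] (𝒜 : FellBundle S)

/-- The algebraic tensor product bundle, with fibres `A s ⊗ B`. -/
abbrev alg (B : Type u) [NonUnitalCStarAlgebra B] :
    AlgBundle (fun s => 𝒜.fibre s ⊗[ℂ] B) :=
  𝒜.bundle.toAlgBundle.tensor B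

/-- The properties of a function `p` on the algebraic tensor product `A 1 ⊗ B` under which
`x ↦ p (x* x) ^ (1 / 2)` makes the fibres `A s ⊗ B` a normed `*`-bundle. -/
structure IsBundleNorm (B : Type u) [NonUnitalCStarAlgebra B] (p : 𝒜.fibre 1 ⊗[ℂ] B → ℝ) :
    Prop where
  nonneg : ∀ c, 0 ≤ p c
  add_le : ∀ (s : S) (x y : 𝒜.fibre s ⊗[ℂ] B), √(p ((𝒜.alg B).ip (x + y) (x + y))) ≤
    √(p ((𝒜.alg B).ip x x)) + √(p ((𝒜.alg B).ip y y))
  smul : ∀ (s : S) (z : ℂ) (x : 𝒜.fibre s ⊗[ℂ] B),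
    p ((𝒜.alg B).ip (z • x) (z • x)) = ‖z‖ ^ 2 * p ((𝒜.alg B).ip x x)
  mul_le : ∀ (s t : S) (x : 𝒜.fibre s ⊗[ℂ] B) (y : 𝒜.fibre t ⊗[ℂ] B),
    p ((𝒜.alg B).ip ((𝒜.alg B).mul s t x y) ((𝒜.alg B).mul s t x y)) ≤
      p ((𝒜.alg B).ip x x) * p ((𝒜.alg B).ip y y)
  ip_self : ∀ c : 𝒜.fibre 1 ⊗[ℂ] B, p ((𝒜.alg B).ip c c) = p c ^ 2
  tmul_le : ∀ (c : 𝒜.fibre 1) (b : B), p (c ⊗ₜ b) ≤ ‖c‖ * ‖b‖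

variable {𝒜}
variable {B : Type u} [NonUnitalCStarAlgebra B] {p : 𝒜.fibre 1 ⊗[ℂ] B → ℝ}

/-- The fibre `A s ⊗ B`, with the seminorm `x ↦ p (x* x) ^ (1 / 2)`. -/
@[nolint unusedArguments]
def TensorFibre (_ : 𝒜.IsBundleNorm B p) (s : S) : Type u := 𝒜.fibre s ⊗[ℂ] B

namespace IsBundleNorm

variable (hp : 𝒜.IsBundleNorm B p)

instance (s : S) : AddCommGroup (TensorFibre hp s) :=
  inferInstanceAs (AddCommGroup (𝒜.fibre s ⊗[ℂ] B))

instance (s : S) : Module ℂ (TensorFibre hp s) :=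
  inferInstanceAs (Module ℂ (𝒜.fibre s ⊗[ℂ] B))

instance (s : S) : Norm (TensorFibre hp s) := ⟨fun x => √(p ((𝒜.alg B).ip x x))⟩

/-- The function `p` on the unit fibre. -/
def pOne : TensorFibre hp 1 → ℝ := p

/-- The algebraic tensor product bundle, on the seminormed fibres. -/
def algT : AlgBundle (TensorFibre hp) := 𝒜.alg B

theorem norm_def {s : S} (x : TensorFibre hp s) : ‖x‖ = √(hp.pOne (hp.algT.ip x x)) := rfl

theorem pOne_nonneg (c : TensorFibre hp 1) : 0 ≤ hp.pOne c := hp.nonneg c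

theorem pOne_smul {s : S} (z : ℂ) (x : TensorFibre hp s) :
    hp.pOne (hp.algT.ip (z • x) (z • x)) = ‖z‖ ^ 2 * hp.pOne (hp.algT.ip x x) := hp.smul s z x

theorem pOne_mul_le {s t : S} (x : TensorFibre hp s) (y : TensorFibre hp t) :
    hp.pOne (hp.algT.ip (hp.algT.mul s t x y) (hp.algT.mul s t x y)) ≤
      hp.pOne (hp.algT.ip x x) * hp.pOne (hp.algT.ip y y) := hp.mul_le s t x y

theorem pOne_ip_self (c : TensorFibre hp 1) : hp.pOne (hp.algT.ip c c) = hp.pOne c ^ 2 :=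
  hp.ip_self c

theorem core (s : S) : SeminormedSpace.Core ℂ (TensorFibre hp s) where
  norm_nonneg _ := Real.sqrt_nonneg _
  norm_smul z x := by
    rw [norm_def, norm_def, hp.pOne_smul, Real.sqrt_mul (by positivity),
      Real.sqrt_sq (norm_nonneg _)]
  norm_triangle := hp.add_le s

instance (s : S) : SeminormedAddCommGroup (TensorFibre hp s) :=
  SeminormedAddCommGroup.ofCore (hp.core s)

instance (s : S) : NormedSpace ℂ (TensorFibre hp s) where
  norm_smul_le z x := ((hp.core s).norm_smul z x).le

theorem norm_sq {s : S} (x : TensorFibre hp s) : ‖x‖ ^ 2 = hp.pOne (hp.algT.ip x x) :=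
  Real.sq_sqrt (hp.pOne_nonneg _)

theorem norm_one (c : TensorFibre hp 1) : ‖c‖ = hp.pOne c :=
  (congrArg Real.sqrt (hp.pOne_ip_self c)).trans (Real.sqrt_sq (hp.pOne_nonneg c))

theorem norm_star_le {s : S} (x : TensorFibre hp s) : ‖hp.algT.star s x‖ ≤ ‖x‖ := by
  have h1 := hp.pOne_mul_le x (hp.algT.star s x)
  rw [← hp.algT.ip_incl (mul_inv_le_one s), hp.pOne_ip_self, ← AlgBundle.mulTo,
    ← hp.algT.ip_star, ← hp.norm_sq, ← hp.norm_sq] at h1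
  by_contra! h
  have h0 := norm_nonneg x
  have h2 : ‖x‖ ^ 2 < ‖hp.algT.star s x‖ ^ 2 := by gcongr
  have h3 : 0 < ‖hp.algT.star s x‖ ^ 2 := lt_of_le_of_lt (by positivity) h2
  nlinarith

/-- The normed `*`-bundle with fibres `A s ⊗ B`. -/
def preBundle : StarBundle (TensorFibre hp) where
  toAlgBundle := hp.algT
  norm_incl h x := by
    rw [hp.norm_def, hp.norm_def, hp.algT.ip_incl]
  norm_mul_le s t x y := by
    rw [hp.norm_def, hp.norm_def, hp.norm_def, ← Real.sqrt_mul (hp.pOne_nonneg _)]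
    exact Real.sqrt_le_sqrt (hp.pOne_mul_le x y)
  norm_star s x := by
    refine le_antisymm (hp.norm_star_le x) ?_
    have h := hp.norm_star_le (hp.algT.star s x)
    rwa [hp.norm_def (hp.algT.star s⁻¹ _),
      ← hp.algT.ip_incl (le_of_eq (InverseMonoid.inv_inv s)), hp.algT.star_star,
      ← hp.norm_def] at h
  norm_star_mul_self s x := by
    rw [hp.norm_def, ← hp.algT.ip_incl (inv_mul_le_one s), hp.pOne_ip_self, hp.norm_sq]
    exact Real.sqrt_sq (hp.pOne_nonneg _)

end IsBundleNorm
end FellBundle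

/-- A quantitative approximate unit for a positive element. -/
theorem exists_approx_unit {A : Type u} [NonUnitalCStarAlgebra A] [PartialOrder A]
    [StarOrderedRing A] (h : A) (hh : 0 ≤ h) {ε : ℝ} (hε : 0 < ε) :
    ∃ r : A, star r = r ∧ ‖r * h * r‖ ≤ 1 ∧
      ‖h - r * h * r * h - h * (r * h * r) + r * h * r * h * (r * h * r)‖ ≤ 4 * ε := by
  set f : ℝ → ℝ := fun t => √t / (|t| + ε) with hf
  have hpos : ∀ t : ℝ, 0 < |t| + ε := fun t => by positivity
  have hfc : Continuous f := Continuous.div (by fun_prop) (by fun_prop) fun t => (hpos t).ne'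
  have hf0 : f 0 = 0 := by simp [hf]
  have hsa : IsSelfAdjoint h := hh.isSelfAdjoint
  have hid : cfcₙ (fun t : ℝ => t) h = h := cfcₙ_id' ℝ h
  have hw : cfcₙ f h * h * cfcₙ f h = cfcₙ (fun t => f t * t * f t) h := by
    rw [cfcₙ_mul _ _ h (by fun_prop) (by simp [hf0]) (by fun_prop) hf0,
      cfcₙ_mul _ _ h (by fun_prop) hf0 (by fun_prop) rfl, hid]
  refine ⟨cfcₙ f h, cfcₙ_predicate f h, ?_, ?_⟩
  · rw [hw]
    refine norm_cfcₙ_le fun t ht => ?_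
    have ht0 : 0 ≤ t := quasispectrum_nonneg_of_nonneg h hh t ht
    have e : f t * t * f t = (t / (t + ε)) ^ 2 := by
      simp only [hf, abs_of_nonneg ht0]
      rw [div_mul_eq_mul_div, div_mul_div_comm, div_pow]
      congr 1
      · calc √t * t * √t = (√t * √t) * t := by ring
          _ = _ := by rw [Real.mul_self_sqrt ht0]; ring
      · ring
    have h1 : t / (t + ε) ≤ 1 := by rw [div_le_one (by positivity)]; linarith
    have h2 : 0 ≤ t / (t + ε) := by positivity
    rw [e, Real.norm_of_nonneg (by positivity)]
    exact pow_le_one₀ h2 h1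
  · have e : h - cfcₙ f h * h * cfcₙ f h * h - h * (cfcₙ f h * h * cfcₙ f h) +
        cfcₙ f h * h * cfcₙ f h * h * (cfcₙ f h * h * cfcₙ f h) =
        cfcₙ (fun t => t - f t * t * f t * t - t * (f t * t * f t) +
          f t * t * f t * t * (f t * t * f t)) h := by
      rw [cfcₙ_add (a := h) _ _ (by fun_prop) (by simp [hf0]) (by fun_prop) (by simp [hf0]),
        cfcₙ_sub (a := h) _ _ (by fun_prop) (by simp [hf0]) (by fun_prop) (by simp [hf0]),
        cfcₙ_sub (a := h) _ _ (by fun_prop) (by simp [hf0]) (by fun_prop) (by simp [hf0]),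
        cfcₙ_mul (fun t => f t * t * f t * t) (fun t => f t * t * f t) h (by fun_prop)
          (by simp) (by fun_prop) (by simp [hf0]),
        cfcₙ_mul (fun t => f t * t * f t) (fun t => t) h (by fun_prop)
          (by simp) (by fun_prop) (by simp [hf0]),
        cfcₙ_mul (fun t => t) (fun t => f t * t * f t) h (by fun_prop)
          (by simp) (by fun_prop) (by simp [hf0]), hid, ← hw]
    rw [e]
    refine norm_cfcₙ_le fun t ht => ?_
    have ht0 : 0 ≤ t := quasispectrum_nonneg_of_nonneg h hh t ht
    have e : f t * t * f t = (t / (t + ε)) ^ 2 := by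
      simp only [hf, abs_of_nonneg ht0]
      rw [div_mul_eq_mul_div, div_mul_div_comm, div_pow]
      congr 1
      · calc √t * t * √t = (√t * √t) * t := by ring
          _ = _ := by rw [Real.mul_self_sqrt ht0]; ring
      · ring
    rw [e]
    have hp : 0 < t + ε := by positivity
    set q := t / (t + ε) with hq
    have h1 : q ≤ 1 := by rw [hq, div_le_one (by positivity)]; linarith
    have h2 : 0 ≤ q := by positivity
    have h3 : t * (1 - q) ≤ ε := by
      have : 1 - q = ε / (t + ε) := by rw [hq]; field_simp; ring
      rw [this, ← mul_div_assoc, div_le_iff₀ hp]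
      nlinarith
    have h4 : t - q ^ 2 * t - t * q ^ 2 + q ^ 2 * t * q ^ 2 =
        t * (1 - q) * ((1 - q) * (1 + q) ^ 2) := by ring
    have h5 : (1 - q) * (1 + q) ^ 2 ≤ 4 := by nlinarith [mul_nonneg h2 h2]
    have h6 : 0 ≤ (1 - q) * (1 + q) ^ 2 := mul_nonneg (by linarith) (by positivity)
    rw [h4, Real.norm_of_nonneg (mul_nonneg (mul_nonneg ht0 (by linarith)) h6)]
    calc _ ≤ ε * 4 := mul_le_mul h3 h5 h6 hε.le
      _ = _ := mul_comm _ _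

namespace FellBundle

variable {S : Type u} [InverseMonoid S] (𝒜 : FellBundle S)

theorem ip_nonneg [PartialOrder (𝒜.fibre 1)] [StarOrderedRing (𝒜.fibre 1)] {s : S}
    (a : 𝒜.fibre s) : 0 ≤ 𝒜.bundle.ip a a := by
  obtain ⟨c, hc⟩ := 𝒜.pos s a
  rw [hc, 𝒜.bundle.ip_eq_mulOne]
  exact star_mul_self_nonneg c

theorem ip_lact_rankOne {s : S} (u x y : 𝒜.fibre s) :
    𝒜.bundle.ip x (𝒜.bundle.lact (𝒜.bundle.ip (𝒜.bundle.star s u) (𝒜.bundle.star s u)) y) =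
      𝒜.bundle.ip (𝒜.bundle.ip u x) (𝒜.bundle.ip u y) := by
  have h : 𝒜.bundle.lact (𝒜.bundle.ip (𝒜.bundle.star s u) (𝒜.bundle.star s u)) y =
      𝒜.bundle.mulTo (le_of_eq (mul_one s)) u (𝒜.bundle.ip u y) := by
    rw [𝒜.bundle.ip_star]
    exact 𝒜.bundle.mulTo_assoc _ _ _ _ _ _ _
  rw [h, 𝒜.bundle.ip_eq_mulOne (𝒜.bundle.ip u x), 𝒜.bundle.starOne_ip]
  exact (𝒜.bundle.mulTo_assoc _ _ _ _ _ _ _).symm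

/-- The element `a b*` of the unit fibre. -/
def rk {s : S} (a b : 𝒜.fibre s) : 𝒜.fibre 1 :=
  𝒜.bundle.mulTo (mul_inv_le_one s) a (𝒜.bundle.star s b)

theorem rk_self {s : S} (a : 𝒜.fibre s) :
    𝒜.rk a a = 𝒜.bundle.ip (𝒜.bundle.star s a) (𝒜.bundle.star s a) :=
  (𝒜.bundle.ip_star a).symm

theorem rk_lact_left {s : S} (c : 𝒜.fibre 1) (a b : 𝒜.fibre s) :
    𝒜.rk (𝒜.bundle.lact c a) b = c * 𝒜.rk a b :=
  𝒜.bundle.mulTo_assoc _ _ _ _ _ _ _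

theorem rk_lact_right {s : S} (c : 𝒜.fibre 1) (a b : 𝒜.fibre s) :
    𝒜.rk a (𝒜.bundle.lact c b) = 𝒜.rk a b * star c := by
  rw [rk, 𝒜.bundle.star_eq_starTo, AlgBundle.lact, 𝒜.bundle.starTo_mulTo _ _ (le_of_eq rfl)
    (le_of_eq InverseMonoid.one_inv) (le_of_eq (mul_one _)), ← 𝒜.bundle.star_eq_starTo]
  exact (𝒜.bundle.mulTo_assoc _ _ _ _ _ _ _).symm

theorem rk_sub_left {s : S} (a a' b : 𝒜.fibre s) : 𝒜.rk (a - a') b = 𝒜.rk a b - 𝒜.rk a' b := by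
  simp [rk, AlgBundle.mulTo]

theorem rk_sub_right {s : S} (a b b' : 𝒜.fibre s) : 𝒜.rk a (b - b') = 𝒜.rk a b - 𝒜.rk a b' := by
  simp [rk, AlgBundle.mulTo]

theorem lact_sum {s : S} {n : Type*} [Fintype n] (c : n → 𝒜.fibre 1) (a : 𝒜.fibre s) :
    𝒜.bundle.lact (∑ i, c i) a = ∑ i, 𝒜.bundle.lact (c i) a := by
  simp [AlgBundle.lact, AlgBundle.mulTo]

theorem ip_sum_right {s : S} {n : Type*} [Fintype n] (a : 𝒜.fibre s) (b : n → 𝒜.fibre s) :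
    𝒜.bundle.ip a (∑ i, b i) = ∑ i, 𝒜.bundle.ip a (b i) := by
  simp [AlgBundle.ip, AlgBundle.mulTo]

/-- Finitely many elements of a fibre are approximately fixed by an element of the form
`w = ∑ uₖ uₖ*` of the unit fibre. -/
theorem exists_factorization {s : S} {n : Type*} [Fintype n] (a : n → 𝒜.fibre s) {δ : ℝ}
    (hδ : 0 < δ) : ∃ (w : 𝒜.fibre 1) (u : n → 𝒜.fibre s), ‖w‖ ≤ 1 ∧
      (∀ i, ‖a i - 𝒜.bundle.lact w (a i)‖ ≤ δ) ∧
      ∀ x y : 𝒜.fibre s, 𝒜.bundle.ip x (𝒜.bundle.lact w y) =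
        ∑ k, 𝒜.bundle.ip (𝒜.bundle.ip (u k) x) (𝒜.bundle.ip (u k) y) := by
  let _ := CStarAlgebra.spectralOrder (𝒜.fibre 1)
  have := CStarAlgebra.spectralOrderedRing (𝒜.fibre 1)
  set h : 𝒜.fibre 1 := ∑ i, 𝒜.rk (a i) (a i) with hh
  have hk : ∀ b : 𝒜.fibre s, 0 ≤ 𝒜.rk b b := fun b => by
    rw [rk_self]; exact 𝒜.ip_nonneg _
  have h0 : 0 ≤ h := Finset.sum_nonneg fun i _ => hk _
  obtain ⟨r, hr, hw, hb⟩ := exists_approx_unit h h0 (ε := δ ^ 2 / 4) (by positivity)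
  set w := r * h * r with hwdef
  have hsw : star w = w := by
    rw [hwdef, star_mul, star_mul, hr, h0.isSelfAdjoint.star_eq, mul_assoc]
  refine ⟨w, fun k => 𝒜.bundle.lact r (a k), hw, fun i => ?_, fun x y => ?_⟩
  · set d : n → 𝒜.fibre s := fun j => a j - 𝒜.bundle.lact w (a j) with hd
    have hdd : ∀ j, 𝒜.rk (d j) (d j) = 𝒜.rk (a j) (a j) - w * 𝒜.rk (a j) (a j) -
        𝒜.rk (a j) (a j) * w + w * 𝒜.rk (a j) (a j) * w := fun j => by
      simp only [hd, rk_sub_left, rk_sub_right, rk_lact_left, rk_lact_right, hsw, mul_assoc, sub_mul]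
      abel
    have hsum : ∑ j, 𝒜.rk (d j) (d j) = h - w * h - h * w + w * h * w := by
      simp only [hdd, Finset.sum_add_distrib, Finset.sum_sub_distrib, hh, Finset.mul_sum,
        Finset.sum_mul]
    have hle : 𝒜.rk (d i) (d i) ≤ ∑ j, 𝒜.rk (d j) (d j) :=
      Finset.single_le_sum (f := fun j => 𝒜.rk (d j) (d j)) (fun j _ => hk _) (Finset.mem_univ i)
    have hn := CStarAlgebra.norm_le_norm_of_nonneg_of_le (hk (d i)) hle
    rw [rk_self, 𝒜.bundle.norm_ip_self, 𝒜.bundle.norm_star, hsum] at hn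
    have hb' : ‖h - w * h - h * w + w * h * w‖ ≤ δ ^ 2 := hb.trans_eq (by ring)
    exact le_of_sq_le_sq (hn.trans hb') hδ.le
  · have e : w = ∑ k, 𝒜.rk (𝒜.bundle.lact r (a k)) (𝒜.bundle.lact r (a k)) := by
      simp only [rk_lact_left, rk_lact_right, hr, hwdef, hh, Finset.mul_sum, Finset.sum_mul,
        mul_assoc]
    rw [e, lact_sum, ip_sum_right]
    refine Finset.sum_congr rfl fun k _ => ?_
    rw [rk_self, ip_lact_rankOne]

end FellBundle

namespace FellBundle.IsBundleNorm

variable {S : Type u} [InverseMonoid S] {𝒜 : FellBundle S}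
variable {B : Type u} [NonUnitalCStarAlgebra B] {p : 𝒜.fibre 1 ⊗[ℂ] B → ℝ}
variable (hp : 𝒜.IsBundleNorm B p)

/-- Elementary tensors. -/
def tm {s : S} : 𝒜.fibre s →ₗ[ℂ] B →ₗ[ℂ] TensorFibre hp s := TensorProduct.mk ℂ _ _

theorem ip_tm {s : S} (a a' : 𝒜.fibre s) (b b' : B) :
    hp.algT.ip (hp.tm a b) (hp.tm a' b') = hp.tm (𝒜.bundle.ip a a') (star b * b') :=
  𝒜.bundle.toAlgBundle.tensor_ip_tmul a a' b b'

theorem norm_tm_one (c : 𝒜.fibre 1) (b : B) : ‖hp.tm c b‖ ≤ ‖c‖ * ‖b‖ :=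
  (hp.norm_one _).trans_le (hp.tmul_le c b)

theorem exists_sum_tm {s : S} (x : TensorFibre hp s) :
    ∃ (n : ℕ) (a : Fin n → 𝒜.fibre s) (b : Fin n → B), x = ∑ i, hp.tm (a i) (b i) :=
  TensorProduct.exists_sum_tmul_eq (M := 𝒜.fibre s) (N := B) x

theorem ip_sum_sum {s : S} {n : ℕ} (x y : Fin n → TensorFibre hp s) :
    hp.algT.ip (∑ i, x i) (∑ i, y i) = ∑ i, ∑ j, hp.algT.ip (x i) (y j) := by
  simp only [AlgBundle.ip, AlgBundle.mulTo, map_sum, LinearMap.sum_apply]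
  exact Finset.sum_comm

theorem ip_approx {s : S} (x : TensorFibre hp s) {ε : ℝ} (hε : 0 < ε) :
    ∃ (n : ℕ) (c : Fin n → TensorFibre hp 1),
      ‖hp.algT.ip x x - ∑ k, hp.algT.ip (c k) (c k)‖ < ε := by
  obtain ⟨n, a, b, rfl⟩ := hp.exists_sum_tm x
  set M : ℝ := ∑ i, ∑ j, ‖a i‖ * (‖b i‖ * ‖b j‖) with hM
  have hM0 : 0 ≤ M := by positivity
  obtain ⟨w, u, -, hwa, hw⟩ := 𝒜.exists_factorization a (δ := ε / (M + 1)) (by positivity)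
  refine ⟨n, fun k => ∑ i, hp.tm (𝒜.bundle.ip (u k) (a i)) (b i), ?_⟩
  have e : ∑ k, hp.algT.ip (∑ i, hp.tm (𝒜.bundle.ip (u k) (a i)) (b i))
      (∑ i, hp.tm (𝒜.bundle.ip (u k) (a i)) (b i)) =
      ∑ i, ∑ j, hp.tm (𝒜.bundle.ip (a i) (𝒜.bundle.lact w (a j))) (star (b i) * b j) := by
    simp only [ip_sum_sum, ip_tm, hw]
    rw [Finset.sum_comm]
    refine Finset.sum_congr rfl fun i _ => ?_
    rw [Finset.sum_comm]
    refine Finset.sum_congr rfl fun j _ => ?_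
    simp
  rw [e, ip_sum_sum, ← Finset.sum_sub_distrib]
  simp only [← Finset.sum_sub_distrib, ip_tm]
  calc _ ≤ ∑ i, ∑ j, ‖a i‖ * (‖b i‖ * ‖b j‖) * (ε / (M + 1)) := by
        refine norm_sum_le_of_le _ fun i _ => norm_sum_le_of_le _ fun j _ => ?_
        have e2 : 𝒜.bundle.ip (a i) (a j) - 𝒜.bundle.ip (a i) (𝒜.bundle.lact w (a j)) =
            𝒜.bundle.ip (a i) (a j - 𝒜.bundle.lact w (a j)) := by
          simp [AlgBundle.ip, AlgBundle.mulTo]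
        rw [← LinearMap.sub_apply, ← map_sub, e2]
        refine (hp.norm_tm_one _ _).trans ?_
        have h1 : ‖𝒜.bundle.ip (a i) (a j - 𝒜.bundle.lact w (a j))‖ ≤ ‖a i‖ * (ε / (M + 1)) := by
          refine (𝒜.bundle.norm_mulTo_le _ _ _).trans ?_
          rw [𝒜.bundle.norm_star]
          gcongr
          exact hwa j
        have h2 : ‖star (b i) * b j‖ ≤ ‖b i‖ * ‖b j‖ := by
          simpa using norm_mul_le (star (b i)) (b j)
        calc _ ≤ ‖a i‖ * (ε / (M + 1)) * (‖b i‖ * ‖b j‖) := by gcongr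
          _ = _ := by ring
    _ = M * (ε / (M + 1)) := by simp only [hM, Finset.sum_mul]
    _ < ε := by
        rw [← mul_div_assoc, div_lt_iff₀ (by positivity)]
        nlinarith

/-- The tensor product bundle: its fibres are the completions of `A s ⊗ B` in the norm
`x ↦ p (x* x) ^ (1 / 2)`. -/
def tensor : FellBundle S where
  fibre s := UniformSpace.Completion (TensorFibre hp s)
  bundle := hp.preBundle.completion
  pos s x := by
    let _ : NonUnitalCStarAlgebra (UniformSpace.Completion (TensorFibre hp 1)) :=
      hp.preBundle.completion.cstarAlgebraOne
    let _ := CStarAlgebra.spectralOrder (UniformSpace.Completion (TensorFibre hp 1))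
    have := CStarAlgebra.spectralOrderedRing (UniformSpace.Completion (TensorFibre hp 1))
    have hip : ∀ c : UniformSpace.Completion (TensorFibre hp 1),
        hp.preBundle.completion.ip c c = star c * c := fun c =>
      hp.preBundle.completion.ip_eq_mulOne c c
    suffices h : 0 ≤ hp.preBundle.completion.ip x x by
      obtain ⟨c, hc⟩ := CStarAlgebra.nonneg_iff_eq_star_mul_self.mp h
      exact ⟨c, hc.trans (hip c).symm⟩
    induction x using UniformSpace.Completion.induction_on with
    | hp => exact (CStarAlgebra.isClosed_nonneg
      (A := UniformSpace.Completion (TensorFibre hp 1))).preimage hp.preBundle.continuous_completion_ip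
    | ih x =>
      rw [hp.preBundle.completion_ip_coe]
      refine (CStarAlgebra.isClosed_nonneg
      (A := UniformSpace.Completion (TensorFibre hp 1))).closure_subset (Metric.mem_closure_iff.mpr ?_)
      intro ε hε
      obtain ⟨n, c, hc⟩ := hp.ip_approx x hε
      refine ⟨∑ k, hp.preBundle.completion.ip (c k : UniformSpace.Completion (TensorFibre hp 1))
        (c k : UniformSpace.Completion (TensorFibre hp 1)), ?_, ?_⟩
      · have h0 : ∀ k, 0 ≤ hp.preBundle.completion.ip
            (c k : UniformSpace.Completion (TensorFibre hp 1))
            (c k : UniformSpace.Completion (TensorFibre hp 1)) := fun k => by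
          rw [hip]
          exact star_mul_self_nonneg _
        exact Finset.sum_nonneg (N := UniformSpace.Completion (TensorFibre hp 1)) fun k _ => h0 k
      · have e : ∑ k, hp.preBundle.completion.ip
            (c k : UniformSpace.Completion (TensorFibre hp 1))
            (c k : UniformSpace.Completion (TensorFibre hp 1)) =
            ((∑ k, hp.preBundle.ip (c k) (c k) : TensorFibre hp 1) :
              UniformSpace.Completion (TensorFibre hp 1)) := by
          simp only [hp.preBundle.completion_ip_coe]
          exact (map_sum (UniformSpace.Completion.toComplₗᵢ (𝕜 := ℂ) (E := TensorFibre hp 1)) _ _).symm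
        rw [e, dist_eq_norm, ← UniformSpace.Completion.coe_sub, UniformSpace.Completion.norm_coe]
        exact hc

end FellBundle.IsBundleNorm

/-- The norm of a positive operator `T* T`, in terms of matrix coefficients. -/
theorem norm_eq_sq_of_inner {E F : Type*} [NormedAddCommGroup E] [InnerProductSpace ℂ E]
    [NormedAddCommGroup F] [InnerProductSpace ℂ F] (T : E →L[ℂ] F) (R : E →L[ℂ] E)
    (h : ∀ v w, inner ℂ (T v) (T w) = inner ℂ v (R w)) : ‖R‖ = ‖T‖ ^ 2 := by
  refine le_antisymm (R.opNorm_le_bound (by positivity) fun w => ?_) ?_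
  · have h1 : ‖R w‖ * ‖R w‖ ≤ ‖R w‖ * (‖T‖ ^ 2 * ‖w‖) := by
      have e : ‖R w‖ * ‖R w‖ = ‖inner ℂ (R w) (R w)‖ := by
        rw [inner_self_eq_norm_sq_to_K]; simp [sq]
      rw [e, ← h]
      refine (norm_inner_le_norm _ _).trans ?_
      calc _ ≤ (‖T‖ * ‖R w‖) * (‖T‖ * ‖w‖) := by
            gcongr <;> exact T.le_opNorm _
        _ = _ := by ring
    rcases (norm_nonneg (R w)).eq_or_lt with h0 | h0
    · rw [← h0]; positivity
    · exact le_of_mul_le_mul_left h1 h0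
  · have h1 : ‖T‖ ≤ √‖R‖ := T.opNorm_le_bound (by positivity) fun v => by
      refine le_of_sq_le_sq ?_ (by positivity)
      rw [mul_pow, Real.sq_sqrt (norm_nonneg _)]
      calc ‖T v‖ ^ 2 = ‖inner ℂ (T v) (T v)‖ := by
            rw [inner_self_eq_norm_sq_to_K]; simp
        _ ≤ ‖v‖ * ‖R v‖ := by rw [h]; exact norm_inner_le_norm _ _
        _ ≤ ‖v‖ * (‖R‖ * ‖v‖) := by gcongr; exact R.le_opNorm v
        _ = _ := by ring
    calc ‖T‖ ^ 2 ≤ √‖R‖ ^ 2 := by gcongr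
      _ = _ := Real.sq_sqrt (norm_nonneg _)

/-- Conditions on a family of representations `Φ i` of the algebraic tensor product `A 1 ⊗ B` under
which the supremum of the operator norms extends to all fibres `A t ⊗ B`. -/
theorem FellBundle.IsBundleNorm.of_family {S : Type u} [InverseMonoid S] {𝒜 : FellBundle S}
    {B : Type u} [NonUnitalCStarAlgebra B] {I : Type*} {E : I → Type*}
    [∀ i, NormedAddCommGroup (E i)] [∀ i, InnerProductSpace ℂ (E i)]
    (Φ : ∀ i, 𝒜.fibre 1 ⊗[ℂ] B →ₗ[ℂ] (E i →L[ℂ] E i))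
    (hΦ : ∀ i c b, ‖Φ i (c ⊗ₜ b)‖ ≤ ‖c‖ * ‖b‖)
    (hip : ∀ i c v w, inner ℂ (Φ i c v) (Φ i c w) = inner ℂ v (Φ i ((𝒜.alg B).ip c c) w))
    (hY : ∀ (t : S) (i : I), ∃ (j : I) (Y : 𝒜.fibre t ⊗[ℂ] B →ₗ[ℂ] (E i →L[ℂ] E j)),
      (∀ x y v w, inner ℂ (Y x v) (Y y w) = inner ℂ v (Φ i ((𝒜.alg B).ip x y) w)) ∧
      ∀ c x v, Y ((𝒜.alg B).lact c x) v = Φ j c (Y x v)) :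
    𝒜.IsBundleNorm B fun c => ⨆ i, ‖Φ i c‖ := by
  have hbdd : ∀ c, BddAbove (Set.range fun i => ‖Φ i c‖) := fun c => by
    obtain ⟨n, a, b, rfl⟩ := TensorProduct.exists_sum_tmul_eq c
    refine ⟨∑ k, ‖a k‖ * ‖b k‖, ?_⟩
    rintro _ ⟨i, rfl⟩
    simp only [map_sum]
    exact norm_sum_le_of_le _ fun k _ => hΦ i _ _
  have hle : ∀ i c, ‖Φ i c‖ ≤ ⨆ i, ‖Φ i c‖ := fun i c => le_ciSup (hbdd c) i
  have hnn : ∀ c, 0 ≤ ⨆ i, ‖Φ i c‖ := fun c => Real.iSup_nonneg fun i => norm_nonneg _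
  refine ⟨hnn, fun s x y => ?_, fun s z x => ?_, fun s t x y => ?_, fun c => ?_, fun c b => ?_⟩
  · refine Real.sqrt_le_left (by positivity) |>.mpr (Real.iSup_le (fun i => ?_) (by positivity))
    obtain ⟨j, Y, hY1, -⟩ := hY s i
    have h : ∀ x, ‖Y x‖ ≤ √(⨆ i, ‖Φ i ((𝒜.alg B).ip x x)‖) := fun x => by
      refine Real.le_sqrt_of_sq_le ?_
      rw [← norm_eq_sq_of_inner (Y x) _ (hY1 x x)]
      exact hle i _
    rw [norm_eq_sq_of_inner (Y (x + y)) _ (hY1 _ _), map_add]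
    gcongr
    exact (norm_add_le _ _).trans (add_le_add (h x) (h y))
  · have e : (𝒜.alg B).ip (z • x) (z • x) = (conj z * z) • (𝒜.alg B).ip x x := by
      rw [AlgBundle.ip_smul_left, AlgBundle.ip_smul_right, smul_smul]
    simp only [e, map_smul, norm_smul, norm_mul, RCLike.norm_conj]
    rw [← Real.mul_iSup_of_nonneg (by positivity), sq]
  · refine Real.iSup_le (fun i => ?_) (mul_nonneg (hnn _) (hnn _))
    obtain ⟨j, Y, hY1, hY2⟩ := hY t i
    have h1 : ‖Φ i ((𝒜.alg B).ip y ((𝒜.alg B).lact ((𝒜.alg B).ip x x) y))‖ ≤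
        ‖Y y‖ ^ 2 * ‖Φ j ((𝒜.alg B).ip x x)‖ := by
      obtain ⟨k, Z, hZ1, hZ2⟩ := hY s j
      rw [norm_eq_sq_of_inner ((Z x).comp (Y y)) _ fun v w => ?_,
        norm_eq_sq_of_inner (Z x) _ (hZ1 x x), ← mul_pow, mul_comm]
      · gcongr
        exact ContinuousLinearMap.opNorm_comp_le _ _
      · rw [← hY1, hY2, ← hZ1]; rfl
    rw [AlgBundle.ip_mul]
    refine h1.trans ?_
    rw [← norm_eq_sq_of_inner (Y y) _ (hY1 y y), mul_comm]
    exact mul_le_mul (hle _ _) (hle _ _) (norm_nonneg _) (hnn _)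
  · have h : ∀ i, ‖Φ i ((𝒜.alg B).ip c c)‖ = ‖Φ i c‖ ^ 2 := fun i =>
      norm_eq_sq_of_inner _ _ (hip i c)
    refine le_antisymm (Real.iSup_le (fun i => ?_) (sq_nonneg _)) ?_
    · rw [h]
      exact pow_le_pow_left₀ (norm_nonneg _) (hle i c) 2
    · have h1 : ⨆ i, ‖Φ i c‖ ≤ √(⨆ i, ‖Φ i ((𝒜.alg B).ip c c)‖) :=
        Real.iSup_le (fun i => Real.le_sqrt_of_sq_le (by rw [← h]; exact hle i _)) (by positivity)
      calc _ ≤ √(⨆ i, ‖Φ i ((𝒜.alg B).ip c c)‖) ^ 2 := pow_le_pow_left₀ (hnn _) h1 2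
        _ = _ := Real.sq_sqrt (hnn _)
  · exact Real.iSup_le (fun i => hΦ i c b) (by positivity)

/-- The same conditions, on elementary tensors. -/
theorem FellBundle.IsBundleNorm.of_family_tmul {S : Type u} [InverseMonoid S] {𝒜 : FellBundle S}
    {B : Type u} [NonUnitalCStarAlgebra B] {I : Type*} {E : I → Type*}
    [∀ i, NormedAddCommGroup (E i)] [∀ i, InnerProductSpace ℂ (E i)]
    (Φ : ∀ i, 𝒜.fibre 1 ⊗[ℂ] B →ₗ[ℂ] (E i →L[ℂ] E i))
    (hΦ : ∀ i c b, ‖Φ i (c ⊗ₜ b)‖ ≤ ‖c‖ * ‖b‖)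
    (hip : ∀ i c c' b b' v w, inner ℂ (Φ i (c ⊗ₜ b) v) (Φ i (c' ⊗ₜ b') w) =
      inner ℂ v (Φ i (𝒜.bundle.ip c c' ⊗ₜ (star b * b')) w))
    (hY : ∀ (t : S) (i : I), ∃ (j : I) (Y : 𝒜.fibre t ⊗[ℂ] B →ₗ[ℂ] (E i →L[ℂ] E j)),
      (∀ a a' b b' v w, inner ℂ (Y (a ⊗ₜ b) v) (Y (a' ⊗ₜ b') w) =
        inner ℂ v (Φ i (𝒜.bundle.ip a a' ⊗ₜ (star b * b')) w)) ∧
      ∀ c b a b' v, Y (𝒜.bundle.lact c a ⊗ₜ (b * b')) v = Φ j (c ⊗ₜ b) (Y (a ⊗ₜ b') v)) :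
    𝒜.IsBundleNorm B fun c => ⨆ i, ‖Φ i c‖ := by
  have aux : ∀ (t : S) (i j : I) (Y : 𝒜.fibre t ⊗[ℂ] B →ₗ[ℂ] (E i →L[ℂ] E j)),
      (∀ a a' b b' v w, inner ℂ (Y (a ⊗ₜ b) v) (Y (a' ⊗ₜ b') w) =
        inner ℂ v (Φ i (𝒜.bundle.ip a a' ⊗ₜ (star b * b')) w)) →
      ∀ x y v w, inner ℂ (Y x v) (Y y w) = inner ℂ v (Φ i ((𝒜.alg B).ip x y) w) := by
    intro t i j Y h x y v w
    induction x with
    | zero => simp [AlgBundle.ip, AlgBundle.mulTo]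
    | add x x' hx hx' =>
      rw [AlgBundle.ip_add_left, map_add, map_add, _root_.add_apply, _root_.add_apply,
        inner_add_left, inner_add_right, hx, hx']
    | tmul a b =>
      induction y with
      | zero => simp [AlgBundle.ip, AlgBundle.mulTo]
      | add y y' hy hy' =>
        rw [AlgBundle.ip_add_right, map_add, map_add, _root_.add_apply, _root_.add_apply,
          inner_add_right, inner_add_right, hy, hy']
      | tmul a' b' => rw [h, AlgBundle.tensor_ip_tmul]
  refine of_family Φ hΦ (fun i c v w => aux 1 i i (Φ i) (hip i) c c v w) fun t i => ?_
  obtain ⟨j, Y, h1, h2⟩ := hY t i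
  refine ⟨j, Y, aux t i j Y h1, fun c x v => ?_⟩
  induction c with
  | zero => simp [AlgBundle.lact, AlgBundle.mulTo]
  | add c c' hc hc' =>
    have e : (𝒜.alg B).lact (c + c') x = (𝒜.alg B).lact c x + (𝒜.alg B).lact c' x := by
      simp [AlgBundle.lact, AlgBundle.mulTo]
    rw [e, map_add, map_add, _root_.add_apply, _root_.add_apply, hc, hc']
  | tmul c b =>
    induction x with
    | zero => simp [AlgBundle.lact, AlgBundle.mulTo]
    | add x x' hx hx' =>
      have e : (𝒜.alg B).lact (c ⊗ₜ b) (x + x') =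
          (𝒜.alg B).lact (c ⊗ₜ b) x + (𝒜.alg B).lact (c ⊗ₜ b) x' := by
        simp [AlgBundle.lact, AlgBundle.mulTo]
      rw [e, map_add, map_add, _root_.add_apply, _root_.add_apply, map_add, hx, hx']
    | tmul a b' => rw [AlgBundle.tensor_lact_tmul, h2]

/-- The element `g = ‖c‖ - (‖c‖² - c* c) ^ (1 / 2)`. -/
theorem exists_defect {C : Type*} [NonUnitalCStarAlgebra C] (c : C) :
    ∃ g : C, star g = g ∧ star c * c = (2 * ‖c‖ : ℝ) • g - g * g := by
  let _ := CStarAlgebra.spectralOrder C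
  have := CStarAlgebra.spectralOrderedRing C
  set d := star c * c with hd
  have hd0 : 0 ≤ d := star_mul_self_nonneg c
  have hsa : IsSelfAdjoint d := hd0.isSelfAdjoint
  set f : ℝ → ℝ := fun t => ‖c‖ - √(‖c‖ ^ 2 - t) with hf
  have hfc : Continuous f := by fun_prop
  have hf0 : f 0 = 0 := by simp [hf]
  refine ⟨cfcₙ f d, cfcₙ_predicate f d, ?_⟩
  rw [← cfcₙ_mul f f d, ← cfcₙ_smul (R := ℝ) (2 * ‖c‖) f d, ← cfcₙ_sub ..]
  conv_lhs => rw [← cfcₙ_id' ℝ d]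
  refine cfcₙ_congr fun t ht => ?_
  have ht1 : t ≤ ‖c‖ ^ 2 := by
    have h := NonUnitalIsometricContinuousFunctionalCalculus.norm_quasispectrum_le (𝕜 := ℝ) d ht
    rw [hd, CStarRing.norm_star_mul_self, ← sq] at h
    exact (le_abs_self t).trans h
  have h2 := Real.sq_sqrt (sub_nonneg.mpr ht1)
  simp only [hf, smul_eq_mul]
  nlinarith

/-- A `*`-representation of a `C*`-algebra by linear maps on a semi-inner product space. -/
structure PreRep (C : Type*) [NonUnitalCStarAlgebra C] (X : Type*) [SeminormedAddCommGroup X]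
    [InnerProductSpace ℂ X] where
  θ : C →ₗ[ℂ] (X →ₗ[ℂ] X)
  map_mul : ∀ c d x, θ (c * d) x = θ c (θ d x)
  map_star : ∀ c x y, inner ℂ (θ c x) y = inner ℂ x (θ (star c) y)

namespace PreRep

open UniformSpace Completion ContinuousLinearMap

variable {C : Type*} [NonUnitalCStarAlgebra C] {X : Type*} [SeminormedAddCommGroup X]
  [InnerProductSpace ℂ X] (r : PreRep C X)

theorem norm_le (c : C) (x : X) : ‖r.θ c x‖ ≤ ‖c‖ * ‖x‖ := by
  obtain ⟨g, hg, h⟩ := exists_defect c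
  refine le_of_sq_le_sq ?_ (by positivity)
  have h1 : ‖r.θ c x‖ ^ 2 = (inner ℂ x (r.θ (star c * c) x)).re := by
    rw [r.map_mul, ← r.map_star]
    exact (inner_self_eq_norm_sq (𝕜 := ℂ) _).symm
  have h2 : ‖r.θ g x‖ ^ 2 = (inner ℂ x (r.θ (g * g) x)).re := by
    conv_rhs => rw [r.map_mul, ← hg, ← r.map_star, hg]
    exact (inner_self_eq_norm_sq (𝕜 := ℂ) _).symm
  have h3 : r.θ (star c * c) x = (2 * ‖c‖ : ℝ) • r.θ g x - r.θ (g * g) x := by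
    rw [h, map_sub, LinearMap.sub_apply, LinearMap.map_smul_of_tower, LinearMap.smul_apply]
  have h4 : ‖(‖c‖ : ℂ) • x - r.θ g x‖ ^ 2 =
      ‖c‖ ^ 2 * ‖x‖ ^ 2 - 2 * ‖c‖ * (inner ℂ x (r.θ g x)).re + ‖r.θ g x‖ ^ 2 := by
    rw [norm_sub_sq (𝕜 := ℂ), norm_smul, inner_smul_left]
    simp
    ring
  have h5 : (inner ℂ x ((2 * ‖c‖ : ℝ) • r.θ g x)).re = 2 * ‖c‖ * (inner ℂ x (r.θ g x)).re := by
    rw [RCLike.real_smul_eq_coe_smul (K := ℂ), inner_smul_right]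
    simp
  rw [h1, h3, inner_sub_right, Complex.sub_re, h5]
  nlinarith [sq_nonneg ‖(‖c‖ : ℂ) • x - r.θ g x‖]

/-- The operators of the representation as bounded operators. -/
def op (c : C) : X →L[ℂ] X := (r.θ c).mkContinuous ‖c‖ (r.norm_le c)

theorem op_apply (c : C) (x : X) : r.op c x = r.θ c x := rfl

theorem op_completion_coe (c : C) (x : X) :
    (r.op c).completion (x : Completion X) = (r.θ c x : Completion X) := by
  rw [ContinuousLinearMap.completion_apply_coe, op_apply]

/-- The operators of the representation on the completion. -/
def extOp (c : C) : Completion X →L[ℂ] Completion X := (r.op c).completion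

theorem extOp_coe (c : C) (x : X) : r.extOp c (x : Completion X) = (r.θ c x : Completion X) :=
  r.op_completion_coe c x

theorem extOp_smul (z : ℂ) (c : C) : r.extOp (z • c) = z • r.extOp c := by
  ext x
  rw [_root_.smul_apply]
  induction x using induction_on with
  | hp => exact isClosed_eq (map_continuous _) ((map_continuous (r.extOp c)).const_smul z)
  | ih x => rw [extOp_coe, extOp_coe, map_smul, LinearMap.smul_apply, Completion.coe_smul]

theorem extOp_add (c d : C) : r.extOp (c + d) = r.extOp c + r.extOp d := by
  ext x
  rw [_root_.add_apply]
  induction x using induction_on with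
  | hp =>
    exact isClosed_eq (map_continuous _)
      ((map_continuous (r.extOp c)).add (map_continuous (r.extOp d)))
  | ih x => rw [extOp_coe, extOp_coe, extOp_coe, map_add, LinearMap.add_apply, Completion.coe_add]

theorem extOp_mul (c d : C) : r.extOp (c * d) = r.extOp c * r.extOp d := by
  ext x
  rw [mul_apply_eq_comp]
  induction x using induction_on with
  | hp =>
    exact isClosed_eq (map_continuous _)
      ((map_continuous (r.extOp c)).comp (map_continuous (r.extOp d)))
  | ih x => rw [extOp_coe, extOp_coe, extOp_coe, r.map_mul]

theorem extOp_star (c : C) : r.extOp (star c) = star (r.extOp c) := by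
  rw [star_eq_adjoint, eq_adjoint_iff]
  intro x y
  induction x, y using induction_on₂ with
  | hp => exact isClosed_eq (((map_continuous (r.extOp (star c))).comp continuous_fst).inner
      continuous_snd) (continuous_fst.inner ((map_continuous (r.extOp c)).comp continuous_snd))
  | ih x y =>
    rw [extOp_coe, extOp_coe, Completion.inner_coe, Completion.inner_coe, r.map_star, star_star]

/-- The extension to the Hilbert space completion. -/
def ext : C →⋆ₙₐ[ℂ] (Completion X →L[ℂ] Completion X) where
  toFun := r.extOp
  map_smul' := r.extOp_smul
  map_zero' := by simpa using r.extOp_smul 0 0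
  map_add' := r.extOp_add
  map_mul' := r.extOp_mul
  map_star' := r.extOp_star

theorem ext_coe (c : C) (x : X) : r.ext c (x : Completion X) = (r.θ c x : Completion X) :=
  r.extOp_coe c x

end PreRep

namespace FellBundle

section Induced

variable {S : Type u} [InverseMonoid S] {𝒜 : FellBundle S} {H : Type u} [NormedAddCommGroup H]
  [InnerProductSpace ℂ H] [CompleteSpace H]

theorem inner_rep {C : Type*} [NonUnitalCStarAlgebra C] (π : C →⋆ₙₐ[ℂ] (H →L[ℂ] H)) (c : C)
    (v w : H) : inner ℂ (π c v) w = inner ℂ v (π (star c) w) := by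
  rw [map_star, ContinuousLinearMap.star_eq_adjoint, ContinuousLinearMap.adjoint_inner_right]

variable (π : 𝒜.fibre 1 →⋆ₙₐ[ℂ] (H →L[ℂ] H))

/-- The algebraic tensor product `A t ⊗ H`, on which a semi-inner product is defined from a
representation of the unit fibre on `H`. -/
@[nolint unusedArguments]
def IndPre (_ : 𝒜.fibre 1 →⋆ₙₐ[ℂ] (H →L[ℂ] H)) (t : S) : Type u := 𝒜.fibre t ⊗[ℂ] H

namespace IndPre

instance (t : S) : AddCommGroup (IndPre π t) := inferInstanceAs (AddCommGroup (𝒜.fibre t ⊗[ℂ] H))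

instance (t : S) : Module ℂ (IndPre π t) := inferInstanceAs (Module ℂ (𝒜.fibre t ⊗[ℂ] H))

/-- Elementary tensors. -/
def tm {t : S} : 𝒜.fibre t →ₗ[ℂ] H →ₗ[ℂ] IndPre π t := TensorProduct.mk ℂ _ _

theorem exists_sum_tm {t : S} (x : IndPre π t) :
    ∃ (n : ℕ) (a : Fin n → 𝒜.fibre t) (v : Fin n → H), x = ∑ i, tm π (a i) (v i) :=
  TensorProduct.exists_sum_tmul_eq (M := 𝒜.fibre t) (N := H) x

/-- The map `a' ⊗ v' ↦ π (a* a') v'`. -/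
def act {t : S} (a : 𝒜.fibre t) : IndPre π t →ₗ[ℂ] H :=
  TensorProduct.lift (LinearMap.mk₂ ℂ (fun (a' : 𝒜.fibre t) v' => π (𝒜.bundle.ip a a') v')
    (by simp [AlgBundle.ip_add_right]) (by simp [AlgBundle.ip_smul_right]) (by simp) (by simp))

theorem act_tm {t : S} (a a' : 𝒜.fibre t) (v : H) :
    act π a (tm π a' v) = π (𝒜.bundle.ip a a') v := rfl

theorem act_add {t : S} (a a' : 𝒜.fibre t) (x : IndPre π t) :
    act π (a + a') x = act π a x + act π a' x := by
  obtain ⟨n, b, v, rfl⟩ := exists_sum_tm π x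
  simp [act_tm, AlgBundle.ip_add_left, Finset.sum_add_distrib]

theorem act_smul {t : S} (z : ℂ) (a : 𝒜.fibre t) (x : IndPre π t) :
    act π (z • a) x = conj z • act π a x := by
  obtain ⟨n, b, v, rfl⟩ := exists_sum_tm π x
  simp [act_tm, AlgBundle.ip_smul_left, Finset.smul_sum]

/-- The sesquilinear form `⟨a ⊗ v, a' ⊗ v'⟩ = ⟨v, π (a* a') v'⟩`. -/
def form {t : S} (y : IndPre π t) : IndPre π t →ₗ⋆[ℂ] ℂ :=
  TensorProduct.lift (LinearMap.mk₂'ₛₗ (starRingEnd ℂ) (starRingEnd ℂ)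
    (fun (a : 𝒜.fibre t) (v : H) => inner ℂ v (act π a y))
    (fun a a' v => by rw [act_add, inner_add_right])
    (fun z a v => by rw [act_smul, inner_smul_right]; rfl)
    (fun a v v' => inner_add_left _ _ _)
    (fun z a v => inner_smul_left _ _ _))

theorem form_tm {t : S} (y : IndPre π t) (a : 𝒜.fibre t) (v : H) :
    form π y (tm π a v) = inner ℂ v (act π a y) := rfl

theorem form_sum_sum {t : S} {n : ℕ} (a : Fin n → 𝒜.fibre t) (v : Fin n → H) {m : ℕ}
    (a' : Fin m → 𝒜.fibre t) (v' : Fin m → H) :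
    form π (∑ j, tm π (a' j) (v' j)) (∑ i, tm π (a i) (v i)) =
      ∑ i, ∑ j, inner ℂ (v i) (π (𝒜.bundle.ip (a i) (a' j)) (v' j)) := by
  simp [form_tm, act_tm]

theorem form_symm {t : S} (x y : IndPre π t) : conj (form π x y) = form π y x := by
  obtain ⟨n, a, v, rfl⟩ := exists_sum_tm π x
  obtain ⟨m, a', v', rfl⟩ := exists_sum_tm π y
  rw [form_sum_sum, form_sum_sum, Finset.sum_comm]
  simp only [map_sum]
  refine Finset.sum_congr rfl fun i _ => Finset.sum_congr rfl fun j _ => ?_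
  rw [inner_conj_symm, inner_rep, star_def, 𝒜.bundle.starOne_ip]

theorem form_nonneg {t : S} (x : IndPre π t) : 0 ≤ (form π x x).re := by
  obtain ⟨n, a, v, rfl⟩ := exists_sum_tm π x
  set M : ℝ := ∑ i, ∑ j, ‖v i‖ * (‖a i‖ * ‖v j‖) with hM
  have hM0 : 0 ≤ M := by positivity
  refine le_of_forall_pos_le_add fun ε hε => ?_
  obtain ⟨w, u, -, hwa, hw⟩ := 𝒜.exists_factorization a (δ := ε / (M + 1)) (by positivity)
  have h : ∀ k i j, inner ℂ (π (𝒜.bundle.ip (u k) (a i)) (v i))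
      (π (𝒜.bundle.ip (u k) (a j)) (v j)) = inner ℂ (v i)
        (π (𝒜.bundle.ip (𝒜.bundle.ip (u k) (a i)) (𝒜.bundle.ip (u k) (a j))) (v j)) := by
    intro k i j
    rw [inner_rep, 𝒜.bundle.ip_eq_mulOne, ← star_def, ← mul_def, map_mul]
    rfl
  have e : ∑ k, inner ℂ (∑ i, π (𝒜.bundle.ip (u k) (a i)) (v i))
      (∑ i, π (𝒜.bundle.ip (u k) (a i)) (v i)) =
      ∑ i, ∑ j, inner ℂ (v i) (π (𝒜.bundle.ip (a i) (𝒜.bundle.lact w (a j))) (v j)) := by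
    refine (Finset.sum_congr rfl fun k _ => (sum_inner _ _ _).trans
      (Finset.sum_congr rfl fun i _ => inner_sum _ _ _)).trans ?_
    simp only [hw, map_sum, _root_.sum_apply, h]
    rw [Finset.sum_comm]
    refine Finset.sum_congr rfl fun i _ => ?_
    rw [Finset.sum_comm]
    exact Finset.sum_congr rfl fun j _ => (inner_sum _ _ _).symm
  have hre : 0 ≤ (∑ k, inner ℂ (∑ i, π (𝒜.bundle.ip (u k) (a i)) (v i))
      (∑ i, π (𝒜.bundle.ip (u k) (a i)) (v i))).re := by
    rw [Complex.re_sum]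
    exact Finset.sum_nonneg fun k _ => inner_self_nonneg (𝕜 := ℂ)
  have hd : ‖(∑ i, ∑ j, inner ℂ (v i) (π (𝒜.bundle.ip (a i)
      (𝒜.bundle.lact w (a j))) (v j))) - form π (∑ i, tm π (a i) (v i)) (∑ i, tm π (a i) (v i))‖ ≤
      ε := by
    rw [form_sum_sum, ← Finset.sum_sub_distrib]
    simp only [← Finset.sum_sub_distrib]
    calc _ ≤ ∑ i, ∑ j, ‖v i‖ * (‖a i‖ * ‖v j‖) * (ε / (M + 1)) := by
          refine norm_sum_le_of_le _ fun i _ => norm_sum_le_of_le _ fun j _ => ?_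
          have e2 : 𝒜.bundle.ip (a i) (𝒜.bundle.lact w (a j)) - 𝒜.bundle.ip (a i) (a j) =
              𝒜.bundle.ip (a i) (𝒜.bundle.lact w (a j) - a j) := by
            simp [AlgBundle.ip, AlgBundle.mulTo]
          rw [← inner_sub_right, ← _root_.sub_apply, ← map_sub, e2]
          have h1 : ‖𝒜.bundle.ip (a i) (𝒜.bundle.lact w (a j) - a j)‖ ≤
              ‖a i‖ * (ε / (M + 1)) := by
            refine (𝒜.bundle.norm_mulTo_le _ _ _).trans ?_
            rw [𝒜.bundle.norm_star, norm_sub_rev]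
            gcongr
            exact hwa j
          calc _ ≤ ‖v i‖ * (‖π (𝒜.bundle.ip (a i) (𝒜.bundle.lact w (a j) - a j))‖ * ‖v j‖) :=
                (norm_inner_le_norm _ _).trans
                  (mul_le_mul_of_nonneg_left (ContinuousLinearMap.le_opNorm _ _) (norm_nonneg _))
            _ ≤ ‖v i‖ * (‖a i‖ * (ε / (M + 1)) * ‖v j‖) := by
                gcongr
                exact (NonUnitalStarAlgHom.norm_apply_le π _).trans h1
            _ = _ := by ring
      _ = M * (ε / (M + 1)) := by simp only [hM, Finset.sum_mul]
      _ ≤ ε := by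
          rw [← mul_div_assoc, div_le_iff₀ (by positivity)]
          nlinarith
  rw [e] at hre
  have h2 := (Complex.re_le_norm _).trans hd
  rw [Complex.sub_re] at h2
  linarith

/-- The semi-inner product on `A t ⊗ H`. -/
abbrev core (t : S) : PreInnerProductSpace.Core ℂ (IndPre π t) where
  inner x y := form π y x
  conj_inner_symm x y := form_symm π x y
  re_inner_nonneg x := form_nonneg π x
  add_left _ _ z := map_add (form π z) _ _
  smul_left x y r := (form π y).map_smulₛₗ r x

instance (t : S) : SeminormedAddCommGroup (IndPre π t) :=
  InnerProductSpace.Core.toSeminormedAddCommGroup (c := core π t)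

instance (t : S) : InnerProductSpace ℂ (IndPre π t) := InnerProductSpace.ofCore (core π t)

theorem inner_eq {t : S} (x y : IndPre π t) : inner ℂ x y = form π y x := rfl

end IndPre
end Induced
end FellBundle

namespace FellBundle.IndPre

variable {S : Type u} [InverseMonoid S] {𝒜 : FellBundle S} {H : Type u} [NormedAddCommGroup H]
  [InnerProductSpace ℂ H] [CompleteSpace H] (π : 𝒜.fibre 1 →⋆ₙₐ[ℂ] (H →L[ℂ] H))

theorem inner_sum_sum {t : S} {n : ℕ} (a : Fin n → 𝒜.fibre t) (v : Fin n → H) {m : ℕ}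
    (a' : Fin m → 𝒜.fibre t) (v' : Fin m → H) :
    inner ℂ (∑ i, tm π (a i) (v i)) (∑ j, tm π (a' j) (v' j)) =
      ∑ i, ∑ j, inner ℂ (v i) (π (𝒜.bundle.ip (a i) (a' j)) (v' j)) :=
  form_sum_sum π a v a' v'

/-- The left action of the unit fibre on `A t ⊗ H`, as a bilinear map. -/
def leftMap (t : S) : 𝒜.fibre 1 →ₗ[ℂ] IndPre π t →ₗ[ℂ] IndPre π t :=
  LinearMap.mk₂ ℂ
    (fun c (x : IndPre π t) => TensorProduct.map
      (𝒜.bundle.incl (le_of_eq (one_mul t)) ∘ₗ 𝒜.bundle.mul 1 t c) LinearMap.id x)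
    (fun c c' x => by
      rw [map_add, LinearMap.comp_add, TensorProduct.map_add_left]; rfl)
    (fun z c x => by
      rw [map_smul, LinearMap.comp_smul, TensorProduct.map_smul_left]; rfl)
    (fun c x x' => map_add _ _ _) (fun z c x => map_smul _ _ _)

theorem leftMap_tm {t : S} (c : 𝒜.fibre 1) (a : 𝒜.fibre t) (v : H) :
    leftMap π t c (tm π a v) = tm π (𝒜.bundle.lact c a) v := rfl

/-- The left action of the unit fibre on `A t ⊗ H`. -/
def leftRep (t : S) : PreRep (𝒜.fibre 1) (IndPre π t) where
  θ := leftMap π t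
  map_mul c d x := by
    obtain ⟨n, a, v, rfl⟩ := exists_sum_tm π x
    simp only [map_sum, leftMap_tm, 𝒜.bundle.lact_lact, mul_def]
  map_star c x y := by
    obtain ⟨n, a, v, rfl⟩ := exists_sum_tm π x
    obtain ⟨m, a', v', rfl⟩ := exists_sum_tm π y
    simp only [map_sum, leftMap_tm, inner_sum_sum, 𝒜.bundle.ip_lact, star_def]

section Right

variable {B : Type u} [NonUnitalCStarAlgebra B] (ρ : B →⋆ₙₐ[ℂ] (H →L[ℂ] H))

/-- The operators `1 ⊗ ρ b` on `A t ⊗ H`, as a bilinear map. -/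
def rightMap (t : S) : B →ₗ[ℂ] IndPre π t →ₗ[ℂ] IndPre π t :=
  LinearMap.mk₂ ℂ
    (fun b (x : IndPre π t) => TensorProduct.map LinearMap.id (ρ b).toLinearMap x)
    (fun b b' x => by
      rw [map_add, ContinuousLinearMap.toLinearMap_add, TensorProduct.map_add_right]; rfl)
    (fun z b x => by
      rw [map_smul, ContinuousLinearMap.toLinearMap_smul, TensorProduct.map_smul_right]; rfl)
    (fun c x x' => map_add _ _ _) (fun z c x => map_smul _ _ _)

theorem rightMap_tm {t : S} (b : B) (a : 𝒜.fibre t) (v : H) :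
    rightMap π ρ t b (tm π a v) = tm π a (ρ b v) := rfl

/-- The representation `b ↦ 1 ⊗ ρ b` on `A t ⊗ H`. -/
def rightRep (h : ∀ c b, π c * ρ b = ρ b * π c) (t : S) : PreRep B (IndPre π t) where
  θ := rightMap π ρ t
  map_mul c d x := by
    obtain ⟨n, a, v, rfl⟩ := exists_sum_tm π x
    simp only [map_sum, rightMap_tm, map_mul, mul_apply_eq_comp]
  map_star b x y := by
    obtain ⟨n, a, v, rfl⟩ := exists_sum_tm π x
    obtain ⟨m, a', v', rfl⟩ := exists_sum_tm π y
    simp only [map_sum, rightMap_tm, inner_sum_sum, inner_rep, ← mul_apply_eq_comp, h]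

theorem ext_commute (h : ∀ c b, π c * ρ b = ρ b * π c) (t : S) (c : 𝒜.fibre 1) (b : B) :
    (leftRep π t).ext c * (rightRep π ρ h t).ext b =
      (rightRep π ρ h t).ext b * (leftRep π t).ext c := by
  ext x
  rw [mul_apply_eq_comp, mul_apply_eq_comp]
  induction x using UniformSpace.Completion.induction_on with
  | hp =>
    exact isClosed_eq
      ((map_continuous ((leftRep π t).ext c)).comp (map_continuous ((rightRep π ρ h t).ext b)))
      ((map_continuous ((rightRep π ρ h t).ext b)).comp (map_continuous ((leftRep π t).ext c)))
  | ih x =>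
    rw [PreRep.ext_coe, PreRep.ext_coe, PreRep.ext_coe, PreRep.ext_coe]
    congr 1
    obtain ⟨n, a, v, rfl⟩ := exists_sum_tm π x
    change leftMap π t c (rightMap π ρ t b _) = rightMap π ρ t b (leftMap π t c _)
    simp only [map_sum, leftMap_tm, rightMap_tm]

end Right

/-- The norm of an elementary tensor. -/
theorem norm_tm_le {t : S} (a : 𝒜.fibre t) (v : H) : ‖tm π a v‖ ≤ ‖a‖ * ‖v‖ := by
  refine le_of_sq_le_sq ?_ (by positivity)
  rw [← inner_self_eq_norm_sq (𝕜 := ℂ)]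
  change (inner ℂ v (π (𝒜.bundle.ip a a) v)).re ≤ _
  calc _ ≤ ‖v‖ * (‖π (𝒜.bundle.ip a a)‖ * ‖v‖) :=
        (Complex.re_le_norm _).trans ((norm_inner_le_norm _ _).trans
          (mul_le_mul_of_nonneg_left (ContinuousLinearMap.le_opNorm _ _) (norm_nonneg _)))
    _ ≤ ‖v‖ * (‖a‖ ^ 2 * ‖v‖) := by
        gcongr
        rw [← 𝒜.bundle.norm_ip_self]
        exact NonUnitalStarAlgHom.norm_apply_le π _
    _ = _ := by ring

/-- The creation operators `v ↦ a ⊗ v`. -/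
def create (t : S) : 𝒜.fibre t →ₗ[ℂ] (H →L[ℂ] UniformSpace.Completion (IndPre π t)) where
  toFun a := UniformSpace.Completion.toComplL.comp
    ((tm π a).mkContinuous ‖a‖ (norm_tm_le π a))
  map_add' a a' := by
    ext v
    change ((tm π (a + a') v : IndPre π t) : UniformSpace.Completion (IndPre π t)) =
      (tm π a v : IndPre π t) + (tm π a' v : IndPre π t)
    rw [map_add, LinearMap.add_apply, UniformSpace.Completion.coe_add]
  map_smul' z a := by
    ext v
    change ((tm π (z • a) v : IndPre π t) : UniformSpace.Completion (IndPre π t)) =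
      z • ((tm π a v : IndPre π t) : UniformSpace.Completion (IndPre π t))
    rw [map_smul, LinearMap.smul_apply, UniformSpace.Completion.coe_smul]

theorem create_apply {t : S} (a : 𝒜.fibre t) (v : H) :
    create π t a v = ((tm π a v : IndPre π t) : UniformSpace.Completion (IndPre π t)) := rfl

theorem inner_create {t : S} (a a' : 𝒜.fibre t) (v v' : H) :
    inner ℂ (create π t a v) (create π t a' v') = inner ℂ v (π (𝒜.bundle.ip a a') v') := by
  rw [create_apply, create_apply, UniformSpace.Completion.inner_coe]
  rfl

theorem ext_create {t : S} (c : 𝒜.fibre 1) (a : 𝒜.fibre t) (v : H) :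
    (leftRep π t).ext c (create π t a v) = create π t (𝒜.bundle.lact c a) v := by
  rw [create_apply, PreRep.ext_coe]
  rfl

theorem ext_right_create {B : Type u} [NonUnitalCStarAlgebra B] (ρ : B →⋆ₙₐ[ℂ] (H →L[ℂ] H))
    (h : ∀ c b, π c * ρ b = ρ b * π c) {t : S} (b : B) (a : 𝒜.fibre t) (v : H) :
    (rightRep π ρ h t).ext b (create π t a v) = create π t a (ρ b v) := by
  rw [create_apply, PreRep.ext_coe]
  rfl

end FellBundle.IndPre

section TensorNorms

variable (A B : Type u) [NonUnitalCStarAlgebra A] [NonUnitalCStarAlgebra B]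

/-- A pair of commuting representations of two `C*`-algebras on one Hilbert space. -/
structure CommRep where
  H : Type u
  [normed : NormedAddCommGroup H]
  [inner : InnerProductSpace ℂ H]
  [complete : CompleteSpace H]
  π : A →⋆ₙₐ[ℂ] (H →L[ℂ] H)
  ρ : B →⋆ₙₐ[ℂ] (H →L[ℂ] H)
  comm : ∀ a b, π a * ρ b = ρ b * π a

/-- A pair of representations of two `C*`-algebras on two Hilbert spaces. -/
structure PairRep where
  H : Type u
  K : Type u
  [normedH : NormedAddCommGroup H]
  [innerH : InnerProductSpace ℂ H]
  [completeH : CompleteSpace H]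
  [normedK : NormedAddCommGroup K]
  [innerK : InnerProductSpace ℂ K]
  [completeK : CompleteSpace K]
  π : A →⋆ₙₐ[ℂ] (H →L[ℂ] H)
  ρ : B →⋆ₙₐ[ℂ] (K →L[ℂ] K)

variable {A B}

namespace CommRep

instance (r : CommRep A B) : NormedAddCommGroup r.H := r.normed
instance (r : CommRep A B) : InnerProductSpace ℂ r.H := r.inner
instance (r : CommRep A B) : CompleteSpace r.H := r.complete

/-- The representation `a ⊗ b ↦ π a ρ b` of the algebraic tensor product. -/
def prodMap (r : CommRep A B) : A ⊗[ℂ] B →ₗ[ℂ] (r.H →L[ℂ] r.H) :=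
  TensorProduct.lift (LinearMap.mk₂ ℂ (fun a b => r.π a * r.ρ b)
    (by simp [add_mul]) (by simp) (by simp [mul_add]) (by simp))

end CommRep

namespace PairRep

instance (r : PairRep A B) : NormedAddCommGroup r.H := r.normedH
instance (r : PairRep A B) : InnerProductSpace ℂ r.H := r.innerH
instance (r : PairRep A B) : CompleteSpace r.H := r.completeH
instance (r : PairRep A B) : NormedAddCommGroup r.K := r.normedK
instance (r : PairRep A B) : InnerProductSpace ℂ r.K := r.innerK
instance (r : PairRep A B) : CompleteSpace r.K := r.completeK

/-- The representation `a ⊗ b ↦ π a ⊗ ρ b` of the algebraic tensor product, by bounded operators on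
the (not completed) inner product space `H ⊗ K`. -/
def prodMap (r : PairRep A B) : A ⊗[ℂ] B →ₗ[ℂ] (r.H ⊗[ℂ] r.K →L[ℂ] r.H ⊗[ℂ] r.K) :=
  TensorProduct.lift (LinearMap.mk₂ ℂ (fun a b => TensorProduct.mapL (r.π a) (r.ρ b))
    (by simp [TensorProduct.mapL_add_left]) (by simp [TensorProduct.mapL_smul_left])
    (by simp [TensorProduct.mapL_add_right]) (by simp [TensorProduct.mapL_smul_right]))

end PairRep

/-- The maximal `C*`-norm on the algebraic tensor product of two `C*`-algebras: the supremum of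
`‖∑ π (aᵢ) ρ (bᵢ)‖` over all pairs of commuting representations. -/
def maxTensorNorm (x : A ⊗[ℂ] B) : ℝ := ⨆ r : CommRep A B, ‖r.prodMap x‖

/-- The minimal (spatial) `C*`-norm on the algebraic tensor product of two `C*`-algebras: the
supremum of `‖∑ π (aᵢ) ⊗ ρ (bᵢ)‖` over all pairs of representations. -/
def minTensorNorm (x : A ⊗[ℂ] B) : ℝ := ⨆ r : PairRep A B, ‖r.prodMap x‖

end TensorNorms

namespace FellBundle

variable {S : Type u} [InverseMonoid S] {𝒜 : FellBundle S} {B : Type u} [NonUnitalCStarAlgebra B]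

theorem prodMap_comm_tmul (r : CommRep (𝒜.fibre 1) B) (c : 𝒜.fibre 1) (b : B) (v : r.H) :
    r.prodMap (c ⊗ₜ b) v = r.π c (r.ρ b v) := rfl

theorem prodMap_pair_tmul (r : PairRep (𝒜.fibre 1) B) (c : 𝒜.fibre 1) (b : B) :
    r.prodMap (c ⊗ₜ b) = TensorProduct.mapL (r.π c) (r.ρ b) := rfl

/-- The pair of commuting representations induced by the fibre at `t`. -/
def indComm (r : CommRep (𝒜.fibre 1) B) (t : S) : CommRep (𝒜.fibre 1) B where
  H := UniformSpace.Completion (IndPre r.π t)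
  π := (IndPre.leftRep r.π t).ext
  ρ := (IndPre.rightRep r.π r.ρ r.comm t).ext
  comm := IndPre.ext_commute r.π r.ρ r.comm t

/-- The pair of representations induced by the fibre at `t`. -/
def indPair (r : PairRep (𝒜.fibre 1) B) (t : S) : PairRep (𝒜.fibre 1) B where
  H := UniformSpace.Completion (IndPre r.π t)
  K := r.K
  π := (IndPre.leftRep r.π t).ext
  ρ := r.ρ

/-- The operators `v ↦ a ⊗ ρ b v`. -/
def createComm (r : CommRep (𝒜.fibre 1) B) (t : S) :
    𝒜.fibre t ⊗[ℂ] B →ₗ[ℂ] (r.H →L[ℂ] UniformSpace.Completion (IndPre r.π t)) :=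
  TensorProduct.lift (LinearMap.mk₂ ℂ (fun a b => (IndPre.create r.π t a).comp (r.ρ b))
    (fun a a' b => by rw [map_add, ContinuousLinearMap.add_comp])
    (fun z a b => by rw [map_smul, ContinuousLinearMap.smul_comp])
    (fun a b b' => by rw [map_add, ContinuousLinearMap.comp_add])
    (fun z a b => by rw [map_smul, ContinuousLinearMap.comp_smul]))

theorem createComm_tmul (r : CommRep (𝒜.fibre 1) B) (t : S) (a : 𝒜.fibre t) (b : B) (v : r.H) :
    createComm r t (a ⊗ₜ b) v = IndPre.create r.π t a (r.ρ b v) := rfl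

/-- The operators `v ⊗ w ↦ (a ⊗ v) ⊗ ρ b w`. -/
def createPair (r : PairRep (𝒜.fibre 1) B) (t : S) : 𝒜.fibre t ⊗[ℂ] B →ₗ[ℂ]
    (r.H ⊗[ℂ] r.K →L[ℂ] UniformSpace.Completion (IndPre r.π t) ⊗[ℂ] r.K) :=
  TensorProduct.lift (LinearMap.mk₂ ℂ
    (fun a b => TensorProduct.mapL (IndPre.create r.π t a) (r.ρ b))
    (fun a a' b => by rw [map_add, TensorProduct.mapL_add_left])
    (fun z a b => by rw [map_smul, TensorProduct.mapL_smul_left])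
    (fun a b b' => by rw [map_add, TensorProduct.mapL_add_right])
    (fun z a b => by rw [map_smul, TensorProduct.mapL_smul_right]))

theorem createPair_tmul (r : PairRep (𝒜.fibre 1) B) (t : S) (a : 𝒜.fibre t) (b : B) :
    createPair r t (a ⊗ₜ b) = TensorProduct.mapL (IndPre.create r.π t a) (r.ρ b) := rfl

theorem ip_eq (c d : 𝒜.fibre 1) : 𝒜.bundle.ip c d = star c * d := 𝒜.bundle.ip_eq_mulOne c d

theorem comm_apply (r : CommRep (𝒜.fibre 1) B) (c : 𝒜.fibre 1) (b : B) (v : r.H) :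
    r.ρ b (r.π c v) = r.π c (r.ρ b v) := (DFunLike.congr_fun (r.comm c b) v).symm

theorem inner_comm_one (r : CommRep (𝒜.fibre 1) B) (c c' : 𝒜.fibre 1) (b b' : B) (v w : r.H) :
    inner ℂ (r.prodMap (c ⊗ₜ b) v) (r.prodMap (c' ⊗ₜ b') w) =
      inner ℂ v (r.prodMap (𝒜.bundle.ip c c' ⊗ₜ (star b * b')) w) := by
  simp only [prodMap_comm_tmul, inner_rep, ip_eq, map_mul, mul_apply_eq_comp, comm_apply]

theorem isBundleNorm_max :
    𝒜.IsBundleNorm B (maxTensorNorm (A := 𝒜.fibre 1) (B := B)) := by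
  refine IsBundleNorm.of_family_tmul (fun r : CommRep (𝒜.fibre 1) B => r.prodMap) (fun r c b => ?_)
    inner_comm_one fun t r => ⟨indComm r t, createComm r t, ?_, ?_⟩
  · refine (norm_mul_le (r.π c) (r.ρ b)).trans ?_
    gcongr <;> exact NonUnitalStarAlgHom.norm_apply_le _ _
  · intro a a' b b' v w
    have h : inner ℂ (createComm r t (a ⊗ₜ b) v) (createComm r t (a' ⊗ₜ b') w) =
        inner ℂ v (r.prodMap (𝒜.bundle.ip a a' ⊗ₜ (star b * b')) w) := by
      simp only [prodMap_comm_tmul, createComm_tmul, IndPre.inner_create, inner_rep, map_mul,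
        mul_apply_eq_comp, comm_apply]
    exact h
  · intro c b a b' v
    change createComm r t (𝒜.bundle.lact c a ⊗ₜ (b * b')) v = (IndPre.leftRep r.π t).ext c
      ((IndPre.rightRep r.π r.ρ r.comm t).ext b (createComm r t (a ⊗ₜ b') v))
    simp only [createComm_tmul, IndPre.ext_right_create, IndPre.ext_create, map_mul,
      mul_apply_eq_comp]

theorem inner_mapL {E F G K : Type*} [NormedAddCommGroup E] [InnerProductSpace ℂ E]
    [NormedAddCommGroup F] [InnerProductSpace ℂ F] [NormedAddCommGroup G] [InnerProductSpace ℂ G]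
    [NormedAddCommGroup K] [InnerProductSpace ℂ K] (f f' : E →L[ℂ] F) (g g' : G →L[ℂ] K)
    (h : E →L[ℂ] E) (k : G →L[ℂ] G) (hf : ∀ v w, inner ℂ (f v) (f' w) = inner ℂ v (h w))
    (hg : ∀ v w, inner ℂ (g v) (g' w) = inner ℂ v (k w)) (x y : E ⊗[ℂ] G) :
    inner ℂ (TensorProduct.mapL f g x) (TensorProduct.mapL f' g' y) =
      inner ℂ x (TensorProduct.mapL h k y) := by
  induction x with
  | zero => simp
  | add x x' hx hx' => rw [map_add, inner_add_left, inner_add_left, hx, hx']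
  | tmul v w =>
    induction y with
    | zero => simp
    | add y y' hy hy' => rw [map_add, map_add, inner_add_right, inner_add_right, hy, hy']
    | tmul v' w' => simp [hf, hg]

theorem inner_rep_rep {C H : Type*} [NonUnitalCStarAlgebra C] [NormedAddCommGroup H]
    [InnerProductSpace ℂ H] [CompleteSpace H] (π : C →⋆ₙₐ[ℂ] (H →L[ℂ] H)) (c c' : C) (v w : H) :
    inner ℂ (π c v) (π c' w) = inner ℂ v (π (star c * c') w) := by
  rw [map_mul, mul_apply_eq_comp, map_star, ContinuousLinearMap.star_eq_adjoint,
    ContinuousLinearMap.adjoint_inner_right]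

theorem isBundleNorm_min :
    𝒜.IsBundleNorm B (minTensorNorm (A := 𝒜.fibre 1) (B := B)) := by
  refine IsBundleNorm.of_family_tmul (fun r : PairRep (𝒜.fibre 1) B => r.prodMap) (fun r c b => ?_)
    (fun r c c' b b' => ?_) fun t r => ⟨indPair r t, createPair r t, ?_, ?_⟩
  · refine (TensorProduct.norm_mapL_le (r.π c) (r.ρ b)).trans ?_
    gcongr <;> exact NonUnitalStarAlgHom.norm_apply_le _ _
  · rw [ip_eq]
    exact inner_mapL _ _ _ _ _ _ (inner_rep_rep r.π c c') (inner_rep_rep r.ρ b b')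
  · intro a a' b b'
    exact inner_mapL _ _ _ _ _ _ (IndPre.inner_create r.π a a') (inner_rep_rep r.ρ b b')
  · intro c b a b' v
    change TensorProduct.mapL (IndPre.create r.π t (𝒜.bundle.lact c a)) (r.ρ (b * b')) v =
      TensorProduct.mapL ((IndPre.leftRep r.π t).ext c) (r.ρ b)
        (TensorProduct.mapL (IndPre.create r.π t a) (r.ρ b') v)
    induction v with
    | zero => simp
    | add v v' hv hv' => rw [map_add, map_add, map_add, hv, hv']
    | tmul v w =>
      simp only [TensorProduct.mapL_tmul, IndPre.ext_create, map_mul, mul_apply_eq_comp]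

variable (𝒜 B)

/-- The minimal tensor product of a Fell bundle with a `C*`-algebra: its fibre at `s` is the
completion of `A s ⊗ B` in the norm `x ↦ ‖x* x‖ ^ (1 / 2)`, where `‖x* x‖` is the minimal `C*`-norm
on `A 1 ⊗ B`. -/
def minTensor : FellBundle S := IsBundleNorm.tensor (isBundleNorm_min (𝒜 := 𝒜) (B := B))

/-- The maximal tensor product of a Fell bundle with a `C*`-algebra: its fibre at `s` is the
completion of `A s ⊗ B` in the norm `x ↦ ‖x* x‖ ^ (1 / 2)`, where `‖x* x‖` is the maximal `C*`-norm
on `A 1 ⊗ B`. -/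
def maxTensor : FellBundle S := IsBundleNorm.tensor (isBundleNorm_max (𝒜 := 𝒜) (B := B))

end FellBundle

end

/-!
In any representation of `𝒜`, the units `1_{pt*}`, indexed by pairs `(p, t)`, are commuting
projections which are symmetric in `p` and `t` and satisfy `1_{pt*} 1_{tr*} ≤ 1_{pr*}`. Such a
projection-valued partial equivalence relation is a positive kernel, and Cauchy–Schwarz for its
semi-inner product bounds the norm of `a ↦ ∑ 1_{p(st)*} ξ(p)* a ξ(t)` by the norm of
`∑ ξ(p)* ξ(t) 1_{pt*}`.

A nondegenerate representation of a tensor product bundle is a product `a ⊗ b ↦ τ(a) ρ(b)` of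
commuting representations, and the units computed in it are those computed in `τ`. So for a net
`ξ_i` witnessing the approximation property of `𝒜` and an approximate unit `e_j` of `B`, the
functions `ξ_i ⊗ e_j` are bounded as in (i) and converge as in (ii) on elementary tensors. By the
norm bound above, convergence extends to the closed linear span of the elementary tensors.
-/

noncomputable section

open scoped TensorProduct Topology

open InverseMonoid Filter

namespace InverseMonoid

variable {S : Type u} [InverseMonoid S]

theorem idem_mul_le {e s t : S} (he : e * e = e) (h : s ≤ t) : e * s ≤ t := by
  simpa using mul_le_mul (show e ≤ 1 from ⟨e, he, one_mul e⟩) h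

theorem mul_idem_le {e s t : S} (he : e * e = e) (h : s ≤ t) : s * e ≤ t := by
  simpa using mul_le_mul h (show e ≤ 1 from ⟨e, he, one_mul e⟩)

theorem idem_le_inv {e s : S} (he : e * e = e) (h : e ≤ s) : e ≤ s⁻¹ := by
  simpa only [idem_inv he] using inv_le_inv h

theorem inv_conj_conj_le (s t : S) : s⁻¹ * (s * t * s⁻¹) * s ≤ t :=
  calc s⁻¹ * (s * t * s⁻¹) * s = s⁻¹ * s * (t * (s⁻¹ * s)) := by simp only [mul_assoc]
    _ ≤ t := idem_mul_le (inv_mul_idem s) (mul_idem_le (inv_mul_idem s) (le_of_eq rfl))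

theorem mul_inv_mul_mul_inv_le (s t r : S) : s * t⁻¹ * (t * r⁻¹) ≤ s * r⁻¹ :=
  calc s * t⁻¹ * (t * r⁻¹) = s * (t⁻¹ * t * r⁻¹) := by simp only [mul_assoc]
    _ ≤ s * r⁻¹ := mul_le_mul (le_of_eq rfl) (idem_mul_le (inv_mul_idem t) (le_of_eq rfl))

theorem inv_mul_self_idem_mul {e : S} (he : e * e = e) (s : S) :
    (e * s)⁻¹ * (e * s) = s⁻¹ * e * s := by
  rw [InverseMonoid.mul_inv_rev, idem_inv he, mul_assoc, ← mul_assoc e e s, he, mul_assoc]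

end InverseMonoid

section Projections

variable {𝕜 H H' : Type*} [RCLike 𝕜]
  [NormedAddCommGroup H] [InnerProductSpace 𝕜 H] [CompleteSpace H]
  [NormedAddCommGroup H'] [InnerProductSpace 𝕜 H'] [CompleteSpace H']

theorem starProjection_apply_of_mapsTo_orthogonal {K : Submodule 𝕜 H} {K' : Submodule 𝕜 H'}
    [K.HasOrthogonalProjection] [K'.HasOrthogonalProjection] {T : H →L[𝕜] H'}
    (h : ∀ x ∈ Kᗮ, T x ∈ K'ᗮ) (h' : ∀ y ∈ K'ᗮ, T.adjoint y ∈ Kᗮ) (x : H) :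
    K'.starProjection (T x) = T (K.starProjection x) := by
  refine Submodule.eq_starProjection_of_mem_orthogonal ?_ ?_
  · rw [← K'.orthogonal_orthogonal, Submodule.mem_orthogonal]
    intro y hy
    rw [← ContinuousLinearMap.adjoint_inner_left]
    exact Submodule.inner_left_of_mem_orthogonal (Submodule.starProjection_apply_mem K x) (h' y hy)
  · rw [← map_sub]
    exact h _ (Submodule.sub_starProjection_mem_orthogonal x)

end Projections

namespace FellBundle

variable {S : Type u} [InverseMonoid S]

/-- A possibly degenerate representation of a Fell bundle on a Hilbert space. The Hilbert space may
live in any universe, so that the universal representation is an instance. -/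
structure HilbertRep (𝒜 : FellBundle S) (H : Type*) [NormedAddCommGroup H] [InnerProductSpace ℂ H]
    [CompleteSpace H] where
  π : ∀ s : S, 𝒜.fibre s →ₗ[ℂ] (H →L[ℂ] H)
  map_mul : ∀ (s t : S) (a : 𝒜.fibre s) (b : 𝒜.fibre t),
    π (s * t) (𝒜.bundle.mul s t a b) = π s a * π t b
  map_star : ∀ (s : S) (a : 𝒜.fibre s), π s⁻¹ (𝒜.bundle.star s a) = star (π s a)
  map_incl : ∀ (s t : S) (h : s ≤ t) (a : 𝒜.fibre s), π t (𝒜.bundle.incl h a) = π s a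

namespace HilbertRep

variable {𝒜 : FellBundle S} {H H' : Type*}
  [NormedAddCommGroup H] [InnerProductSpace ℂ H] [CompleteSpace H]
  [NormedAddCommGroup H'] [InnerProductSpace ℂ H'] [CompleteSpace H']
  (σ : 𝒜.HilbertRep H)

theorem map_mulTo {s t r : S} (h : s * t ≤ r) (a : 𝒜.fibre s) (b : 𝒜.fibre t) :
    σ.π r (𝒜.bundle.mulTo h a b) = σ.π s a * σ.π t b :=
  (σ.map_incl _ _ _ _).trans (σ.map_mul s t a b)

theorem map_starTo {s r : S} (h : s⁻¹ ≤ r) (a : 𝒜.fibre s) :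
    σ.π r (𝒜.bundle.starTo h a) = star (σ.π s a) :=
  (σ.map_incl _ _ _ _).trans (σ.map_star s a)

theorem map_ip {s : S} (a b : 𝒜.fibre s) :
    σ.π 1 (𝒜.bundle.ip a b) = star (σ.π s a) * σ.π s b := by
  rw [AlgBundle.ip, map_mulTo, map_star]

theorem map_mul_one (c d : 𝒜.fibre 1) : σ.π 1 (c * d) = σ.π 1 c * σ.π 1 d :=
  σ.map_mulTo _ c d

theorem map_star_one (c : 𝒜.fibre 1) : σ.π 1 (star c) = star (σ.π 1 c) :=
  σ.map_starTo _ c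

/-- The restriction of a representation to the unit fibre. -/
def one : 𝒜.fibre 1 →⋆ₙₐ[ℂ] (H →L[ℂ] H) where
  __ := σ.π 1
  map_zero' := map_zero (σ.π 1)
  map_mul' := σ.map_mul_one
  map_star' := σ.map_star_one

theorem norm_le (s : S) (a : 𝒜.fibre s) : ‖σ.π s a‖ ≤ ‖a‖ := by
  have h : ‖σ.π s a‖ ^ 2 ≤ ‖a‖ ^ 2 := by
    rw [sq, ← CStarRing.norm_star_mul_self, ← σ.map_ip, ← 𝒜.bundle.norm_ip_self]
    exact NonUnitalStarAlgHom.norm_apply_le σ.one _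
  exact le_of_sq_le_sq h (norm_nonneg a)

theorem inner_star_apply_left {s : S} (a : 𝒜.fibre s) (x y : H) :
    inner ℂ (star (σ.π s a) x) y = inner ℂ x (σ.π s a y) :=
  ContinuousLinearMap.adjoint_inner_left _ _ _

theorem inner_star_apply_right {s : S} (a : 𝒜.fibre s) (x y : H) :
    inner ℂ x (star (σ.π s a) y) = inner ℂ (σ.π s a x) y :=
  ContinuousLinearMap.adjoint_inner_right _ _ _

/-- The closed linear span of the range of the ideal `I_{r,1}`. -/
def essential (r : S) : Submodule ℂ H :=
  (Submodule.span ℂ {w : H | ∃ c ∈ 𝒜.ideal r, ∃ v : H, w = σ.π 1 c v}).topologicalClosure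

instance (r : S) : CompleteSpace (σ.essential r) :=
  (Submodule.isClosed_topologicalClosure _).completeSpace_coe

/-- The image of the unit `1_r` of the von Neumann algebra `I_{r,1}''`, that is, the orthogonal
projection onto the essential subspace of `I_{r,1}`. -/
def unit (r : S) : H →L[ℂ] H := (σ.essential r).starProjection

/-- The vectors annihilated by the fibres at the idempotents below `r`. They form the kernel of the
unit `1_r`. -/
def null (r : S) : Submodule ℂ H where
  carrier := {y | ∀ e : S, e * e = e → e ≤ r → ∀ a : 𝒜.fibre e, σ.π e a y = 0}
  zero_mem' := by simp
  add_mem' hx hy e he h a := by rw [map_add, hx e he h a, hy e he h a, add_zero]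
  smul_mem' z x hx e he h a := by rw [map_smul, hx e he h a, smul_zero]

theorem map_one_mem_null {r : S} {y : H} (hy : y ∈ σ.null r) (c : 𝒜.fibre 1) :
    σ.π 1 c y ∈ σ.null r := fun e he h a => by
  rw [← mul_apply_eq_comp, ← σ.map_mulTo (le_of_eq (mul_one e))]
  exact hy e he h _

theorem map_eq_zero_of_mem_null {r s : S} (hs : s⁻¹ * s ≤ r) {y : H} (hy : y ∈ σ.null r)
    (a : 𝒜.fibre s) : σ.π s a y = 0 := by
  have h := hy _ (inv_mul_idem s) hs (𝒜.bundle.mul _ _ (𝒜.bundle.star s a) a)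
  rw [σ.map_mul, σ.map_star, mul_apply_eq_comp] at h
  rw [← inner_self_eq_zero (𝕜 := ℂ), ← σ.inner_star_apply_left, h, inner_zero_left]

theorem star_map_eq_zero_of_mem_null {r e : S} (he : e * e = e) (h : e ≤ r) {y : H}
    (hy : y ∈ σ.null r) (a : 𝒜.fibre e) : star (σ.π e a) y = 0 := by
  rw [← σ.map_starTo (le_of_eq (idem_inv he))]
  exact hy e he h _

theorem exists_mem_ideal {r e : S} (he : e * e = e) (h : e ≤ r) (a : 𝒜.fibre e) :
    ∃ c ∈ 𝒜.ideal r, σ.π 1 c = σ.π e a := by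
  have hle : e ≤ e⁻¹ * e := le_of_eq (by rw [idem_inv he, he])
  refine ⟨𝒜.bundle.incl (inv_mul_le_one e) (𝒜.bundle.incl hle a), ?_, ?_⟩
  · exact Submodule.mem_sInf.mpr fun J hJ => hJ.2.2 e h ⟨e, he, one_mul e⟩ _
  · rw [σ.map_incl, σ.map_incl]

/-- The elements of the unit fibre whose range is orthogonal to the null vectors, a closed
two-sided ideal which turns out to contain `I_{r,1}`. -/
def coannihilator (r : S) : Submodule ℂ (𝒜.fibre 1) :=
  ⨅ v : H, (σ.null r)ᗮ.comap ((ContinuousLinearMap.apply ℂ H v).toLinearMap ∘ₗ σ.π 1)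

theorem mem_coannihilator {r : S} {c : 𝒜.fibre 1} :
    c ∈ σ.coannihilator r ↔ ∀ v, σ.π 1 c v ∈ (σ.null r)ᗮ := by
  simp [coannihilator]

theorem continuous_π_apply (s : S) (v : H) : Continuous fun a => σ.π s a v :=
  (ContinuousLinearMap.apply ℂ H v).continuous.comp <|
    AddMonoidHomClass.continuous_of_bound (σ.π s) 1 fun a => by simpa using σ.norm_le s a

theorem isClosed_coannihilator (r : S) : IsClosed (σ.coannihilator r : Set (𝒜.fibre 1)) := by
  rw [coannihilator, Submodule.coe_iInf]
  exact isClosed_iInter fun v =>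
    (Submodule.isClosed_orthogonal _).preimage (σ.continuous_π_apply 1 v)

theorem ideal_le_coannihilator (r : S) : 𝒜.ideal r ≤ σ.coannihilator r := by
  refine sInf_le ⟨σ.isClosed_coannihilator r, fun c hc d => ?_, fun v hvr hv a => ?_⟩
  · simp only [mem_coannihilator] at hc ⊢
    refine ⟨fun v => (Submodule.mem_orthogonal _ _).mpr fun y hy => ?_, fun v => ?_⟩
    · rw [map_mul_one, mul_apply_eq_comp, ← inner_star_apply_left, ← map_star_one]
      exact (Submodule.mem_orthogonal _ _).mp (hc v) _ (σ.map_one_mem_null hy _)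
    · rw [map_mul_one, mul_apply_eq_comp]
      exact hc _
  · obtain ⟨e, he, rfl⟩ := hv
    rw [one_mul] at hvr
    refine σ.mem_coannihilator.mpr fun w => (Submodule.mem_orthogonal _ _).mpr fun y hy => ?_
    have hle : (1 * e)⁻¹ * (1 * e) ≤ r := by rwa [one_mul, idem_inv he, he]
    rw [σ.map_incl, ← inner_star_apply_left,
      σ.star_map_eq_zero_of_mem_null (inv_mul_idem _) hle hy, inner_zero_left]

theorem orthogonal_essential (r : S) : (σ.essential r)ᗮ = σ.null r := by
  rw [essential, Submodule.orthogonal_closure]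
  refine le_antisymm (fun y hy e he h a => ?_) ((Submodule.le_orthogonal_orthogonal _).trans
    (Submodule.orthogonal_le (Submodule.span_le.mpr ?_)))
  · obtain ⟨c, hc, hca⟩ := σ.exists_mem_ideal he h (𝒜.bundle.starTo (le_of_eq (idem_inv he)) a)
    rw [← inner_self_eq_zero (𝕜 := ℂ), ← inner_star_apply_left,
      ← σ.map_starTo (le_of_eq (idem_inv he)), ← hca]
    exact (Submodule.mem_orthogonal _ _).mp hy _ (Submodule.subset_span ⟨c, hc, _, rfl⟩)
  · rintro _ ⟨c, hc, v, rfl⟩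
    exact σ.mem_coannihilator.mp (σ.ideal_le_coannihilator r hc) v

theorem isStarProjection_unit (r : S) : IsStarProjection (σ.unit r) :=
  isStarProjection_starProjection

theorem unit_apply_eq_zero_iff {r : S} {y : H} : σ.unit r y = 0 ↔ y ∈ σ.null r := by
  rw [unit, Submodule.starProjection_apply_eq_zero_iff, orthogonal_essential]

theorem sub_unit_mem_null (r : S) (x : H) : x - σ.unit r x ∈ σ.null r := by
  rw [← orthogonal_essential]
  exact Submodule.sub_starProjection_mem_orthogonal x

theorem unit_eq_of_null_eq {ℬ : FellBundle S} {τ : ℬ.HilbertRep H} {r r' : S}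
    (h : σ.null r = τ.null r') : σ.unit r = τ.unit r' := by
  have h_ess : σ.essential r = τ.essential r' := by
    rw [← (σ.essential r).orthogonal_orthogonal, orthogonal_essential, h, ← orthogonal_essential,
      Submodule.orthogonal_orthogonal]
  simp only [unit, h_ess]

theorem unit_apply_of_mapsTo_null {ℬ : FellBundle S} {τ : ℬ.HilbertRep H'} {T : H →L[ℂ] H'}
    {r r' : S} (h : ∀ y ∈ σ.null r, T y ∈ τ.null r')
    (h' : ∀ y ∈ τ.null r', T.adjoint y ∈ σ.null r) (x : H) :
    τ.unit r' (T x) = T (σ.unit r x) := by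
  simp only [← orthogonal_essential] at h h'
  exact starProjection_apply_of_mapsTo_orthogonal h h' x

theorem commute_unit_of_mapsTo_null {r : S} {T : H →L[ℂ] H}
    (h : ∀ y ∈ σ.null r, T y ∈ σ.null r) (h' : ∀ y ∈ σ.null r, star T y ∈ σ.null r) :
    Commute (σ.unit r) T :=
  ContinuousLinearMap.ext (σ.unit_apply_of_mapsTo_null h h')

theorem commute_unit_map_one (r : S) (c : 𝒜.fibre 1) : Commute (σ.unit r) (σ.π 1 c) :=
  σ.commute_unit_of_mapsTo_null (fun _ hy => σ.map_one_mem_null hy c) fun _ hy => by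
    rw [← map_star_one]
    exact σ.map_one_mem_null hy _

theorem commute_unit_map_idem (r : S) {e : S} (he : e * e = e) (a : 𝒜.fibre e) :
    Commute (σ.unit r) (σ.π e a) := by
  rw [← σ.map_incl e 1 ⟨e, he, one_mul e⟩ a]
  exact σ.commute_unit_map_one r _

theorem unit_apply_mem_null {r r' : S} {y : H} (hy : y ∈ σ.null r) :
    σ.unit r' y ∈ σ.null r := fun e he h a => by
  rw [← mul_apply_eq_comp, ← (σ.commute_unit_map_idem r' he a).eq, mul_apply_eq_comp,
    hy e he h, map_zero]

theorem commute_unit_unit (r r' : S) : Commute (σ.unit r) (σ.unit r') :=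
  σ.commute_unit_of_mapsTo_null (fun _ hy => σ.unit_apply_mem_null hy) fun _ hy => by
    rw [(σ.isStarProjection_unit r').isSelfAdjoint.star_eq]
    exact σ.unit_apply_mem_null hy

theorem unit_inv (r : S) : σ.unit r⁻¹ = σ.unit r :=
  σ.unit_eq_of_null_eq <| le_antisymm
    (fun _ hy e he h a => hy e he (idem_le_inv he h) a)
    fun _ hy e he h a => hy e he (InverseMonoid.inv_inv r ▸ idem_le_inv he h) a

theorem unit_mul_unit_mul_unit {r r' r'' : S} (h : r * r' ≤ r'') :
    σ.unit r * σ.unit r' * σ.unit r'' = σ.unit r * σ.unit r' := by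
  ext x
  have hzero : σ.unit r (σ.unit r' (x - σ.unit r'' x)) = 0 := by
    rw [unit_apply_eq_zero_iff]
    intro e he her a
    rw [← mul_apply_eq_comp, ← (σ.commute_unit_map_idem r' he a).eq, mul_apply_eq_comp,
      unit_apply_eq_zero_iff]
    intro f hf hfr' b
    rw [← mul_apply_eq_comp, ← σ.map_mul]
    have hle : f * e ≤ r'' := idem_comm hf he ▸ le_trans' (mul_le_mul her hfr') h
    exact σ.sub_unit_mem_null r'' x _ (idem_mul hf he) hle _
  rw [map_sub, map_sub, sub_eq_zero] at hzero
  exact hzero.symm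

theorem unit_conj_mul (s r : S) (a : 𝒜.fibre s) :
    σ.unit (s * r * s⁻¹) * σ.π s a = σ.π s a * σ.unit r := by
  refine ContinuousLinearMap.ext <| σ.unit_apply_of_mapsTo_null
    (fun y hy e he h b => ?_) (fun y hy e he h b => ?_)
  · rw [← mul_apply_eq_comp, ← σ.map_mul]
    refine σ.map_eq_zero_of_mem_null ?_ hy _
    rw [inv_mul_self_idem_mul he]
    exact le_trans' (mul_le_mul (mul_le_mul (le_of_eq rfl) h) (le_of_eq rfl))
      (inv_conj_conj_le s r)
  · rw [← ContinuousLinearMap.star_eq_adjoint, ← σ.map_star, ← mul_apply_eq_comp, ← σ.map_mul]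
    refine σ.map_eq_zero_of_mem_null ?_ hy _
    rw [inv_mul_self_idem_mul he, InverseMonoid.inv_inv]
    exact mul_le_mul (mul_le_mul (le_of_eq rfl) h) (le_of_eq rfl)

/-- A bounded operator is an intertwiner if it commutes with the actions of all fibres. -/
def Intertwines (σ : 𝒜.HilbertRep H) (τ : 𝒜.HilbertRep H') (T : H →L[ℂ] H') : Prop :=
  ∀ (s : S) (a : 𝒜.fibre s) (x : H), T (σ.π s a x) = τ.π s a (T x)

namespace Intertwines

variable {σ} {τ : 𝒜.HilbertRep H'} {T : H →L[ℂ] H'}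

theorem star_apply (hT : Intertwines σ τ T) {s : S} (a : 𝒜.fibre s) (x : H) :
    T (star (σ.π s a) x) = star (τ.π s a) (T x) := by
  rw [← σ.map_star, ← τ.map_star, hT]

theorem adjoint (hT : Intertwines σ τ T) : Intertwines τ σ T.adjoint := fun s a y =>
  ext_inner_right ℂ fun x => by
    rw [ContinuousLinearMap.adjoint_inner_left, ← inner_star_apply_right, ← hT.star_apply,
      ← ContinuousLinearMap.adjoint_inner_left, inner_star_apply_right]

theorem mem_null (hT : Intertwines σ τ T) {r : S} {y : H} (hy : y ∈ σ.null r) :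
    T y ∈ τ.null r := fun e he h a => by
  rw [← hT, hy e he h, map_zero]

theorem unit_apply (hT : Intertwines σ τ T) (r : S) (x : H) :
    T (σ.unit r x) = τ.unit r (T x) :=
  (σ.unit_apply_of_mapsTo_null (fun _ => hT.mem_null) (fun _ => hT.adjoint.mem_null) x).symm

end Intertwines

end HilbertRep

end FellBundle

/-- A family of commuting projections `P i j` which is symmetric and satisfies
`P i j ∧ P j k ≤ P i k`, that is, a partial equivalence relation on the index set with values in a
Boolean algebra of projections. -/
structure IsProjectionRelation {𝕜 H ι : Type*} [RCLike 𝕜] [NormedAddCommGroup H]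
    [InnerProductSpace 𝕜 H] [CompleteSpace H] (P : ι → ι → H →L[𝕜] H) : Prop where
  isStarProjection : ∀ i j, IsStarProjection (P i j)
  symm : ∀ i j, P i j = P j i
  commute : ∀ i j k l, Commute (P i j) (P k l)
  trans : ∀ i j k, P i j * P j k * P i k = P i j * P j k

namespace IsProjectionRelation

variable {𝕜 H ι : Type*} [RCLike 𝕜] [NormedAddCommGroup H] [InnerProductSpace 𝕜 H]
  [CompleteSpace H] {P : ι → ι → H →L[𝕜] H} (hP : IsProjectionRelation P)

include hP

theorem mul_self (i j : ι) : P i j * P i j = P i j := (hP.isStarProjection i j).isIdempotentElem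

theorem mul_diag (i j : ι) : P i j * P j j = P i j := by
  simpa only [hP.symm j i, hP.mul_self] using hP.trans j i j

theorem row_mul (r i j : ι) : P r i * P i j = P r i * P r j :=
  calc P r i * P i j = P r i * P i j * P r j := (hP.trans r i j).symm
    _ = P i r * P r j * P i j := by
      rw [mul_assoc, (hP.commute i j r j).eq, ← mul_assoc, hP.symm r i]
    _ = P r i * P r j := by rw [hP.trans i r j, hP.symm]

theorem mul_row (r i j : ι) : P i j * P r j = P r i * P r j := by
  rw [(hP.commute i j r j).eq, hP.symm i j, hP.row_mul r j i, (hP.commute r j r i).eq]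

theorem inner_left (i j : ι) (x y : H) : inner 𝕜 (P i j x) y = inner 𝕜 x (P i j y) :=
  (hP.isStarProjection i j).isSelfAdjoint.isSymmetric x y

theorem inner_eq_add (r i j : ι) (x y : H) :
    inner 𝕜 x (P i j y) =
      inner 𝕜 (P r i x) (P r j y) + inner 𝕜 (x - P r i x) (P i j (y - P r j y)) := by
  simp only [map_sub, inner_sub_left, inner_sub_right, hP.inner_left, ← mul_apply_eq_comp,
    hP.mul_row, hP.row_mul]
  simp only [← mul_assoc, hP.mul_self]
  ring

theorem sum_inner_eq_add (F : Finset ι) (f : ι → H) (r : ι) :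
    ∑ i ∈ F, ∑ j ∈ F, inner 𝕜 (f i) (P i j (f j)) =
      inner 𝕜 (∑ i ∈ F, P r i (f i)) (∑ i ∈ F, P r i (f i)) +
        ∑ i ∈ F, ∑ j ∈ F, inner 𝕜 (f i - P r i (f i)) (P i j (f j - P r j (f j))) := by
  simp only [fun i j => hP.inner_eq_add r i j (f i) (f j), Finset.sum_add_distrib]
  rw [sum_inner]
  simp only [inner_sum]

theorem sum_inner_nonneg (F : Finset ι) (f : ι → H) :
    0 ≤ RCLike.re (∑ i ∈ F, ∑ j ∈ F, inner 𝕜 (f i) (P i j (f j))) := by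
  classical
  induction F using Finset.induction_on generalizing f with
  | empty => simp
  | insert r F hr ih =>
    have h_left : ∀ j, P r j (f j - P r j (f j)) = 0 := fun j => by
      rw [map_sub, ← mul_apply_eq_comp, hP.mul_self, sub_self]
    have h_right : ∀ i, P i r (f r - P r r (f r)) = 0 := fun i => by
      rw [map_sub, ← mul_apply_eq_comp, hP.mul_diag, sub_self]
    rw [hP.sum_inner_eq_add _ f r, map_add]
    refine add_nonneg inner_self_nonneg ?_
    simpa only [Finset.sum_insert hr, h_left, h_right, inner_zero_right, Finset.sum_const_zero,
      add_zero, zero_add] using ih fun i => f i - P r i (f i)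

/-- The semi-inner product `⟪f, g⟫ = ∑ ⟪f i, P i j (g j)⟫` over a finite set of indices. -/
abbrev core (F : Finset ι) : PreInnerProductSpace.Core 𝕜 (ι → H) where
  inner f g := ∑ i ∈ F, ∑ j ∈ F, inner 𝕜 (f i) (P i j (g j))
  conj_inner_symm f g := by
    simp only [map_sum, inner_conj_symm, hP.inner_left]
    rw [Finset.sum_comm]
    simp only [hP.symm]
  re_inner_nonneg f := hP.sum_inner_nonneg F f
  add_left f g h := by simp only [Pi.add_apply, inner_add_left, Finset.sum_add_distrib]
  smul_left f g z := by simp only [Pi.smul_apply, inner_smul_left, Finset.mul_sum]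

theorem norm_sum_inner_sq_le (F : Finset ι) (f g : ι → H) :
    ‖∑ i ∈ F, ∑ j ∈ F, inner 𝕜 (f i) (P i j (g j))‖ ^ 2 ≤
      RCLike.re (∑ i ∈ F, ∑ j ∈ F, inner 𝕜 (f i) (P i j (f j))) *
      RCLike.re (∑ i ∈ F, ∑ j ∈ F, inner 𝕜 (g i) (P i j (g j))) := by
  have h := @InnerProductSpace.Core.inner_mul_inner_self_le 𝕜 (ι → H) _ _ _ (hP.core F) f g
  rwa [@InnerProductSpace.Core.norm_inner_symm 𝕜 (ι → H) _ _ _ (hP.core F) g f, ← sq] at h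

omit hP in
theorem norm_sum_inner_inl_inr_sq_le {κ : Type*} {Q : ι ⊕ κ → ι ⊕ κ → H →L[𝕜] H}
    (hQ : IsProjectionRelation Q) (F : Finset ι) (G : Finset κ) (f : ι → H) (g : κ → H) :
    ‖∑ i ∈ F, ∑ j ∈ G, inner 𝕜 (f i) (Q (.inl i) (.inr j) (g j))‖ ^ 2 ≤
      RCLike.re (∑ i ∈ F, ∑ j ∈ F, inner 𝕜 (f i) (Q (.inl i) (.inl j) (f j))) *
      RCLike.re (∑ i ∈ G, ∑ j ∈ G, inner 𝕜 (g i) (Q (.inr i) (.inr j) (g j))) := by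
  simpa [Finset.sum_disjSum] using
    hQ.norm_sum_inner_sq_le (F.disjSum G) (Sum.elim f 0) (Sum.elim 0 g)

end IsProjectionRelation

theorem FellBundle.HilbertRep.isProjectionRelation_unit {S : Type u} [InverseMonoid S]
    {𝒜 : FellBundle S} {H : Type*} [NormedAddCommGroup H] [InnerProductSpace ℂ H]
    [CompleteSpace H] (σ : 𝒜.HilbertRep H) {ι : Type*} (s : ι → S) :
    IsProjectionRelation fun i j => σ.unit (s i * (s j)⁻¹) where
  isStarProjection i j := σ.isStarProjection_unit _
  symm i j := by
    rw [← σ.unit_inv (s i * (s j)⁻¹), InverseMonoid.mul_inv_rev, InverseMonoid.inv_inv]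
  commute i j k l := σ.commute_unit_unit _ _
  trans i j k := σ.unit_mul_unit_mul_unit (mul_inv_mul_mul_inv_le _ _ _)

namespace FellBundle.HilbertRep

variable {S : Type u} [InverseMonoid S] {𝒜 : FellBundle S} {H H' : Type*}
  [NormedAddCommGroup H] [InnerProductSpace ℂ H] [CompleteSpace H]
  [NormedAddCommGroup H'] [InnerProductSpace ℂ H'] [CompleteSpace H'] (σ : 𝒜.HilbertRep H)

/-- The operator `∑ ξ(p)* ξ(t) 1_{pt*}` whose norm is bounded in condition (i) of the approximation
property. -/
def gram (ξ : S →₀ 𝒜.fibre 1) : H →L[ℂ] H :=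
  ξ.sum fun p c => ξ.sum fun t d => star (σ.π 1 c) * σ.π 1 d * σ.unit (p * t⁻¹)

/-- The map `a ↦ ∑ 1_{p(st)*} ξ(p)* a ξ(t)` of condition (ii) of the approximation property. -/
def average (ξ : S →₀ 𝒜.fibre 1) (s : S) : 𝒜.fibre s →ₗ[ℂ] (H →L[ℂ] H) where
  toFun a := ξ.sum fun p c => ξ.sum fun t d =>
    σ.unit (p * (s * t)⁻¹) * star (σ.π 1 c) * σ.π s a * σ.π 1 d
  map_add' a b := by simp only [Finsupp.sum, map_add, mul_add, add_mul, Finset.sum_add_distrib]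
  map_smul' z a := by
    simp only [Finsupp.sum, map_smul, mul_smul_comm, smul_mul_assoc, Finset.smul_sum,
      RingHom.id_apply]

theorem average_apply (ξ : S →₀ 𝒜.fibre 1) {s : S} (a : 𝒜.fibre s) :
    σ.average ξ s a = ξ.sum fun p c => ξ.sum fun t d =>
      σ.unit (p * (s * t)⁻¹) * star (σ.π 1 c) * σ.π s a * σ.π 1 d := rfl

theorem commute_unit_star_map_one (r : S) (c : 𝒜.fibre 1) :
    Commute (σ.unit r) (star (σ.π 1 c)) := by
  rw [← map_star_one]
  exact σ.commute_unit_map_one r _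

theorem inner_gram_apply (ξ : S →₀ 𝒜.fibre 1) (x : H) :
    inner ℂ x (σ.gram ξ x) = ∑ p ∈ ξ.support, ∑ t ∈ ξ.support,
      inner ℂ (σ.π 1 (ξ p) x) (σ.unit (p * t⁻¹) (σ.π 1 (ξ t) x)) := by
  simp only [gram, Finsupp.sum, _root_.sum_apply, inner_sum, mul_assoc,
    ← (σ.commute_unit_map_one _ _).eq]
  simp only [mul_apply_eq_comp, inner_star_apply_right]

theorem inner_average_apply (ξ : S →₀ 𝒜.fibre 1) {s : S} (a : 𝒜.fibre s) (x y : H) :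
    inner ℂ x (σ.average ξ s a y) = ∑ p ∈ ξ.support, ∑ t ∈ ξ.support,
      inner ℂ (σ.π 1 (ξ p) x) (σ.unit (p * (s * t)⁻¹) (σ.π s a (σ.π 1 (ξ t) y))) := by
  simp only [average_apply, Finsupp.sum, _root_.sum_apply, inner_sum,
    (σ.commute_unit_star_map_one _ _).eq]
  simp only [mul_apply_eq_comp, inner_star_apply_right]

theorem re_inner_gram_apply_le (ξ : S →₀ 𝒜.fibre 1) (x : H) :
    RCLike.re (inner ℂ x (σ.gram ξ x)) ≤ ‖σ.gram ξ‖ * ‖x‖ ^ 2 :=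
  calc RCLike.re (inner ℂ x (σ.gram ξ x)) ≤ ‖x‖ * ‖σ.gram ξ x‖ := re_inner_le_norm _ _
    _ ≤ ‖x‖ * (‖σ.gram ξ‖ * ‖x‖) := by gcongr; exact (σ.gram ξ).le_opNorm x
    _ = ‖σ.gram ξ‖ * ‖x‖ ^ 2 := by ring

theorem exists_star_mul_self_eq_sub {s : S} (a : 𝒜.fibre s) :
    ∃ d : H →L[ℂ] H, (∀ r, Commute (σ.unit r) d) ∧
      star (σ.π s a) * σ.π s a = (‖a‖ ^ 2 : ℂ) • 1 - star d * d := by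
  obtain ⟨c, hc⟩ := 𝒜.pos s a
  have h_norm : ‖c‖ = ‖a‖ := by
    rw [← sq_eq_sq₀ (norm_nonneg _) (norm_nonneg _), ← 𝒜.bundle.norm_ip_self,
      ← 𝒜.bundle.norm_ip_self, hc]
  obtain ⟨g, hg, hcg⟩ := exists_defect c
  have h_star : star (σ.π 1 g) = σ.π 1 g := by rw [← map_star_one, hg]
  have h_smul : σ.π 1 ((2 * ‖c‖) • g) = (2 * ‖a‖ : ℂ) • σ.π 1 g := by
    rw [RCLike.real_smul_eq_coe_smul (K := ℂ), map_smul, h_norm]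
    simp
  refine ⟨(‖a‖ : ℂ) • 1 - σ.π 1 g, fun r => ?_, ?_⟩
  · exact ((Commute.one_right _).smul_right _).sub_right (σ.commute_unit_map_one r g)
  · rw [← σ.map_ip, hc, 𝒜.bundle.ip_eq_mulOne, ← star_def, ← mul_def, hcg, map_sub, h_smul,
      map_mul_one, star_sub, h_star, star_smul, star_one, Complex.star_def, Complex.conj_ofReal]
    simp only [sub_mul, mul_sub, smul_mul_assoc, mul_smul_comm, one_mul, mul_one]
    module

theorem re_sum_inner_map_le {s : S} (a : 𝒜.fibre s) (F : Finset S) (f : S → H) :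
    RCLike.re (∑ p ∈ F, ∑ t ∈ F,
        inner ℂ (σ.π s a (f p)) (σ.unit (s * p * (s * t)⁻¹) (σ.π s a (f t)))) ≤
      ‖a‖ ^ 2 * RCLike.re (∑ p ∈ F, ∑ t ∈ F, inner ℂ (f p) (σ.unit (p * t⁻¹) (f t))) := by
  obtain ⟨d, hd, had⟩ := σ.exists_star_mul_self_eq_sub a
  have h_term : ∀ p t, inner ℂ (σ.π s a (f p)) (σ.unit (s * p * (s * t)⁻¹) (σ.π s a (f t))) =
      (‖a‖ ^ 2 : ℝ) * inner ℂ (f p) (σ.unit (p * t⁻¹) (f t)) -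
        inner ℂ (d (f p)) (σ.unit (p * t⁻¹) (d (f t))) := fun p t => by
    have h_conj : s * p * (s * t)⁻¹ = s * (p * t⁻¹) * s⁻¹ := by
      simp only [InverseMonoid.mul_inv_rev, mul_assoc]
    rw [h_conj, ← mul_apply_eq_comp (σ.unit _), unit_conj_mul, mul_apply_eq_comp,
      ← inner_star_apply_right, ← mul_apply_eq_comp (star _), had, _root_.sub_apply,
      inner_sub_right, _root_.smul_apply, inner_smul_right, ← mul_apply_eq_comp (σ.unit _) d,
      (hd _).eq, mul_apply_eq_comp, mul_apply_eq_comp, ContinuousLinearMap.star_eq_adjoint,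
      ContinuousLinearMap.adjoint_inner_right, one_apply_eq_self, Complex.ofReal_pow]
  have h_pos := (σ.isProjectionRelation_unit id).sum_inner_nonneg F fun p => d (f p)
  simp only [h_term, Finset.sum_sub_distrib, ← Finset.mul_sum, map_sub]
  exact (sub_le_self _ h_pos).trans_eq (Complex.re_ofReal_mul _ _)

theorem norm_inner_average_apply_le (ξ : S →₀ 𝒜.fibre 1) {s : S} (a : 𝒜.fibre s) (x y : H) :
    ‖inner ℂ x (σ.average ξ s a y)‖ ≤ ‖σ.gram ξ‖ * ‖a‖ * ‖y‖ * ‖x‖ := by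
  have h_cs := (σ.isProjectionRelation_unit (Sum.elim id (s * ·))).norm_sum_inner_inl_inr_sq_le
    ξ.support ξ.support (fun p => σ.π 1 (ξ p) x) fun t => σ.π s a (σ.π 1 (ξ t) y)
  have h_pos := (σ.isProjectionRelation_unit id).sum_inner_nonneg ξ.support
    fun p => σ.π 1 (ξ p) x
  simp only [Sum.elim_inl, Sum.elim_inr, id_eq, ← inner_average_apply, ← inner_gram_apply]
    at h_cs h_pos
  have h_map := σ.re_sum_inner_map_le a ξ.support fun t => σ.π 1 (ξ t) y
  rw [← inner_gram_apply] at h_map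
  refine le_of_sq_le_sq ?_ (by positivity)
  calc ‖inner ℂ x (σ.average ξ s a y)‖ ^ 2
      ≤ RCLike.re (inner ℂ x (σ.gram ξ x)) *
          (‖a‖ ^ 2 * RCLike.re (inner ℂ y (σ.gram ξ y))) := h_cs.trans (by gcongr)
    _ ≤ (‖σ.gram ξ‖ * ‖x‖ ^ 2) * (‖a‖ ^ 2 * (‖σ.gram ξ‖ * ‖y‖ ^ 2)) :=
        mul_le_mul_of_nonneg (σ.re_inner_gram_apply_le ξ x)
          (by gcongr; exact σ.re_inner_gram_apply_le ξ y) h_pos (by positivity)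
    _ = (‖σ.gram ξ‖ * ‖a‖ * ‖y‖ * ‖x‖) ^ 2 := by ring

theorem norm_average_le (ξ : S →₀ 𝒜.fibre 1) {s : S} (a : 𝒜.fibre s) :
    ‖σ.average ξ s a‖ ≤ ‖σ.gram ξ‖ * ‖a‖ := by
  refine ContinuousLinearMap.opNorm_le_bound _ (by positivity) fun y => ?_
  rw [← innerSL_apply_norm (𝕜 := ℂ)]
  refine ContinuousLinearMap.opNorm_le_bound _ (by positivity) fun x => ?_
  rw [innerSL_apply_apply, norm_inner_symm]
  exact σ.norm_inner_average_apply_le ξ a x y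

namespace Intertwines

variable {σ} {τ : 𝒜.HilbertRep H'} {T : H →L[ℂ] H'}

theorem gram_apply (hT : Intertwines σ τ T) (ξ : S →₀ 𝒜.fibre 1) (x : H) :
    T (σ.gram ξ x) = τ.gram ξ (T x) := by
  simp only [gram, Finsupp.sum, _root_.sum_apply, map_sum, mul_apply_eq_comp, hT.star_apply,
    hT.unit_apply, hT _ _ _]

theorem average_apply (hT : Intertwines σ τ T) (ξ : S →₀ 𝒜.fibre 1) {s : S} (a : 𝒜.fibre s)
    (x : H) : T (σ.average ξ s a x) = τ.average ξ s a (T x) := by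
  simp only [HilbertRep.average_apply, Finsupp.sum, _root_.sum_apply, map_sum, mul_apply_eq_comp,
    hT.star_apply, hT.unit_apply, hT _ _ _]

theorem average_sub_apply (hT : Intertwines σ τ T) (ξ : S →₀ 𝒜.fibre 1) {s : S}
    (a : 𝒜.fibre s) (x : H) :
    T ((σ.average ξ s a - σ.π s a) x) = (τ.average ξ s a - τ.π s a) (T x) := by
  rw [_root_.sub_apply, _root_.sub_apply, map_sub, hT.average_apply, hT]

end Intertwines

end FellBundle.HilbertRep

/-- A family of self-adjoint contractions that is a two-sided approximate unit along a filter. -/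
structure IsContractiveApproximateUnit {κ C : Type*} [NonUnitalCStarAlgebra C] (l : Filter κ)
    (e : κ → C) : Prop where
  star_eq : ∀ j, star (e j) = e j
  norm_le_one : ∀ j, ‖e j‖ ≤ 1
  tendsto_mul_left : ∀ c, Tendsto (fun j => c * e j) l (𝓝 c)
  tendsto_mul_right : ∀ c, Tendsto (fun j => e j * c) l (𝓝 c)

theorem IsContractiveApproximateUnit.tendsto_conj {κ C : Type*} [NonUnitalCStarAlgebra C]
    {l : Filter κ} {e : κ → C} (he : IsContractiveApproximateUnit l e) (c : C) :
    Tendsto (fun j => star (e j) * c * e j) l (𝓝 c) := by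
  have h : Tendsto (fun j => e j * (c * e j - c)) l (𝓝 0) := by
    refine squeeze_zero_norm (fun j => ?_)
      (tendsto_iff_norm_sub_tendsto_zero.mp (he.tendsto_mul_left c))
    exact (norm_mul_le _ _).trans (mul_le_of_le_one_left (norm_nonneg _) (he.norm_le_one j))
  simpa only [he.star_eq, mul_sub, mul_assoc, sub_add_cancel, zero_add] using
    h.add (he.tendsto_mul_right c)

theorem exists_isContractiveApproximateUnit (C : Type u) [NonUnitalCStarAlgebra C] :
    ∃ (κ : Type u) (_ : Preorder κ) (_ : IsDirectedOrder κ) (_ : Nonempty κ) (e : κ → C),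
      IsContractiveApproximateUnit atTop e := by
  let _ := CStarAlgebra.spectralOrder C
  have := CStarAlgebra.spectralOrderedRing C
  let κ := {x : C // x ∈ {x : C | 0 ≤ x} ∩ Metric.ball 0 1}
  have hdir : IsDirectedOrder κ := directedOn_iff_isDirectedOrder.mp
    CStarAlgebra.directedOn_nonneg_ball
  have hne : Nonempty κ := ⟨0, by simp⟩
  have hnorm (j : κ) : ‖(j : C)‖ ≤ 1 := (mem_ball_zero_iff.mp j.2.2).le
  have hlim : Tendsto ((↑) : κ → C) atTop (CStarAlgebra.approximateUnit C) := by
    refine (CStarAlgebra.hasBasis_approximateUnit C).tendsto_right_iff.mpr fun x hx => ?_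
    filter_upwards [eventually_ge_atTop (⟨x, hx.1, mem_ball_zero_iff.mpr hx.2⟩ : κ)] with j hj
    exact ⟨hj, mem_closedBall_zero_iff.mpr (hnorm j)⟩
  have happrox := CStarAlgebra.increasingApproximateUnit C
  exact ⟨κ, inferInstance, hdir, hne, (↑), fun j => (IsSelfAdjoint.of_nonneg j.2.1).star_eq, hnorm,
    fun c => (happrox.tendsto_mul_left c).comp hlim,
    fun c => (happrox.tendsto_mul_right c).comp hlim⟩

section StrongLimit

variable {α E F : Type*} [NormedAddCommGroup E] [NormedSpace ℂ E]
  [NormedAddCommGroup F] [NormedSpace ℂ F] {l : Filter α} {D : Set E}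

theorem tendsto_apply_of_dense_span (hD : Dense (Submodule.span ℂ D : Set E)) {C : ℝ}
    {T : α → E →L[ℂ] F} {R : E →L[ℂ] F} (hT : ∀ i, ‖T i‖ ≤ C)
    (h : ∀ x ∈ D, Tendsto (fun i => T i x) l (𝓝 (R x))) (x : E) :
    Tendsto (fun i => T i x) l (𝓝 (R x)) := by
  have hequi : Equicontinuous fun i => (T i : E → F) :=
    (LipschitzWith.uniformEquicontinuous _ C.toNNReal fun i =>
      (T i).lipschitz.weaken (NNReal.le_toNNReal_of_coe_le (hT i))).equicontinuous
  have hclosed : IsClosed {x | Tendsto (fun i => T i x) l (𝓝 (R x))} :=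
    hequi.isClosed_setOfPred_tendsto R.continuous
  refine hclosed.closure_subset_iff.mpr (fun y hy => ?_) (hD x)
  induction hy using Submodule.span_induction with
  | mem y hy => exact h y hy
  | zero => simp only [Set.mem_ofPred_eq, map_zero, tendsto_const_nhds]
  | add y z _ _ hy hz => simpa only [Set.mem_ofPred_eq, map_add] using hy.add hz
  | smul c y _ hy => simpa only [Set.mem_ofPred_eq, map_smul] using hy.const_smul c

variable [CompleteSpace F] [l.NeBot]

theorem exists_tendsto_apply_of_dense_span (hD : Dense (Submodule.span ℂ D : Set E)) {C : ℝ}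
    {T : α → E →L[ℂ] F} (hT : ∀ i, ‖T i‖ ≤ C) (h : ∀ x ∈ D, ∃ y, Tendsto (fun i => T i x) l (𝓝 y))
    (x : E) : ∃ y, Tendsto (fun i => T i x) l (𝓝 y) := by
  have hdiff : Tendsto (fun i : α × α => (T i.1 - T i.2) x) (l ×ˢ l)
      (𝓝 ((0 : E →L[ℂ] F) x)) := by
    refine tendsto_apply_of_dense_span hD (C := C + C)
      (fun i => (norm_sub_le _ _).trans (add_le_add (hT _) (hT _))) (fun y hy => ?_) x
    obtain ⟨z, hz⟩ := h y hy
    simpa only [sub_self, _root_.zero_apply] using! (hz.comp tendsto_fst).sub (hz.comp tendsto_snd)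
  refine cauchy_map_iff_exists_tendsto.mp (cauchy_map_iff.mpr ⟨inferInstance, ?_⟩)
  refine tendsto_uniformity_iff_dist_tendsto_zero.mpr ?_
  simpa only [dist_eq_norm, _root_.zero_apply, norm_zero, _root_.sub_apply] using hdiff.norm

theorem exists_strongLimit {V : Type*} [AddCommGroup V] [Module ℂ V]
    (hD : Dense (Submodule.span ℂ D : Set E)) {T : α → V →ₗ[ℂ] (E →L[ℂ] F)} {C : V → ℝ}
    (hT : ∀ i a, ‖T i a‖ ≤ C a) (h : ∀ a, ∀ x ∈ D, ∃ y, Tendsto (fun i => T i a x) l (𝓝 y)) :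
    ∃ R : V →ₗ[ℂ] (E →L[ℂ] F), ∀ a x, Tendsto (fun i => T i a x) l (𝓝 (R a x)) := by
  choose R hR using fun a => exists_tendsto_apply_of_dense_span hD (fun i => hT i a) (h a)
  have hbdd (a : V) : Bornology.IsBounded (Set.range fun i => T i a) :=
    isBounded_iff_forall_norm_le.mpr ⟨C a, Set.forall_mem_range.mpr fun i => hT i a⟩
  refine ⟨⟨⟨fun a => .ofTendstoOfBoundedRange (R a) (fun i => T i a)
    (tendsto_pi_nhds.mpr (hR a)) (hbdd a), fun a b => ?_⟩, fun z a => ?_⟩, hR⟩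
  · ext x
    refine tendsto_nhds_unique (hR (a + b) x) ?_
    simpa only [map_add] using! (hR a x).add (hR b x)
  · ext x
    refine tendsto_nhds_unique (hR (z • a) x) ?_
    simpa only [map_smul] using! (hR a x).const_smul z

end StrongLimit

namespace FellBundle.IsBundleNorm

variable {S : Type u} [InverseMonoid S] {𝒜 : FellBundle S} {B : Type u} [NonUnitalCStarAlgebra B]
  {p : 𝒜.fibre 1 ⊗[ℂ] B → ℝ} (hp : 𝒜.IsBundleNorm B p)

/-- Elementary tensors in the completed fibres of the tensor product bundle. -/
def tmul {s : S} : 𝒜.fibre s →ₗ[ℂ] B →ₗ[ℂ] hp.tensor.fibre s :=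
  (hp.tm (s := s)).compr₂
    (UniformSpace.Completion.toComplL (𝕜 := ℂ) (E := TensorFibre hp s)).toLinearMap

theorem norm_tmul_le {s : S} (a : 𝒜.fibre s) (b : B) : ‖hp.tmul a b‖ ≤ ‖a‖ * ‖b‖ := by
  have hcoe : ‖hp.tmul a b‖ = ‖hp.tm a b‖ := UniformSpace.Completion.norm_coe _
  refine le_of_sq_le_sq ?_ (by positivity)
  calc ‖hp.tmul a b‖ ^ 2 = p (𝒜.bundle.ip a a ⊗ₜ (star b * b)) := by
        rw [hcoe, hp.norm_sq, hp.ip_tm]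
        rfl
    _ ≤ ‖𝒜.bundle.ip a a‖ * ‖star b * b‖ := hp.tmul_le _ _
    _ = (‖a‖ * ‖b‖) ^ 2 := by
        rw [𝒜.bundle.norm_ip_self, CStarRing.norm_star_mul_self]
        ring

theorem mul_tmul {s t : S} (a : 𝒜.fibre s) (a' : 𝒜.fibre t) (b b' : B) :
    hp.tensor.bundle.mul s t (hp.tmul a b) (hp.tmul a' b') =
      hp.tmul (𝒜.bundle.mul s t a a') (b * b') :=
  hp.preBundle.mulC_coe s t _ _

theorem star_tmul {s : S} (a : 𝒜.fibre s) (b : B) :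
    hp.tensor.bundle.star s (hp.tmul a b) = hp.tmul (𝒜.bundle.star s a) (star b) :=
  hp.preBundle.starC_coe s _

theorem incl_tmul {s t : S} (h : s ≤ t) (a : 𝒜.fibre s) (b : B) :
    hp.tensor.bundle.incl h (hp.tmul a b) = hp.tmul (𝒜.bundle.incl h a) b :=
  hp.preBundle.inclC_coe h _

theorem mulTo_tmul {s t r : S} (h : s * t ≤ r) (a : 𝒜.fibre s) (a' : 𝒜.fibre t) (b b' : B) :
    hp.tensor.bundle.mulTo h (hp.tmul a b) (hp.tmul a' b') =
      hp.tmul (𝒜.bundle.mulTo h a a') (b * b') := by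
  rw [AlgBundle.mulTo, mul_tmul, incl_tmul]
  rfl

theorem tmul_mul_tmul (c c' : 𝒜.fibre 1) (b b' : B) :
    hp.tmul c b * hp.tmul c' b' = hp.tmul (c * c') (b * b') :=
  hp.mulTo_tmul _ c c' b b'

theorem star_tmul_one (c : 𝒜.fibre 1) (b : B) :
    star (hp.tmul c b) = hp.tmul (star c) (star b) := by
  rw [star_def, AlgBundle.starOne, AlgBundle.starTo, star_tmul, incl_tmul]
  rfl

theorem continuous_tmul {s : S} (a : 𝒜.fibre s) : Continuous (hp.tmul a) :=
  AddMonoidHomClass.continuous_of_bound (hp.tmul a) ‖a‖ (hp.norm_tmul_le a)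

theorem continuous_tmul_flip {s : S} (b : B) : Continuous fun a : 𝒜.fibre s => hp.tmul a b :=
  AddMonoidHomClass.continuous_of_bound ((hp.tmul (s := s)).flip b) ‖b‖ fun a =>
    (hp.norm_tmul_le a b).trans_eq (mul_comm _ _)

theorem dense_span_tmul (s : S) :
    Dense (Submodule.span ℂ {x : hp.tensor.fibre s | ∃ a b, x = hp.tmul a b} :
      Set (hp.tensor.fibre s)) := by
  refine (UniformSpace.Completion.denseRange_coe (α := TensorFibre hp s)).mono ?_
  rintro _ ⟨x, rfl⟩
  obtain ⟨n, a, b, rfl⟩ := hp.exists_sum_tm x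
  have hcoe : ((∑ i, hp.tm (a i) (b i) : TensorFibre hp s) :
      UniformSpace.Completion (TensorFibre hp s)) = ∑ i, hp.tmul (a i) (b i) :=
    map_sum (UniformSpace.Completion.toComplL (𝕜 := ℂ) (E := TensorFibre hp s)) _ _
  refine Set.mem_of_eq_of_mem hcoe (sum_mem (M := hp.tensor.fibre s) fun i _ => ?_)
  exact Submodule.subset_span ⟨a i, b i, rfl⟩

end FellBundle.IsBundleNorm

namespace FellBundle.HilbertRep

variable {S : Type u} [InverseMonoid S] {𝒜 : FellBundle S} {H : Type*}
  [NormedAddCommGroup H] [InnerProductSpace ℂ H] [CompleteSpace H]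

/-- A representation is nondegenerate if the images of the operators of the unit fibre span a dense
subspace. -/
def Nondegenerate (σ : 𝒜.HilbertRep H) : Prop :=
  Dense (Submodule.span ℂ {w : H | ∃ c v, w = σ.π 1 c v} : Set H)

theorem Nondegenerate.eq_zero {σ : 𝒜.HilbertRep H} (hσ : σ.Nondegenerate) {y : H}
    (h : ∀ c, σ.π 1 c y = 0) : y = 0 := by
  have hle : Submodule.span ℂ {w : H | ∃ c v, w = σ.π 1 c v} ≤ (ℂ ∙ y)ᗮ := by
    refine Submodule.span_le.mpr ?_
    rintro _ ⟨c, v, rfl⟩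
    refine Submodule.mem_orthogonal_singleton_iff_inner_right.mpr ?_
    rw [← inner_star_apply_left, ← map_star_one, h, inner_zero_left]
  exact hσ.eq_zero_of_inner_left ℂ fun v hv =>
    Submodule.mem_orthogonal_singleton_iff_inner_right.mp (hle hv)

variable {B : Type u} [NonUnitalCStarAlgebra B] {p : 𝒜.fibre 1 ⊗[ℂ] B → ℝ}
  {hp : 𝒜.IsBundleNorm B p} (σ : hp.tensor.HilbertRep H)

theorem map_tmul_map_tmul {s t : S} (a : 𝒜.fibre s) (a' : 𝒜.fibre t) (b b' : B) (v : H) :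
    σ.π s (hp.tmul a b) (σ.π t (hp.tmul a' b') v) =
      σ.π (s * t) (hp.tmul (𝒜.bundle.mul s t a a') (b * b')) v := by
  rw [← mul_apply_eq_comp, ← σ.map_mul, hp.mul_tmul]

theorem map_one_tmul_map_tmul (c c' : 𝒜.fibre 1) (b b' : B) (v : H) :
    σ.π 1 (hp.tmul c b) (σ.π 1 (hp.tmul c' b') v) = σ.π 1 (hp.tmul (c * c') (b * b')) v := by
  rw [← mul_apply_eq_comp, ← σ.map_mul_one, hp.tmul_mul_tmul]

theorem map_mem_of_map_tmul_mem {J : Submodule ℂ H} (hJ : IsClosed (J : Set H)) {s : S} {v : H}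
    (h : ∀ a b, σ.π s (hp.tmul a b) v ∈ J) (x : hp.tensor.fibre s) : σ.π s x v ∈ J := by
  refine hJ.closure_subset_iff.mpr subset_rfl <|
    map_mem_closure (f := fun x => σ.π s x v) (σ.continuous_π_apply s v) (hp.dense_span_tmul s x)
      fun y hy => ?_
  induction hy using Submodule.span_induction with
  | mem y hy =>
    obtain ⟨a, b, rfl⟩ := hy
    exact h a b
  | zero => simp only [map_zero, _root_.zero_apply, SetLike.mem_coe, zero_mem]
  | add y z _ _ hy hz => simpa only [map_add] using! J.add_mem hy hz
  | smul c y _ hy => simpa only [map_smul] using! J.smul_mem c hy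

variable {σ}

theorem Nondegenerate.dense_span_map_tmul (hσ : σ.Nondegenerate) :
    Dense (Submodule.span ℂ {w : H | ∃ c b v, w = σ.π 1 (hp.tmul c b) v} : Set H) := by
  refine dense_closure.mp (hσ.mono ?_)
  rw [← Submodule.topologicalClosure_coe]
  refine Submodule.span_le.mpr ?_
  rintro _ ⟨x, v, rfl⟩
  refine σ.map_mem_of_map_tmul_mem (Submodule.isClosed_topologicalClosure _) (fun c b => ?_) x
  exact Submodule.le_topologicalClosure _ (Submodule.subset_span ⟨c, b, v, rfl⟩)

theorem Nondegenerate.ext_tmul (hσ : σ.Nondegenerate) {T T' : H →L[ℂ] H}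
    (h : ∀ c b v, T (σ.π 1 (hp.tmul c b) v) = T' (σ.π 1 (hp.tmul c b) v)) : T = T' := by
  refine ContinuousLinearMap.ext_on hσ.dense_span_map_tmul ?_
  intro w hw
  obtain ⟨c, b, v, rfl⟩ := hw
  exact h c b v

variable {κ : Type*} {l : Filter κ}

theorem tendsto_map_tmul_map_tmul {e : κ → B} (he : IsContractiveApproximateUnit l e) {s t : S}
    (a : 𝒜.fibre s) (a' : 𝒜.fibre t) (b : B) (v : H) :
    Tendsto (fun j => σ.π s (hp.tmul a (e j)) (σ.π t (hp.tmul a' b) v)) l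
      (𝓝 (σ.π (s * t) (hp.tmul (𝒜.bundle.mul s t a a') b) v)) := by
  simp only [map_tmul_map_tmul]
  exact ((σ.continuous_π_apply _ v).comp (hp.continuous_tmul _)).tendsto _ |>.comp
    (he.tendsto_mul_right b)

theorem exists_leftFactor [l.NeBot] {e : κ → B} (hσ : σ.Nondegenerate)
    (he : IsContractiveApproximateUnit l e) :
    ∃ τ : 𝒜.HilbertRep H, ∀ (s : S) (a : 𝒜.fibre s) (t : S) (a' : 𝒜.fibre t) (b : B) (v : H),
      τ.π s a (σ.π t (hp.tmul a' b) v) = σ.π (s * t) (hp.tmul (𝒜.bundle.mul s t a a') b) v := by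
  have hbound (s : S) (j : κ) (a : 𝒜.fibre s) : ‖σ.π s (hp.tmul a (e j))‖ ≤ ‖a‖ :=
    (σ.norm_le _ _).trans <| (hp.norm_tmul_le _ _).trans <|
      mul_le_of_le_one_right (norm_nonneg _) (he.norm_le_one j)
  have hlim (s : S) : ∃ R : 𝒜.fibre s →ₗ[ℂ] (H →L[ℂ] H), ∀ a x,
      Tendsto (fun j => σ.π s (hp.tmul a (e j)) x) l (𝓝 (R a x)) := by
    refine exists_strongLimit (T := fun j => σ.π s ∘ₗ hp.tmul.flip (e j))
      hσ.dense_span_map_tmul (hbound s) fun a x hx => ?_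
    obtain ⟨c, b, v, rfl⟩ := hx
    exact ⟨_, tendsto_map_tmul_map_tmul he a c b v⟩
  choose R hR using hlim
  have hR_map (s : S) (a : 𝒜.fibre s) (t : S) (a' : 𝒜.fibre t) (b : B) (v : H) :
      R s a (σ.π t (hp.tmul a' b) v) = σ.π (s * t) (hp.tmul (𝒜.bundle.mul s t a a') b) v :=
    tendsto_nhds_unique (hR s a _) (tendsto_map_tmul_map_tmul he a a' b v)
  refine ⟨⟨R, fun s t a a' => hσ.ext_tmul fun c b v => ?_, fun s a => ?_, fun s t h a => ?_⟩,
    hR_map⟩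
  · rw [mul_apply_eq_comp, hR_map, hR_map, hR_map,
      ← 𝒜.bundle.mul_assoc s t 1 (le_of_eq (mul_assoc _ _ _)), ← hp.incl_tmul, σ.map_incl]
  · rw [ContinuousLinearMap.star_eq_adjoint, ContinuousLinearMap.eq_adjoint_iff]
    intro x y
    refine tendsto_nhds_unique ((hR s⁻¹ _ x).inner tendsto_const_nhds)
      ((tendsto_const_nhds.inner (hR s a y)).congr fun j => ?_)
    rw [← inner_star_apply_left, ← σ.map_star, hp.star_tmul, he.star_eq]
  · ext x
    refine tendsto_nhds_unique (hR t _ x) ((hR s a x).congr fun j => ?_)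
    rw [← hp.incl_tmul, σ.map_incl]

theorem tendsto_map_tmul_right {u : κ → 𝒜.fibre 1} (hu : IsContractiveApproximateUnit l u)
    (b : B) (c : 𝒜.fibre 1) (b' : B) (v : H) :
    Tendsto (fun j => σ.π 1 (hp.tmul (u j) b) (σ.π 1 (hp.tmul c b') v)) l
      (𝓝 (σ.π 1 (hp.tmul c (b * b')) v)) := by
  simp only [map_one_tmul_map_tmul]
  exact ((σ.continuous_π_apply _ v).comp (hp.continuous_tmul_flip _)).tendsto _ |>.comp
    (hu.tendsto_mul_right c)

theorem exists_rightFactor [l.NeBot] (hσ : σ.Nondegenerate) {u : κ → 𝒜.fibre 1}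
    (hu : IsContractiveApproximateUnit l u) :
    ∃ ρ : B →⋆ₙₐ[ℂ] (H →L[ℂ] H), ∀ (b : B) (c : 𝒜.fibre 1) (b' : B) (v : H),
      ρ b (σ.π 1 (hp.tmul c b') v) = σ.π 1 (hp.tmul c (b * b')) v := by
  have hbound (j : κ) (b : B) : ‖σ.π 1 (hp.tmul (u j) b)‖ ≤ ‖b‖ :=
    (σ.norm_le _ _).trans <| (hp.norm_tmul_le _ _).trans <|
      mul_le_of_le_one_left (norm_nonneg _) (hu.norm_le_one j)
  obtain ⟨R, hR⟩ := exists_strongLimit (T := fun j => σ.π 1 ∘ₗ hp.tmul (u j))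
    hσ.dense_span_map_tmul hbound fun b x hx => by
      obtain ⟨c, b', v, rfl⟩ := hx
      exact ⟨_, tendsto_map_tmul_right hu b c b' v⟩
  have hR_map (b : B) (c : 𝒜.fibre 1) (b' : B) (v : H) :
      R b (σ.π 1 (hp.tmul c b') v) = σ.π 1 (hp.tmul c (b * b')) v :=
    tendsto_nhds_unique (hR b _) (tendsto_map_tmul_right hu b c b' v)
  have hR_mul (b b' : B) : R (b * b') = R b * R b' := hσ.ext_tmul fun c d v => by
    rw [mul_apply_eq_comp, hR_map, hR_map, hR_map, mul_assoc]
  have hR_star (b : B) : R (star b) = star (R b) := by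
    rw [ContinuousLinearMap.star_eq_adjoint, ContinuousLinearMap.eq_adjoint_iff]
    intro x y
    refine tendsto_nhds_unique ((hR _ x).inner tendsto_const_nhds)
      ((tendsto_const_nhds.inner (hR b y)).congr fun j => ?_)
    rw [LinearMap.comp_apply, LinearMap.comp_apply, ← inner_star_apply_left, ← σ.map_star_one,
      hp.star_tmul_one, hu.star_eq]
  exact ⟨{ R with map_zero' := map_zero R, map_mul' := hR_mul, map_star' := hR_star }, hR_map⟩

end FellBundle.HilbertRep

namespace FellBundle.IsBundleNorm

variable {S : Type u} [InverseMonoid S] {𝒜 : FellBundle S} {B : Type u} [NonUnitalCStarAlgebra B]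
  {p : 𝒜.fibre 1 ⊗[ℂ] B → ℝ} (hp : 𝒜.IsBundleNorm B p)

/-- The function `ξ ⊗ b` on `S` with values in the unit fibre of the tensor product bundle. -/
def tensorSection (ξ : S →₀ 𝒜.fibre 1) (b : B) : S →₀ hp.tensor.fibre 1 :=
  ξ.mapRange (fun c => hp.tmul c b) (by rw [map_zero, LinearMap.zero_apply])

theorem isSection_tensorSection {ξ : S →₀ 𝒜.fibre 1} (hξ : 𝒜.IsSection ξ) (b : B) :
    hp.tensor.IsSection (hp.tensorSection ξ b) := fun s => by
  obtain ⟨a, ha⟩ := hξ s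
  exact ⟨hp.tmul a b, by rw [tensorSection, Finsupp.mapRange_apply, ha, incl_tmul]⟩

theorem sum_sum_tensorSection {M : Type*} [AddCommMonoid M] (ξ : S →₀ 𝒜.fibre 1) (b : B)
    {f : S → hp.tensor.fibre 1 → S → hp.tensor.fibre 1 → M} (hf : ∀ s t d, f s 0 t d = 0)
    (hf' : ∀ s c t, f s c t 0 = 0) :
    ((hp.tensorSection ξ b).sum fun s c => (hp.tensorSection ξ b).sum (f s c)) =
      ξ.sum fun s c => ξ.sum fun t d => f s (hp.tmul c b) t (hp.tmul d b) := by
  rw [tensorSection, Finsupp.sum_mapRange_index fun s => Finset.sum_eq_zero fun t _ => hf s t _]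
  exact Finsupp.sum_congr fun s _ => Finsupp.sum_mapRange_index (hf' s _)

end FellBundle.IsBundleNorm

namespace FellBundle.HilbertRep

variable {S : Type u} [InverseMonoid S] {𝒜 : FellBundle S} {H : Type*}
  [NormedAddCommGroup H] [InnerProductSpace ℂ H] [CompleteSpace H]
  {B : Type u} [NonUnitalCStarAlgebra B] {p : 𝒜.fibre 1 ⊗[ℂ] B → ℝ}
  {hp : 𝒜.IsBundleNorm B p} {σ : hp.tensor.HilbertRep H} {τ : 𝒜.HilbertRep H}
  {ρ : B →⋆ₙₐ[ℂ] (H →L[ℂ] H)}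

/-- A representation of the tensor product bundle is the product of a representation `τ` of the
Fell bundle and a representation `ρ` of the `C*`-algebra. Commutation of the factors follows by
taking adjoints. -/
def IsProduct (σ : hp.tensor.HilbertRep H) (τ : 𝒜.HilbertRep H) (ρ : B →⋆ₙₐ[ℂ] (H →L[ℂ] H)) :
    Prop :=
  ∀ (s : S) (a : 𝒜.fibre s) (b : B), σ.π s (hp.tmul a b) = τ.π s a * ρ b

theorem Nondegenerate.exists_isProduct (hσ : σ.Nondegenerate) :
    ∃ (τ : 𝒜.HilbertRep H) (ρ : B →⋆ₙₐ[ℂ] (H →L[ℂ] H)), σ.IsProduct τ ρ := by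
  obtain ⟨κ, _, _, _, e, he⟩ := exists_isContractiveApproximateUnit B
  obtain ⟨κ', _, _, _, e', he'⟩ := exists_isContractiveApproximateUnit (𝒜.fibre 1)
  obtain ⟨τ, hτ⟩ := exists_leftFactor hσ he
  obtain ⟨ρ, hρ⟩ := exists_rightFactor hσ he'
  refine ⟨τ, ρ, fun s a b => hσ.ext_tmul fun c b' v => ?_⟩
  rw [map_tmul_map_tmul, mul_apply_eq_comp, hρ, hτ]

namespace IsProduct

variable (h : σ.IsProduct τ ρ)

include h

theorem commute {s : S} (a : 𝒜.fibre s) (b : B) : Commute (τ.π s a) (ρ b) := by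
  have h_star := σ.map_star s (hp.tmul a b)
  rw [hp.star_tmul, h, h, star_mul, τ.map_star, StarHomClass.map_star] at h_star
  exact commute_star_star.mp h_star

theorem nondegenerate (hσ : σ.Nondegenerate) : τ.Nondegenerate := by
  refine hσ.dense_span_map_tmul.mono (Submodule.span_mono ?_)
  rintro _ ⟨c, b, v, rfl⟩
  exact ⟨c, ρ b v, by rw [h, mul_apply_eq_comp]⟩

theorem apply_map_apply {s : S} (a : 𝒜.fibre s) (b : B) (y : H) :
    ρ b (τ.π s a y) = σ.π s (hp.tmul a b) y := by
  rw [h, (h.commute a b).eq, mul_apply_eq_comp]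

theorem null_eq (hσ : σ.Nondegenerate) (r : S) : σ.null r = τ.null r := by
  refine le_antisymm (fun y hy e he hr a => hσ.eq_zero fun x => ?_) fun y hy e he hr x => ?_
  · refine σ.map_mem_of_map_tmul_mem (J := ⊥) isClosed_singleton (fun c b => ?_) x
    rw [Submodule.mem_bot, h, mul_apply_eq_comp, h.apply_map_apply, hy e he hr, map_zero]
  · refine σ.map_mem_of_map_tmul_mem (J := ⊥) isClosed_singleton (fun a b => ?_) x
    rw [Submodule.mem_bot, ← h.apply_map_apply, hy e he hr, map_zero]

theorem unit_eq (hσ : σ.Nondegenerate) (r : S) : σ.unit r = τ.unit r :=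
  σ.unit_eq_of_null_eq (h.null_eq hσ r)

theorem map_mem_null {r : S} {y : H} (hy : y ∈ τ.null r) (b : B) : ρ b y ∈ τ.null r :=
  fun e he hr a => by
    rw [← mul_apply_eq_comp, (h.commute a b).eq, mul_apply_eq_comp, hy e he hr, map_zero]

theorem commute_unit_map (r : S) (b : B) : Commute (τ.unit r) (ρ b) :=
  τ.commute_unit_of_mapsTo_null (fun _ hy => h.map_mem_null hy b) fun _ hy => by
    rw [← StarHomClass.map_star]
    exact h.map_mem_null hy _

theorem star_map_tmul (c : 𝒜.fibre 1) (b : B) :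
    star (σ.π 1 (hp.tmul c b)) = star (τ.π 1 c) * ρ (star b) := by
  rw [← map_star_one, hp.star_tmul_one, h, map_star_one]

theorem mul_map_mul_map_tmul (T : H →L[ℂ] H) {s : S} (a : 𝒜.fibre s) (b b' : B) :
    T * ρ b * σ.π s (hp.tmul a b') = T * τ.π s a * ρ (b * b') := by
  rw [h, _root_.map_mul, (h.commute a b).symm.mul_mul_mul_comm]

theorem gram_tensorSection (hσ : σ.Nondegenerate) (ξ : S →₀ 𝒜.fibre 1) (e : B) :
    σ.gram (hp.tensorSection ξ e) = τ.gram ξ * ρ (star e * e) := by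
  rw [gram, hp.sum_sum_tensorSection ξ e (by simp) (by simp)]
  simp only [gram, Finsupp.sum_mul]
  refine Finsupp.sum_congr fun p _ => Finsupp.sum_congr fun t _ => ?_
  rw [h.star_map_tmul, h.mul_map_mul_map_tmul, h.unit_eq hσ, mul_assoc,
    ← (h.commute_unit_map _ _).eq, ← mul_assoc]

theorem average_tensorSection (hσ : σ.Nondegenerate) (ξ : S →₀ 𝒜.fibre 1) (e : B) {s : S}
    (a : 𝒜.fibre s) (b : B) :
    σ.average (hp.tensorSection ξ e) s (hp.tmul a b) =
      τ.average ξ s a * ρ (star e * b * e) := by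
  rw [average_apply, hp.sum_sum_tensorSection ξ e (by simp) (by simp)]
  simp only [average_apply, Finsupp.sum_mul]
  refine Finsupp.sum_congr fun p _ => Finsupp.sum_congr fun t _ => ?_
  rw [h.star_map_tmul, ← mul_assoc, h.mul_map_mul_map_tmul, h.mul_map_mul_map_tmul, h.unit_eq hσ]

end IsProduct

end FellBundle.HilbertRep

section DirectSum

variable {𝕜 ι : Type*} [NontriviallyNormedField 𝕜] {E : ι → Type*}
  [∀ i, NormedAddCommGroup (E i)] [∀ i, NormedSpace 𝕜 (E i)] {p : ENNReal} [Fact (1 ≤ p)]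

theorem lp_opNorm_le_of_forall_norm_le {T : lp E p →L[𝕜] lp E p} {T' : ∀ i, E i →L[𝕜] E i}
    (h : ∀ f i, T f i = T' i (f i)) {C : ℝ} (hC₀ : 0 ≤ C) (hC : ∀ i, ‖T' i‖ ≤ C) : ‖T‖ ≤ C := by
  have hT : T = lp.mapCLM p T' hC₀ hC := by
    ext f i
    exact h f i
  rw [hT]
  exact lp.norm_mapCLM_le p T' hC₀ hC

theorem norm_le_lp_opNorm {T : lp E p →L[𝕜] lp E p} {i : ι} {T' : E i →L[𝕜] E i}
    (h : ∀ f, T f i = T' (f i)) : ‖T'‖ ≤ ‖T‖ := by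
  classical
  have hp : p ≠ 0 := (zero_lt_one.trans_le Fact.out).ne'
  refine T'.opNorm_le_bound (norm_nonneg _) fun x => ?_
  calc ‖T' x‖ = ‖T (lp.single p i x) i‖ := by rw [h, lp.single_apply_self]
    _ ≤ ‖T (lp.single p i x)‖ := lp.norm_apply_le_norm hp _ _
    _ ≤ ‖T‖ * ‖lp.single p i x‖ := T.le_opNorm _
    _ = ‖T‖ * ‖x‖ := by rw [lp.norm_single (by positivity)]

end DirectSum

namespace FellBundle

variable {S : Type u} [InverseMonoid S] {𝒜 : FellBundle S}

namespace HilbertRep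

/-- A nondegenerate representation on a small Hilbert space is a summand of the universal
representation. -/
def toRep {H : Type u} [NormedAddCommGroup H] [InnerProductSpace ℂ H] [CompleteSpace H]
    (σ : 𝒜.HilbertRep H) (hσ : σ.Nondegenerate) : 𝒜.Rep where
  __ := σ
  H := H
  nondegenerate := Submodule.dense_iff_topologicalClosure_eq_top.mp hσ

end HilbertRep

namespace Rep

/-- The underlying representation, forgetting nondegeneracy. -/
def toHilbertRep (ρ : 𝒜.Rep) : 𝒜.HilbertRep ρ.H where
  __ := ρ

theorem nondegenerate_toHilbertRep (ρ : 𝒜.Rep) : ρ.toHilbertRep.Nondegenerate :=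
  Submodule.dense_iff_topologicalClosure_eq_top.mpr ρ.nondegenerate

end Rep

variable (𝒜) in
/-- The universal representation on all fibres simultaneously. -/
def univRep : 𝒜.HilbertRep 𝒜.univSpace where
  π s :=
    { toFun := 𝒜.univ s
      map_add' := fun a b => by
        ext f ρ
        exact congrArg (· (f ρ)) (map_add (ρ.π s) a b)
      map_smul' := fun z a => by
        ext f ρ
        exact congrArg (· (f ρ)) (map_smul (ρ.π s) z a) }
  map_mul s t a b := by
    ext f ρ
    exact congrArg (· (f ρ)) (ρ.map_mul s t a b)
  map_star s a := by
    rw [ContinuousLinearMap.star_eq_adjoint, ContinuousLinearMap.eq_adjoint_iff]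
    intro f g
    simp only [lp.inner_eq_tsum]
    refine tsum_congr fun ρ => ?_
    calc inner ℂ (ρ.π s⁻¹ (𝒜.bundle.star s a) (f ρ)) (g ρ)
        = inner ℂ (star (ρ.π s a) (f ρ)) (g ρ) := by rw [ρ.map_star]
      _ = inner ℂ (f ρ) (ρ.π s a (g ρ)) := ρ.toHilbertRep.inner_star_apply_left a _ _
  map_incl s t h a := by
    ext f ρ
    exact congrArg (· (f ρ)) (ρ.map_incl s t h a)

theorem intertwines_univRep (ρ : 𝒜.Rep) : HilbertRep.Intertwines 𝒜.univRep ρ.toHilbertRep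
    (lp.evalCLM ℂ (fun ρ : 𝒜.Rep => ρ.H) 2 ρ) := fun _ _ _ => rfl

theorem norm_gram_univRep_le {ξ : S →₀ 𝒜.fibre 1} {C : ℝ} (hC₀ : 0 ≤ C)
    (hC : ∀ ρ : 𝒜.Rep, ‖ρ.toHilbertRep.gram ξ‖ ≤ C) : ‖𝒜.univRep.gram ξ‖ ≤ C :=
  lp_opNorm_le_of_forall_norm_le (fun f ρ => (intertwines_univRep ρ).gram_apply ξ f) hC₀ hC

theorem norm_average_sub_univRep_le {ξ : S →₀ 𝒜.fibre 1} {s : S} {a : 𝒜.fibre s} {C : ℝ}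
    (hC₀ : 0 ≤ C)
    (hC : ∀ ρ : 𝒜.Rep, ‖ρ.toHilbertRep.average ξ s a - ρ.toHilbertRep.π s a‖ ≤ C) :
    ‖𝒜.univRep.average ξ s a - 𝒜.univRep.π s a‖ ≤ C :=
  lp_opNorm_le_of_forall_norm_le (fun f ρ => (intertwines_univRep ρ).average_sub_apply ξ a f)
    hC₀ hC

namespace HilbertRep.Nondegenerate

variable {H : Type u} [NormedAddCommGroup H] [InnerProductSpace ℂ H] [CompleteSpace H]
  {σ : 𝒜.HilbertRep H}

theorem norm_gram_le (hσ : σ.Nondegenerate) (ξ : S →₀ 𝒜.fibre 1) :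
    ‖σ.gram ξ‖ ≤ ‖𝒜.univRep.gram ξ‖ :=
  norm_le_lp_opNorm (i := σ.toRep hσ) fun f =>
    (intertwines_univRep (σ.toRep hσ)).gram_apply ξ f

theorem norm_average_sub_le (hσ : σ.Nondegenerate) (ξ : S →₀ 𝒜.fibre 1) {s : S}
    (a : 𝒜.fibre s) :
    ‖σ.average ξ s a - σ.π s a‖ ≤ ‖𝒜.univRep.average ξ s a - 𝒜.univRep.π s a‖ :=
  norm_le_lp_opNorm (i := σ.toRep hσ) fun f =>
    (intertwines_univRep (σ.toRep hσ)).average_sub_apply ξ a f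

end HilbertRep.Nondegenerate

end FellBundle

namespace FellBundle

variable {S : Type u} [InverseMonoid S] {𝒜 : FellBundle S} {B : Type u} [NonUnitalCStarAlgebra B]
  {p : 𝒜.fibre 1 ⊗[ℂ] B → ℝ} {hp : 𝒜.IsBundleNorm B p}

namespace HilbertRep

theorem tendsto_average_of_tendsto_tmul {H : Type*} [NormedAddCommGroup H]
    [InnerProductSpace ℂ H] [CompleteSpace H] {σ : hp.tensor.HilbertRep H} {κ : Type*}
    {l : Filter κ} {η : κ → S →₀ hp.tensor.fibre 1} {C : ℝ} (hC : ∀ k, ‖σ.gram (η k)‖ ≤ C)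
    {s : S} (h : ∀ a b, Tendsto (fun k => σ.average (η k) s (hp.tmul a b)) l
      (𝓝 (σ.π s (hp.tmul a b)))) (x : hp.tensor.fibre s) :
    Tendsto (fun k => σ.average (η k) s x) l (𝓝 (σ.π s x)) := by
  let T (k : κ) : hp.tensor.fibre s →L[ℂ] H →L[ℂ] H :=
    (σ.average (η k) s).mkContinuous ‖σ.gram (η k)‖ (σ.norm_average_le (η k))
  let R : hp.tensor.fibre s →L[ℂ] H →L[ℂ] H :=
    (σ.π s).mkContinuous 1 fun x => (σ.norm_le s x).trans_eq (one_mul _).symm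
  have hT (k : κ) : ‖T k‖ ≤ C :=
    (LinearMap.mkContinuous_norm_le _ (norm_nonneg _) _).trans (hC k)
  refine tendsto_apply_of_dense_span (R := R) (hp.dense_span_tmul s) hT (fun y hy => ?_) x
  obtain ⟨a, b, rfl⟩ := hy
  exact h a b

variable {H : Type u} [NormedAddCommGroup H] [InnerProductSpace ℂ H] [CompleteSpace H]
  {σ : hp.tensor.HilbertRep H}

theorem Nondegenerate.norm_gram_tensorSection_le (hσ : σ.Nondegenerate) (ξ : S →₀ 𝒜.fibre 1)
    (e : B) : ‖σ.gram (hp.tensorSection ξ e)‖ ≤ ‖𝒜.univRep.gram ξ‖ * ‖e‖ ^ 2 := by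
  obtain ⟨τ, ρ, h⟩ := hσ.exists_isProduct
  calc ‖σ.gram (hp.tensorSection ξ e)‖ = ‖τ.gram ξ * ρ (star e * e)‖ := by
        rw [h.gram_tensorSection hσ]
    _ ≤ ‖τ.gram ξ‖ * ‖ρ (star e * e)‖ := norm_mul_le _ _
    _ ≤ ‖𝒜.univRep.gram ξ‖ * ‖star e * e‖ := by
        gcongr
        · exact (h.nondegenerate hσ).norm_gram_le ξ
        · exact NonUnitalStarAlgHom.norm_apply_le ρ _
    _ = ‖𝒜.univRep.gram ξ‖ * ‖e‖ ^ 2 := by rw [CStarRing.norm_star_mul_self, sq]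

theorem Nondegenerate.norm_average_tensorSection_sub_le (hσ : σ.Nondegenerate)
    (ξ : S →₀ 𝒜.fibre 1) (e : B) {s : S} (a : 𝒜.fibre s) (b : B) :
    ‖σ.average (hp.tensorSection ξ e) s (hp.tmul a b) - σ.π s (hp.tmul a b)‖ ≤
      ‖𝒜.univRep.average ξ s a - 𝒜.univRep.π s a‖ * ‖star e * b * e‖ +
        ‖a‖ * ‖star e * b * e - b‖ := by
  obtain ⟨τ, ρ, h⟩ := hσ.exists_isProduct
  have h_split : σ.average (hp.tensorSection ξ e) s (hp.tmul a b) - σ.π s (hp.tmul a b) =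
      (τ.average ξ s a - τ.π s a) * ρ (star e * b * e) + τ.π s a * ρ (star e * b * e - b) := by
    rw [h.average_tensorSection hσ, h, map_sub, sub_mul, mul_sub, sub_add_sub_cancel]
  rw [h_split]
  refine (norm_add_le _ _).trans (add_le_add ?_ ?_)
  · refine (norm_mul_le _ _).trans ?_
    gcongr
    · exact (h.nondegenerate hσ).norm_average_sub_le ξ a
    · exact NonUnitalStarAlgHom.norm_apply_le ρ _
  · refine (norm_mul_le _ _).trans ?_
    gcongr
    · exact τ.norm_le s a
    · exact NonUnitalStarAlgHom.norm_apply_le ρ _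

end HilbertRep

theorem norm_gram_univRep_tensorSection_le (ξ : S →₀ 𝒜.fibre 1) (e : B) :
    ‖hp.tensor.univRep.gram (hp.tensorSection ξ e)‖ ≤ ‖𝒜.univRep.gram ξ‖ * ‖e‖ ^ 2 :=
  norm_gram_univRep_le (by positivity) fun ρ =>
    ρ.nondegenerate_toHilbertRep.norm_gram_tensorSection_le ξ e

theorem norm_average_univRep_tensorSection_sub_le (ξ : S →₀ 𝒜.fibre 1) (e : B) {s : S}
    (a : 𝒜.fibre s) (b : B) :
    ‖hp.tensor.univRep.average (hp.tensorSection ξ e) s (hp.tmul a b) -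
        hp.tensor.univRep.π s (hp.tmul a b)‖ ≤
      ‖𝒜.univRep.average ξ s a - 𝒜.univRep.π s a‖ * ‖star e * b * e‖ +
        ‖a‖ * ‖star e * b * e - b‖ :=
  norm_average_sub_univRep_le (by positivity) fun ρ =>
    ρ.nondegenerate_toHilbertRep.norm_average_tensorSection_sub_le ξ e a b

theorem tendsto_average_tensorSection {α κ : Type*} {l : Filter α} {l' : Filter κ}
    {ξ : α → S →₀ 𝒜.fibre 1} {e : κ → B} (he : IsContractiveApproximateUnit l' e) {s : S}
    {a : 𝒜.fibre s}
    (hξ : Tendsto (fun i => 𝒜.univRep.average (ξ i) s a) l (𝓝 (𝒜.univRep.π s a))) (b : B) :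
    Tendsto (fun k : α × κ => hp.tensor.univRep.average (hp.tensorSection (ξ k.1) (e k.2)) s
      (hp.tmul a b)) (l ×ˢ l') (𝓝 (hp.tensor.univRep.π s (hp.tmul a b))) := by
  have hξ' := (tendsto_iff_norm_sub_tendsto_zero.mp hξ).comp (tendsto_fst (g := l'))
  have he' := (he.tendsto_conj b).comp (tendsto_snd (f := l))
  have h_lim := (hξ'.mul he'.norm).add ((tendsto_iff_norm_sub_tendsto_zero.mp he').const_mul ‖a‖)
  rw [zero_mul, mul_zero, add_zero] at h_lim
  exact tendsto_iff_norm_sub_tendsto_zero.mpr <| squeeze_zero (fun _ => norm_nonneg _)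
    (fun k => norm_average_univRep_tensorSection_sub_le (ξ k.1) (e k.2) a b) h_lim

theorem approximationProperty_iff : 𝒜.ApproximationProperty ↔
    ∃ (ι : Type u) (_ : Preorder ι) (_ : IsDirectedOrder ι) (_ : Nonempty ι)
      (ξ : ι → S →₀ 𝒜.fibre 1), (∀ i, 𝒜.IsSection (ξ i)) ∧
      (∃ C, ∀ i, ‖𝒜.univRep.gram (ξ i)‖ ≤ C) ∧
      ∀ (s : S) (a : 𝒜.fibre s), Tendsto (fun i => 𝒜.univRep.average (ξ i) s a) atTop
        (𝓝 (𝒜.univRep.π s a)) :=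
  Iff.rfl

end FellBundle

theorem isDirectedOrder_prod (ι κ : Type*) [Preorder ι] [Preorder κ] [IsDirectedOrder ι]
    [IsDirectedOrder κ] : IsDirectedOrder (ι × κ) where
  directed k k' := by
    obtain ⟨i, h₁, h₂⟩ := exists_ge_ge k.1 k'.1
    obtain ⟨j, h₃, h₄⟩ := exists_ge_ge k.2 k'.2
    exact ⟨(i, j), ⟨h₁, h₃⟩, ⟨h₂, h₄⟩⟩

theorem proposition4p20_general {S : Type u} [InverseMonoid S] {𝒜 : FellBundle S} {B : Type u}
    [NonUnitalCStarAlgebra B] {p : 𝒜.fibre 1 ⊗[ℂ] B → ℝ} (hp : 𝒜.IsBundleNorm B p)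
    (h : 𝒜.ApproximationProperty) : hp.tensor.ApproximationProperty := by
  obtain ⟨ι, _, _, _, ξ, h_section, ⟨C, hC⟩, h_lim⟩ := FellBundle.approximationProperty_iff.mp h
  obtain ⟨κ, _, _, _, e, he⟩ := exists_isContractiveApproximateUnit B
  have h_bound (k : ι × κ) : ‖hp.tensor.univRep.gram (hp.tensorSection (ξ k.1) (e k.2))‖ ≤ C :=
    (FellBundle.norm_gram_univRep_tensorSection_le _ _).trans <|
      (mul_le_of_le_one_right (norm_nonneg _) <|
        pow_le_one₀ (norm_nonneg _) (he.norm_le_one k.2)).trans (hC k.1)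
  refine FellBundle.approximationProperty_iff.mpr ⟨ι × κ, inferInstance, isDirectedOrder_prod ι κ,
    inferInstance, fun k => hp.tensorSection (ξ k.1) (e k.2),
    fun k => hp.isSection_tensorSection (h_section k.1) _, ⟨C, h_bound⟩, fun s => ?_⟩
  refine FellBundle.HilbertRep.tendsto_average_of_tendsto_tmul h_bound fun a b => ?_
  rw [← prod_atTop_atTop_eq]
  exact FellBundle.tendsto_average_tensorSection he (h_lim s a) b

end

/-- If a Fell bundle over an inverse semigroup (with unit) has the approximation property, then so
do its minimal and maximal tensor products with any `C*`-algebra `B`. -/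
theorem proposition4p20 {S : Type u} [InverseMonoid S] (𝒜 : FellBundle S) (B : Type u)
    [NonUnitalCStarAlgebra B] (h : 𝒜.ApproximationProperty) :
    (𝒜.minTensor B).ApproximationProperty ∧ (𝒜.maxTensor B).ApproximationProperty :=
  ⟨proposition4p20_general _ h, proposition4p20_general _ h⟩
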